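/- Let $g\ge 0$, let $a_1,\dots,a_{g+3}\in\mathbb C$ be distinct, and put $\Pi(X)=\prod_{i=1}^{g+3}(X-a_i)$. **The algebra $A_{\mathcal X}$.** Let $\mathbb C(\hat x_1,\dots,\hat x_g)[\hat y_1,\dots,\hat y_g]$ be the crossed product of the field $\mathbb C(\hat x_1,\dots,\hat x_g)$ by the abelian Lie algebra $\bigoplus_\alpha\mathbb C\hat y_\alpha$, with $[\hat y_\alpha,\hat y_\beta]=0$ and $[\hat y_\alpha,f]=2\Pi(\hat x_\alpha)\,\partial f/\partial\hat x_\alpha$. The symmetric group $\mathfrak S_g$ permutes the pairs $(\hat x_\alpha,\hat y_\alpha)$; $A_{\mathcal X}$ is the algebra of invariants. For $\phi\in\mathbb C[X]$ set $\hat Y[\phi]=\sum_\alpha(\phi/\Pi)(\hat x_\alpha)\,\hat y_\alpha\in A_{\mathcal X}$. **The algebra $A_{\mathcal U}$.** Let $V=\bigoplus_{i=1}^{g+3}\mathbb C f_i$ with dual basis $(f_i^*)$ of $V^*$, let $W=\mathrm{Span}(\sum_i f_i,\sum_i a_if_i)$, and let $\mathcal O=\mathbb C(V)_W$ be the localization of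 $S(V)$ at the prime ideal generated by $W$, so that $\mathcal O/(W)=\mathbb C(V/W)$. Let $A=\mathcal O[V^*]$ be the crossed product of $\mathcal O$ by the commuting derivations $f_i^*=\partial/\partial f_i$ (a localization of the Weyl algebra). For $d\in\mathbb Z$ let $A^d\subset A$ be the part of degree $d$, where $V$ has degree $1$ and $V^*$ has degree $-1$. Put $$N^0=\{f\in A^0\mid fW\subset WA^0\},\qquad \Phi=\sum_i f_if_i^*,\qquad A_{\mathcal U}=N^0/(WA^{-1}+N^0\Phi).$$ Put $h_i=-2f_if_i^*$, let $\bar f_i\in A_{\mathcal U}$ be the class of $f_i/\sum_j a_j^2f_j$, and let $P_f(X)=\Pi(X)\sum_i\frac{f_i}{X-a_i}\in\mathbb C(V/W)[X]$. For $\phi\in\mathbb C[X]$ set $$\hat W[\phi]=\mathrm{Res}_{t=\infty}\Big(\sum_i\Big(\frac{P_f'}{P_f}(t)-\frac{P_f'}{P_f}(a_i)\Big)\frac{h_i}{t-a_i}\,\phi(t)\,dt\Big)=\sum_i\rho_i h_i ,\qquad \rho_i\in\mathbb C(V/W),$$ with the convention $\mathrm{Res}_{t=\infty}dt/t=-1$.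 This is an element of $A/WA$, a left $\mathbb C(V/W)$-module; its representatives of degree $0$ are the elements $\sum_i r_ih_i\in A$ with $r_i\in\mathcal O$ homogeneous of degree $0$ and $r_i\equiv\rho_i$ modulo $(W)$. **Theorem.** (1) For every $\phi\in\mathbb C[X]$ such representatives of $\hat W[\phi]$ exist, and all of them belong to $N^0$; their image in $A_{\mathcal U}$ is also denoted $\hat W[\phi]$ (it does not depend on the representative). (2) There is a unique $\mathbb C$-algebra isomorphism $\hat\Lambda:A_{\mathcal X}\to A_{\mathcal U}$ such that $$\sum_{\alpha_1<\dots<\alpha_k}\hat x_{\alpha_1}\cdots\hat x_{\alpha_k}\ \mapsto\ \sum_{i=1}^{g+3}\bar f_i\sum_{\substack{j_1<\dots<j_{k+2}\\ j_1,\dots,j_{k+2}\ne i}}a_{j_1}\cdots a_{j_{k+2}}\quad(1\le k\le g),\qquad \hat Y[\phi]\mapsto\hat W[\phi]\quad(\phi\in\mathbb C[X]).$$ (3) $\hat\Lambda$ quantizes the classical isomorphism $\Lambda$, in the following sense. Let $S_{\mathcal X}=\mathbb C(x_1,\dots,x_g)[y_1,\dots,y_g]^{\mathfrak S_g}$, with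 Poisson bracket $\{y_\alpha,f\}=2\Pi(x_\alpha)\,\partial f/\partial x_\alpha$, $\{y_\alpha,y_\beta\}=0$, $\{f,f'\}=0$, and let $S_{\mathcal U}$ be the quotient of $\{p\in(\mathcal O\otimes S(V^*))^0\mid\{p,W\}\subset W(\mathcal O\otimes S(V^*))^0\}$ by the ideal generated by $W(\mathcal O\otimes S(V^*))^{-1}$ and $\Phi$, with the bracket induced by $\{\xi,v\}=\langle\xi,v\rangle$ ($\xi\in V^*$, $v\in V$); both are graded by the degree in the $y_\alpha$, resp. in $V^*$. There is a unique isomorphism of graded Poisson algebras $\Lambda:S_{\mathcal X}\to S_{\mathcal U}$ given on elementary symmetric functions and on $Y[\phi]=\sum_\alpha(\phi/\Pi)(x_\alpha)y_\alpha$ by the commutative versions of the formulas in (2). Filter $A_{\mathcal X}$ by the order in the $\hat y_\alpha$, and $A_{\mathcal U}$ by the order in $V^*$ of representatives in $N^0$. Then $\hat\Lambda$ maps the $k$-th step of the filtration onto the $k$-th step for all $k$, and its associated graded is $\Lambda$: if $x\in A_{\mathcal X}$ has order at most $k$ and symbol $p$ in degree $k$, then $\hat\Lambda(x)$ has symbol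 $\Lambda(p)$ in degree $k$. -/

import Mathlib

namespace GNR

set_option linter.unusedSectionVars false

noncomputable section

/-! ### Extending derivations to localizations -/

section LocalizedDerivation

variable {R S : Type} [CommRing R] [CommRing S] [Algebra ℂ R] [Algebra ℂ S] [Algebra R S]
  [IsScalarTower ℂ R S] (M : Submonoid R) [IsLocalization M S]

/-- The ring homomorphism `r ↦ r + ε D r` into the dual numbers over `S`. -/
def dualHom (S : Type) [CommRing S] [Algebra R S] (D : Derivation ℂ R R) :
    R →+* TrivSqZeroExt S S where
  toFun r := (algebraMap R S r, algebraMap R S (D r))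
  map_one' := TrivSqZeroExt.ext (map_one _) (by
    change algebraMap R S (D 1) = 0
    simp)
  map_mul' x y := TrivSqZeroExt.ext (map_mul _ _ _) (by
    change algebraMap R S (D (x * y))
      = algebraMap R S x * algebraMap R S (D y) + algebraMap R S (D x) * algebraMap R S y
    rw [Derivation.leibniz, map_add, smul_eq_mul, smul_eq_mul, map_mul, map_mul]
    ring)
  map_zero' := TrivSqZeroExt.ext (map_zero _) (by
    change algebraMap R S (D 0) = 0
    simp)
  map_add' x y := TrivSqZeroExt.ext (map_add _ _ _) (by
    change algebraMap R S (D (x + y)) = algebraMap R S (D x) + algebraMap R S (D y)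
    rw [map_add, map_add])

theorem dualHom_isUnit (D : Derivation ℂ R R) (m : M) : IsUnit (dualHom S D m) := by
  rw [TrivSqZeroExt.isUnit_iff_isUnit_fst]
  exact IsLocalization.map_units S m

/-- The ring homomorphism `z ↦ z + ε D z` on the localization. -/
def locDualHom (D : Derivation ℂ R R) : S →+* TrivSqZeroExt S S :=
  IsLocalization.lift (M := M) (S := S) (g := dualHom S D) (dualHom_isUnit M D)

theorem fst_locDualHom (D : Derivation ℂ R R) (z : S) : (locDualHom M D z).fst = z := by
  have h : ((TrivSqZeroExt.fstHom S S S : TrivSqZeroExt S S →ₐ[S] S) :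
      TrivSqZeroExt S S →+* S).comp (locDualHom M D) = RingHom.id S := by
    apply IsLocalization.ringHom_ext M
    ext r
    change (locDualHom M D (algebraMap R S r)).fst = algebraMap R S r
    rw [locDualHom, IsLocalization.lift_eq]
    rfl
  simpa using congrArg (fun f : S →+* S => f z) h

theorem locDualHom_algebraMap (D : Derivation ℂ R R) (r : R) :
    (locDualHom M D (algebraMap R S r)).snd = algebraMap R S (D r) := by
  rw [locDualHom, IsLocalization.lift_eq]
  rfl

/-- The unique extension of the derivation `D` of `R` to the localization `S = M⁻¹R`. -/
def locDer (D : Derivation ℂ R R) : Derivation ℂ S S :=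
  Derivation.mk'
    { toFun := fun z => (locDualHom M D z).snd
      map_add' := fun x y => by simp
      map_smul' := fun c x => by
        have h : (locDualHom M D (algebraMap ℂ S c)).snd = 0 := by
          rw [IsScalarTower.algebraMap_apply ℂ R S, locDualHom_algebraMap]
          simp
        rw [Algebra.smul_def, map_mul, TrivSqZeroExt.snd_mul, h, fst_locDualHom]
        simp [Algebra.smul_def] }
    (fun x y => by
      simp only [LinearMap.coe_mk, AddHom.coe_mk, map_mul, TrivSqZeroExt.snd_mul,
        fst_locDualHom]
      simp [mul_comm])

theorem locDer_algebraMap (D : Derivation ℂ R R) (r : R) :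
    locDer M D (algebraMap R S r) = algebraMap R S (D r) :=
  locDualHom_algebraMap M D r

end LocalizedDerivation

/-! ### Crossed products by commuting derivations and their classical limits -/

section Crossed

variable {R ι : Type} [CommRing R] [Algebra ℂ R] (δ : ι → Derivation ℂ R R)

/-- Defining relations of the crossed product of `R` by the abelian Lie algebra with basis
`(∂ᵢ)`, acting on `R` by the derivations `δᵢ`: the elements of `R` multiply as in `R`, the `∂ᵢ`
commute with each other, and `[∂ᵢ, r] = δᵢ r`. -/
inductive CrossedRel : FreeAlgebra ℂ (R ⊕ ι) → FreeAlgebra ℂ (R ⊕ ι) → Prop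
  | add (r s : R) : CrossedRel (FreeAlgebra.ι ℂ (Sum.inl (r + s)))
      (FreeAlgebra.ι ℂ (Sum.inl r) + FreeAlgebra.ι ℂ (Sum.inl s))
  | mul (r s : R) : CrossedRel (FreeAlgebra.ι ℂ (Sum.inl (r * s)))
      (FreeAlgebra.ι ℂ (Sum.inl r) * FreeAlgebra.ι ℂ (Sum.inl s))
  | scalar (c : ℂ) : CrossedRel (FreeAlgebra.ι ℂ (Sum.inl (algebraMap ℂ R c)))
      (algebraMap ℂ (FreeAlgebra ℂ (R ⊕ ι)) c)
  | comm (i j : ι) : CrossedRel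
      (FreeAlgebra.ι ℂ (Sum.inr i) * FreeAlgebra.ι ℂ (Sum.inr j))
      (FreeAlgebra.ι ℂ (Sum.inr j) * FreeAlgebra.ι ℂ (Sum.inr i))
  | leibniz (i : ι) (r : R) : CrossedRel
      (FreeAlgebra.ι ℂ (Sum.inr i) * FreeAlgebra.ι ℂ (Sum.inl r))
      (FreeAlgebra.ι ℂ (Sum.inl r) * FreeAlgebra.ι ℂ (Sum.inr i)
        + FreeAlgebra.ι ℂ (Sum.inl (δ i r)))

/-- The crossed product algebra `R[∂ᵢ, i ∈ ι]`. -/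
abbrev CrossedProduct : Type := RingQuot (CrossedRel δ)

/-- The homomorphism from `R` to the crossed product. -/
def coef : R →ₐ[ℂ] CrossedProduct δ where
  toFun r := RingQuot.mkAlgHom ℂ (CrossedRel δ) (FreeAlgebra.ι ℂ (Sum.inl r))
  map_one' := by
    have h := RingQuot.mkAlgHom_rel ℂ (CrossedRel.scalar (δ := δ) 1)
    simpa using h
  map_mul' r s := by
    rw [← map_mul]
    exact RingQuot.mkAlgHom_rel ℂ (CrossedRel.mul (δ := δ) r s)
  map_zero' := by
    have h := RingQuot.mkAlgHom_rel ℂ (CrossedRel.scalar (δ := δ) 0)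
    simpa using h
  map_add' r s := by
    rw [← map_add]
    exact RingQuot.mkAlgHom_rel ℂ (CrossedRel.add (δ := δ) r s)
  commutes' c := by
    have h := RingQuot.mkAlgHom_rel ℂ (CrossedRel.scalar (δ := δ) c)
    rw [h, AlgHom.commutes]

/-- The generators `∂ᵢ` of the crossed product. -/
def gen (i : ι) : CrossedProduct δ :=
  RingQuot.mkAlgHom ℂ (CrossedRel δ) (FreeAlgebra.ι ℂ (Sum.inr i))

theorem gen_comm (i j : ι) : Commute (gen δ i) (gen δ j) := by
  have h := RingQuot.mkAlgHom_rel ℂ (CrossedRel.comm (δ := δ) i j)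
  rw [map_mul, map_mul] at h
  exact h

theorem gen_mul_coef (i : ι) (r : R) :
    gen δ i * coef δ r = coef δ r * gen δ i + coef δ (δ i r) := by
  have h := RingQuot.mkAlgHom_rel ℂ (CrossedRel.leibniz (δ := δ) i r)
  rw [map_add, map_mul, map_mul] at h
  exact h

/-- Automorphisms of `R` that permute the derivations act on the crossed product. -/
def permHom (e : R →ₐ[ℂ] R) (σ : ι → ι) (h : ∀ i r, e (δ i r) = δ (σ i) (e r)) :
    CrossedProduct δ →ₐ[ℂ] CrossedProduct δ :=
  RingQuot.liftAlgHom ℂ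
    ⟨FreeAlgebra.lift ℂ (Sum.elim (fun r => coef δ (e r)) (fun i => gen δ (σ i))), by
      intro x y hxy
      cases hxy with
      | add r s => simp
      | mul r s => simp
      | scalar c => simp
      | comm i j => simpa using (gen_comm δ (σ i) (σ j)).eq
      | leibniz i r => simp [gen_mul_coef, h]⟩

theorem permHom_coef (e : R →ₐ[ℂ] R) (σ : ι → ι) (h : ∀ i r, e (δ i r) = δ (σ i) (e r)) (r : R) :
    permHom δ e σ h (coef δ r) = coef δ (e r) := by
  change permHom δ e σ h (RingQuot.mkAlgHom ℂ (CrossedRel δ) _) = _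
  simp [permHom, RingQuot.liftAlgHom_mkAlgHom_apply]

theorem permHom_gen (e : R →ₐ[ℂ] R) (σ : ι → ι) (h : ∀ i r, e (δ i r) = δ (σ i) (e r)) (i : ι) :
    permHom δ e σ h (gen δ i) = gen δ (σ i) := by
  change permHom δ e σ h (RingQuot.mkAlgHom ℂ (CrossedRel δ) _) = _
  simp [permHom, RingQuot.liftAlgHom_mkAlgHom_apply]

variable [Fintype ι] [DecidableEq ι]

theorem genPow_pairwise (m : ι →₀ ℕ) :
    ((Finset.univ : Finset ι) : Set ι).Pairwise
      (Function.onFun Commute fun i => gen δ i ^ m i) :=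
  fun i _ j _ _ => (gen_comm δ i j).pow_pow _ _

/-- The monomial `∏ᵢ ∂ᵢ ^ mᵢ`. -/
def genPow (m : ι →₀ ℕ) : CrossedProduct δ :=
  Finset.univ.noncommProd (fun i => gen δ i ^ m i) (genPow_pairwise δ m)

/-- The normal ordering map `R ⊗ S(⊕ ℂ ∂ᵢ) = R[ξᵢ] → R[∂ᵢ]`, `r ξ^m ↦ r ∂^m`
(functions on the left). -/
def nord : MvPolynomial ι R →ₗ[ℂ] CrossedProduct δ :=
  (Finsupp.lsum ℂ fun m : ι →₀ ℕ =>
      (LinearMap.mulRight ℂ (genPow δ m)).comp (coef δ).toLinearMap).comp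
    ((MvPolynomial.basisMonomials ι R).repr.toLinearMap.restrictScalars ℂ)

/-- Order filtration of the crossed product: operators of order at most `k`. -/
def filt (k : ℤ) : Submodule ℂ (CrossedProduct δ) :=
  Submodule.map (nord δ)
    { carrier := {p | ∀ m, p.coeff m ≠ 0 → (m.degree : ℤ) ≤ k}
      add_mem' := by
        intro p q hp hq m hm
        by_contra hk
        apply hm
        rw [MvPolynomial.coeff_add, not_not.mp (mt (hp m) hk), not_not.mp (mt (hq m) hk), add_zero]
      zero_mem' := by intro m hm; simp at hm
      smul_mem' := by
        intro c p hp m hm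
        apply hp m
        intro h0
        apply hm
        simp [h0] }

/-- `p` is the symbol of order `k` of `a`. -/
def HasSymbol (k : ℕ) (a : CrossedProduct δ) (p : MvPolynomial ι R) : Prop :=
  p.IsHomogeneous k ∧ a - nord δ p ∈ filt δ ((k : ℤ) - 1)


/-- The derivation `D` applied to the coefficients of a polynomial in the `ξᵢ`. -/
def coeffD (D : Derivation ℂ R R) : MvPolynomial ι R →ₗ[ℂ] MvPolynomial ι R :=
  ((MvPolynomial.basisMonomials ι R).repr.symm.toLinearMap.restrictScalars ℂ).comp
    ((Finsupp.mapRange.linearMap (D : R →ₗ[ℂ] R)).comp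
      ((MvPolynomial.basisMonomials ι R).repr.toLinearMap.restrictScalars ℂ))

/-- The Poisson bracket on `R[ξᵢ]` with `{ξᵢ, r} = δᵢ r`, `{ξᵢ, ξⱼ} = 0`, `{r, s} = 0`. -/
def bracket (p q : MvPolynomial ι R) : MvPolynomial ι R :=
  ∑ i, (MvPolynomial.pderiv i p * coeffD (δ i) q - coeffD (δ i) p * MvPolynomial.pderiv i q)

theorem coeff_coeffD (D : Derivation ℂ R R) (p : MvPolynomial ι R) (m : ι →₀ ℕ) :
    (coeffD D p).coeff m = D (p.coeff m) := by
  have h1 : ∀ (q : MvPolynomial ι R), (MvPolynomial.basisMonomials ι R).repr q m = q.coeff m := by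
    intro q; rfl
  rw [← h1, coeffD]
  simp only [LinearMap.comp_apply, LinearMap.restrictScalars_apply, LinearEquiv.coe_coe,
    LinearEquiv.apply_symm_apply, Finsupp.mapRange.linearMap_apply, Finsupp.mapRange_apply]
  rfl

theorem bracket_C (p : MvPolynomial ι R) (r : R) :
    bracket δ p (MvPolynomial.C r) = ∑ i, MvPolynomial.pderiv i p * MvPolynomial.C (δ i r) := by
  have h : ∀ i, coeffD (δ i) (MvPolynomial.C r : MvPolynomial ι R) = MvPolynomial.C (δ i r) := by
    intro i
    classical
    ext m
    rw [coeff_coeffD, MvPolynomial.coeff_C, MvPolynomial.coeff_C]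
    split_ifs <;> simp
  simp [bracket, h]

theorem nord_monomial (m : ι →₀ ℕ) (r : R) :
    nord δ (MvPolynomial.monomial m r) = coef δ r * genPow δ m := by
  have h : (MvPolynomial.basisMonomials ι R).repr (MvPolynomial.monomial m r)
      = Finsupp.single m r := rfl
  simp [nord, h]

theorem genPow_zero : genPow δ 0 = 1 := by
  unfold genPow
  rw [Finset.noncommProd_eq_pow_card _ _ _ 1 (by simp)]
  simp

theorem genPow_add (m n : ι →₀ ℕ) : genPow δ (m + n) = genPow δ m * genPow δ n := by
  unfold genPow
  rw [← Finset.noncommProd_mul_distrib _ _ _ _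
    (fun i _ j _ _ => (gen_comm δ i j).pow_pow _ _)]
  refine Finset.noncommProd_congr rfl (fun i _ => ?_) _
  simp [pow_add]

theorem genPow_single (i : ι) : genPow δ (Finsupp.single i 1) = gen δ i := by
  have h := Finset.noncommProd_eq_pow_card (Finset.univ.erase i)
    (fun j => gen δ j ^ (Finsupp.single i 1 : ι →₀ ℕ) j)
    (fun i _ j _ _ => (gen_comm δ i j).pow_pow _ _) 1 (by
      intro j hj
      rw [Finsupp.single_apply, if_neg (fun h => Finset.ne_of_mem_erase hj h.symm), pow_zero])
  refine (Finset.mul_noncommProd_erase _ (Finset.mem_univ i) _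
    (genPow_pairwise δ (Finsupp.single i 1))).symm.trans ?_
  refine (congrArg _ h).trans ?_
  simp

theorem coef_mul_nord (r : R) (p : MvPolynomial ι R) :
    coef δ r * nord δ p = nord δ (MvPolynomial.C r * p) := by
  induction p using MvPolynomial.induction_on' with
  | monomial m s => rw [MvPolynomial.C_mul_monomial, nord_monomial, nord_monomial, map_mul,
      mul_assoc]
  | add p q hp hq => rw [map_add, mul_add, hp, hq, mul_add, map_add]

theorem gen_mul_nord (i : ι) (p : MvPolynomial ι R) :
    gen δ i * nord δ p = nord δ (MvPolynomial.X i * p) + nord δ (coeffD (δ i) p) := by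
  induction p using MvPolynomial.induction_on' with
  | monomial m s =>
    have h : coeffD (δ i) (MvPolynomial.monomial m s) = MvPolynomial.monomial m (δ i s) := by
      ext k
      rw [coeff_coeffD, MvPolynomial.coeff_monomial, MvPolynomial.coeff_monomial]
      split_ifs <;> simp
    rw [h, MvPolynomial.X, MvPolynomial.monomial_mul, one_mul, nord_monomial, nord_monomial,
      nord_monomial, genPow_add, genPow_single, ← mul_assoc, gen_mul_coef, add_mul, mul_assoc]
  | add p q hp hq =>
    rw [map_add, mul_add, hp, hq, mul_add, map_add, map_add, map_add]
    abel

/-! Given homogeneous components `G d` of `R`, the elements of degree `d` when every `ξᵢ`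
(resp. `∂ᵢ`) is given degree `-1`. -/

variable (G : ℤ → Submodule ℂ R)

/-- Elements `∑ rₘ ξ^m` of `R[ξ]` with `rₘ ∈ R` homogeneous of degree `d + |m|`. -/
def clPiece (ι : Type) (d : ℤ) : Submodule ℂ (MvPolynomial ι R) where
  carrier := {p | ∀ m, p.coeff m ∈ G (d + m.degree)}
  add_mem' := by
    intro p q hp hq m
    rw [MvPolynomial.coeff_add]
    exact add_mem (hp m) (hq m)
  zero_mem' := by intro m; simp
  smul_mem' := by
    intro c p hp m
    rw [MvPolynomial.coeff_smul]
    exact Submodule.smul_mem _ _ (hp m)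

/-- Elements `∑ rₘ ∂^m` of the crossed product with `rₘ ∈ R` homogeneous of degree `d + |m|`. -/
def qPiece (d : ℤ) : Submodule ℂ (CrossedProduct δ) :=
  Submodule.map (nord δ) (clPiece G ι d)

variable {G}

theorem clPiece_mul (hmul : ∀ d e r s, r ∈ G d → s ∈ G e → r * s ∈ G (d + e)) {d e : ℤ}
    {p q : MvPolynomial ι R} (hp : p ∈ clPiece G ι d) (hq : q ∈ clPiece G ι e) :
    p * q ∈ clPiece G ι (d + e) := by
  classical
  intro m
  rw [MvPolynomial.coeff_mul]
  refine Submodule.sum_mem _ fun x hx => ?_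
  have h := hmul _ _ _ _ (hp x.1) (hq x.2)
  rw [Finset.HasAntidiagonal.mem_antidiagonal] at hx
  convert h using 2
  rw [← hx, map_add]
  push_cast
  ring

theorem clPiece_C {d : ℤ} {r : R} (hr : r ∈ G d) :
    (MvPolynomial.C r : MvPolynomial ι R) ∈ clPiece G ι d := by
  classical
  intro m
  rw [MvPolynomial.coeff_C]
  split_ifs with h
  · subst h; simpa using hr
  · simp

theorem clPiece_X (h1 : (1 : R) ∈ G 0) (i : ι) :
    (MvPolynomial.X i : MvPolynomial ι R) ∈ clPiece G ι (-1) := by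
  classical
  intro m
  rw [MvPolynomial.coeff_X]
  split_ifs with h
  · subst h; simpa using h1
  · simp

theorem coef_mem_qPiece {d : ℤ} {r : R} (hr : r ∈ G d) : coef δ r ∈ qPiece δ G d := by
  refine ⟨MvPolynomial.C r, clPiece_C hr, ?_⟩
  rw [MvPolynomial.C_apply, nord_monomial, genPow_zero, mul_one]

theorem qPiece_mul (h1 : (1 : R) ∈ G 0)
    (hmul : ∀ d e r s, r ∈ G d → s ∈ G e → r * s ∈ G (d + e))
    (hδ : ∀ i d r, r ∈ G d → δ i r ∈ G (d - 1)) {d e : ℤ}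
    {a b : CrossedProduct δ} (ha : a ∈ qPiece δ G d) (hb : b ∈ qPiece δ G e) :
    a * b ∈ qPiece δ G (d + e) := by
  have hcoef : ∀ (d e : ℤ) (r : R) (b : CrossedProduct δ), r ∈ G d → b ∈ qPiece δ G e →
      coef δ r * b ∈ qPiece δ G (d + e) := by
    rintro d e r _ hr ⟨q, hq, rfl⟩
    exact ⟨MvPolynomial.C r * q, clPiece_mul hmul (clPiece_C hr) hq, (coef_mul_nord δ r q).symm⟩
  have hgen : ∀ (e : ℤ) (i : ι) (b : CrossedProduct δ), b ∈ qPiece δ G e →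
      gen δ i * b ∈ qPiece δ G (-1 + e) := by
    rintro e i _ ⟨q, hq, rfl⟩
    rw [gen_mul_nord]
    refine add_mem ⟨_, clPiece_mul hmul (clPiece_X h1 i) hq, rfl⟩ ⟨_, ?_, rfl⟩
    intro m
    rw [coeff_coeffD]
    have h := hδ i _ _ (hq m)
    convert h using 2
    ring
  have hpow : ∀ (m : ι →₀ ℕ) (e : ℤ) (b : CrossedProduct δ), b ∈ qPiece δ G e →
      genPow δ m * b ∈ qPiece δ G (-(m.degree : ℤ) + e) := by
    intro m
    induction m using Finsupp.induction_linear with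
    | zero => intro e b hb; simpa [genPow_zero] using hb
    | add f g hf hg =>
      intro e b hb
      rw [genPow_add, mul_assoc]
      convert hf _ _ (hg _ _ hb) using 2
      rw [map_add]
      push_cast
      ring
    | single i n =>
      induction n with
      | zero => intro e b hb; simpa [genPow_zero] using hb
      | succ n ih =>
        intro e b hb
        rw [add_comm n 1, Finsupp.single_add, genPow_add, genPow_single, mul_assoc]
        convert hgen _ i _ (ih _ _ hb) using 2
        rw [map_add, Finsupp.degree_single]
        push_cast
        ring
  obtain ⟨p, hp, rfl⟩ := ha
  rw [MvPolynomial.as_sum p, map_sum, Finset.sum_mul]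
  refine Submodule.sum_mem _ fun m _ => ?_
  rw [nord_monomial, mul_assoc]
  convert hcoef _ _ _ _ (hp m) (hpow m _ _ hb) using 2
  ring

end Crossed

/-! ### The algebra of the `x̂`-variables -/

section XSide

variable {g : ℕ}

/-- The field `ℂ(x₁, …, x_g)`. -/
def RatX (g : ℕ) : Type := FractionRing (MvPolynomial (Fin g) ℂ)

instance : Field (RatX g) := inferInstanceAs (Field (FractionRing (MvPolynomial (Fin g) ℂ)))

instance : Algebra (MvPolynomial (Fin g) ℂ) (RatX g) :=
  inferInstanceAs (Algebra (MvPolynomial (Fin g) ℂ) (FractionRing (MvPolynomial (Fin g) ℂ)))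

instance : Algebra ℂ (RatX g) :=
  inferInstanceAs (Algebra ℂ (FractionRing (MvPolynomial (Fin g) ℂ)))

instance : IsScalarTower ℂ (MvPolynomial (Fin g) ℂ) (RatX g) :=
  inferInstanceAs
    (IsScalarTower ℂ (MvPolynomial (Fin g) ℂ) (FractionRing (MvPolynomial (Fin g) ℂ)))

instance : IsFractionRing (MvPolynomial (Fin g) ℂ) (RatX g) :=
  inferInstanceAs
    (IsFractionRing (MvPolynomial (Fin g) ℂ) (FractionRing (MvPolynomial (Fin g) ℂ)))

/-- The variable `x_α`. -/
def xvar (α : Fin g) : RatX g := algebraMap (MvPolynomial (Fin g) ℂ) (RatX g) (MvPolynomial.X α)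

/-- `Π(X) = ∏ᵢ (X - aᵢ)`. -/
def bigPi (a : Fin (g + 3) ↪ ℂ) : Polynomial ℂ := ∏ i, (Polynomial.X - Polynomial.C (a i))

/-- The derivation `2 Π(x_α) ∂/∂x_α` of `ℂ(x₁, …, x_g)`. -/
def derX (a : Fin (g + 3) ↪ ℂ) (α : Fin g) : Derivation ℂ (RatX g) (RatX g) :=
  (2 * Polynomial.aeval (xvar α) (bigPi a)) •
    locDer (nonZeroDivisors (MvPolynomial (Fin g) ℂ)) (MvPolynomial.pderiv α)

/-- The action of a permutation on `ℂ(x₁, …, x_g)`, `x_α ↦ x_{σ α}`. -/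
def permX (σ : Equiv.Perm (Fin g)) : RatX g →ₐ[ℂ] RatX g :=
  IsLocalization.liftAlgHom (M := nonZeroDivisors (MvPolynomial (Fin g) ℂ))
    (f := (IsScalarTower.toAlgHom ℂ (MvPolynomial (Fin g) ℂ) (RatX g)).comp
      (MvPolynomial.rename σ))
    (fun y => by
      refine isUnit_iff_ne_zero.mpr ?_
      have h : MvPolynomial.rename σ (y : MvPolynomial (Fin g) ℂ) ≠ 0 := by
        rw [Ne, map_eq_zero_iff _ (MvPolynomial.rename_injective σ σ.injective)]
        exact nonZeroDivisors.ne_zero y.2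
      simpa using h)

theorem permX_algebraMap (σ : Equiv.Perm (Fin g)) (p : MvPolynomial (Fin g) ℂ) :
    permX σ (algebraMap _ (RatX g) p) = algebraMap _ (RatX g) (MvPolynomial.rename σ p) := by
  simp [permX]

theorem permX_aeval (σ : Equiv.Perm (Fin g)) (α : Fin g) (p : Polynomial ℂ) :
    permX σ (Polynomial.aeval (xvar α) p) = Polynomial.aeval (xvar (σ α)) p := by
  rw [← Polynomial.aeval_algHom_apply, xvar, permX_algebraMap, MvPolynomial.rename_X]
  rfl

theorem permX_derX (a : Fin (g + 3) ↪ ℂ) (σ : Equiv.Perm (Fin g)) (α : Fin g) (r : RatX g) :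
    permX σ (derX a α r) = derX a (σ α) (permX σ r) := by
  have key : ∀ p : MvPolynomial (Fin g) ℂ,
      permX σ (derX a α (algebraMap _ (RatX g) p))
        = derX a (σ α) (permX σ (algebraMap _ (RatX g) p)) := by
    intro p
    simp only [derX, Derivation.smul_apply, permX_algebraMap, locDer_algebraMap, smul_eq_mul,
      map_mul, permX_aeval, map_ofNat]
    rw [MvPolynomial.pderiv_rename σ.injective]
  obtain ⟨p, q, hq, rfl⟩ := IsFractionRing.div_surjective (A := MvPolynomial (Fin g) ℂ) r
  have hq0 : algebraMap _ (RatX g) q ≠ 0 := by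
    simpa using nonZeroDivisors.ne_zero hq
  have hq1 : permX σ (algebraMap _ (RatX g) q) ≠ 0 := by
    simpa using hq0
  set z := algebraMap _ (RatX g) p / algebraMap _ (RatX g) q with hz
  have hzq : z * algebraMap _ (RatX g) q = algebraMap _ (RatX g) p := by
    rw [hz, div_mul_cancel₀ _ hq0]
  have e1 := key p
  rw [← hzq, map_mul (permX σ) z, Derivation.leibniz, Derivation.leibniz] at e1
  simp only [smul_eq_mul, map_add, map_mul, key q] at e1
  have e2 := add_left_cancel e1
  exact mul_left_cancel₀ hq1 e2

/-- The crossed product `ℂ(x̂₁, …, x̂_g)[ŷ₁, …, ŷ_g]`, with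
`[ŷ_α, f] = 2 Π(x̂_α) ∂f/∂x̂_α`. -/
abbrev AXfull (a : Fin (g + 3) ↪ ℂ) : Type := CrossedProduct (derX a)

/-- A permutation acts by `(x̂_α, ŷ_α) ↦ (x̂_{σ α}, ŷ_{σ α})`. -/
def permAX (a : Fin (g + 3) ↪ ℂ) (σ : Equiv.Perm (Fin g)) : AXfull a →ₐ[ℂ] AXfull a :=
  permHom (derX a) (permX σ) σ (permX_derX a σ)

/-- `A_𝒳`: the algebra of `𝔖_g`-invariants. -/
def AX (a : Fin (g + 3) ↪ ℂ) : Subalgebra ℂ (AXfull a) :=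
  ⨅ σ : Equiv.Perm (Fin g), AlgHom.equalizer (permAX a σ) (AlgHom.id ℂ (AXfull a))

theorem mem_AX (a : Fin (g + 3) ↪ ℂ) (z : AXfull a) : z ∈ AX a ↔ ∀ σ, permAX a σ z = z := by
  simp [AX, Algebra.mem_iInf]

/-- The elementary symmetric function `∑_{α₁ < … < α_k} x̂_{α₁} ⋯ x̂_{α_k}` in `A_𝒳`. -/
def ehat (a : Fin (g + 3) ↪ ℂ) (k : ℕ) : AX a :=
  ⟨coef (derX a) (algebraMap _ (RatX g) (MvPolynomial.esymm (Fin g) ℂ k)), by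
    rw [mem_AX]
    intro σ
    rw [permAX, permHom_coef, permX_algebraMap, MvPolynomial.esymm_isSymmetric]⟩

/-- The coefficient `(φ/Π)(x_α)`. -/
def yCoef (a : Fin (g + 3) ↪ ℂ) (φ : Polynomial ℂ) (α : Fin g) : RatX g :=
  Polynomial.aeval (xvar α) φ / Polynomial.aeval (xvar α) (bigPi a)

theorem permX_yCoef (a : Fin (g + 3) ↪ ℂ) (φ : Polynomial ℂ) (σ : Equiv.Perm (Fin g))
    (α : Fin g) : permX σ (yCoef a φ α) = yCoef a φ (σ α) := by
  rw [yCoef, map_div₀, permX_aeval, permX_aeval, yCoef]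

/-- `Ŷ[φ] = ∑_α (φ/Π)(x̂_α) ŷ_α ∈ A_𝒳`. -/
def Yhat (a : Fin (g + 3) ↪ ℂ) (φ : Polynomial ℂ) : AX a :=
  ⟨∑ α, coef (derX a) (yCoef a φ α) * gen (derX a) α, by
    rw [mem_AX]
    intro σ
    simp only [permAX, map_sum, map_mul, permHom_coef, permHom_gen, permX_yCoef]
    exact Equiv.sum_comp σ fun α => coef (derX a) (yCoef a φ α) * gen (derX a) α⟩

/-- A permutation acts on `ℂ(x₁, …, x_g)[y₁, …, y_g]` by `(x_α, y_α) ↦ (x_{σ α}, y_{σ α})`. -/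
def permSX (σ : Equiv.Perm (Fin g)) :
    MvPolynomial (Fin g) (RatX g) →ₐ[ℂ] MvPolynomial (Fin g) (RatX g) :=
  ((MvPolynomial.rename σ).restrictScalars ℂ).comp (MvPolynomial.mapAlgHom (permX σ))

/-- The classical algebra `ℂ(x₁, …, x_g)[y₁, …, y_g]^{𝔖_g}`. -/
def SX (g : ℕ) : Subalgebra ℂ (MvPolynomial (Fin g) (RatX g)) :=
  ⨅ σ : Equiv.Perm (Fin g), AlgHom.equalizer (permSX σ) (AlgHom.id ℂ _)

theorem mem_SX (z : MvPolynomial (Fin g) (RatX g)) : z ∈ SX g ↔ ∀ σ, permSX σ z = z := by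
  simp [SX, Algebra.mem_iInf]

/-- The elementary symmetric function of the `x_α` in the classical algebra. -/
def ecl (g k : ℕ) : SX g :=
  ⟨MvPolynomial.C (algebraMap _ (RatX g) (MvPolynomial.esymm (Fin g) ℂ k)), by
    rw [mem_SX]
    intro σ
    simp [permSX, permX_algebraMap, MvPolynomial.esymm_isSymmetric (Fin g) ℂ k σ]⟩

/-- `Y[φ] = ∑_α (φ/Π)(x_α) y_α`. -/
def Ycl (a : Fin (g + 3) ↪ ℂ) (φ : Polynomial ℂ) : SX g :=
  ⟨∑ α, MvPolynomial.C (yCoef a φ α) * MvPolynomial.X α, by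
    rw [mem_SX]
    intro σ
    simp only [permSX, map_sum, map_mul, AlgHom.comp_apply, MvPolynomial.mapAlgHom_apply,
      MvPolynomial.map_C, MvPolynomial.map_X, AlgHom.restrictScalars_apply,
      MvPolynomial.rename_C, MvPolynomial.rename_X, RingHom.coe_coe, permX_yCoef]
    exact Equiv.sum_comp σ fun α =>
      (MvPolynomial.C (yCoef a φ α) * MvPolynomial.X α : MvPolynomial (Fin g) (RatX g))⟩

/-- Order filtration of `A_𝒳`. -/
def filtAX (a : Fin (g + 3) ↪ ℂ) (k : ℤ) : Set (AX a) := {z | (z : AXfull a) ∈ filt (derX a) k}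

end XSide

/-! ### The localized symmetric algebra `ℂ(V)_W` -/

section USide

variable {g : ℕ} (a : Fin (g + 3) ↪ ℂ)

/-- The linear form `∑ᵢ aᵢᵏ fᵢ` on `V = ⊕ᵢ ℂ fᵢ`; `S(V)` is the polynomial ring in the `fᵢ`. -/
def ell (k : ℕ) : MvPolynomial (Fin (g + 3)) ℂ :=
  ∑ i, MvPolynomial.C (a i ^ k) * MvPolynomial.X i

/-- `W = Span(ℓ̂₀, ℓ̂₁) ⊂ V ⊂ S(V)`. -/
def W : Submodule ℂ (MvPolynomial (Fin (g + 3)) ℂ) := Submodule.span ℂ {ell a 0, ell a 1}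

/-- The ideal of `S(V)` generated by `W`. -/
def idealW : Ideal (MvPolynomial (Fin (g + 3)) ℂ) := Ideal.span (W a : Set _)

theorem ell_mem_W_zero : ell a 0 ∈ W a := Submodule.subset_span (by simp)

theorem ell_mem_W_one : ell a 1 ∈ W a := Submodule.subset_span (by simp)

theorem idealW_le {J : Ideal (MvPolynomial (Fin (g + 3)) ℂ)} (h0 : ell a 0 ∈ J)
    (h1 : ell a 1 ∈ J) : idealW a ≤ J := by
  refine Ideal.span_le.mpr ?_
  have h : W a ≤ J.restrictScalars ℂ := by
    refine Submodule.span_le.mpr ?_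
    rintro x (rfl | rfl)
    · exact h0
    · exact h1
  exact h

theorem exists_dual_pair : ∃ u v : Fin (g + 3) → ℂ,
    ∑ i, u i = 1 ∧ ∑ i, a i * u i = 0 ∧ ∑ i, v i = 0 ∧ ∑ i, a i * v i = 1 := by
  have h01 : a 0 - a 1 ≠ 0 := sub_ne_zero.mpr (a.injective.ne (by simp))
  have hs : ∀ (c d : ℂ) (w : Fin (g + 3) → ℂ),
      ∑ i, w i * ((Pi.single 0 c : Fin (g + 3) → ℂ) i + (Pi.single 1 d : Fin (g + 3) → ℂ) i)
        = w 0 * c + w 1 * d := by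
    intro c d w
    simp [mul_add, Finset.sum_add_distrib, Pi.single_apply]
  refine ⟨fun i => (Pi.single 0 (-a 1 / (a 0 - a 1)) : Fin (g + 3) → ℂ) i
      + (Pi.single 1 (a 0 / (a 0 - a 1)) : Fin (g + 3) → ℂ) i,
    fun i => (Pi.single 0 (1 / (a 0 - a 1)) : Fin (g + 3) → ℂ) i
      + (Pi.single 1 (-1 / (a 0 - a 1)) : Fin (g + 3) → ℂ) i, ?_, ?_, ?_, ?_⟩
  · have := hs (-a 1 / (a 0 - a 1)) (a 0 / (a 0 - a 1)) (fun _ => 1)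
    simp only [one_mul] at this
    rw [this]; field_simp; ring
  · rw [hs]; field_simp; ring
  · have := hs (1 / (a 0 - a 1)) (-1 / (a 0 - a 1)) (fun _ => 1)
    simp only [one_mul] at this
    rw [this]; field_simp; ring
  · rw [hs]; field_simp; ring

instance idealW_isPrime : (idealW a).IsPrime := by
  obtain ⟨u, v, hu0, hu1, hv0, hv1⟩ := exists_dual_pair a
  let θ : MvPolynomial (Fin (g + 3)) ℂ →ₐ[ℂ] MvPolynomial (Fin (g + 3)) ℂ :=
    MvPolynomial.aeval fun i => MvPolynomial.X i - MvPolynomial.C (u i) * ell a 0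
      - MvPolynomial.C (v i) * ell a 1
  have hl0 : ell a 0 ∈ idealW a := Ideal.subset_span (ell_mem_W_zero a)
  have hl1 : ell a 1 ∈ idealW a := Ideal.subset_span (ell_mem_W_one a)
  have hθ : ∀ k, θ (ell a k) = ell a k - MvPolynomial.C (∑ i, a i ^ k * u i) * ell a 0
      - MvPolynomial.C (∑ i, a i ^ k * v i) * ell a 1 := by
    intro k
    have e : ell a k = ∑ i, MvPolynomial.C (a i ^ k) * MvPolynomial.X i := rfl
    conv_lhs => rw [e]
    conv_rhs => rw [e]
    simp only [map_sum, map_mul, Finset.sum_mul, ← Finset.sum_sub_distrib]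
    refine Finset.sum_congr rfl fun i _ => ?_
    simp only [θ, MvPolynomial.aeval_X, MvPolynomial.algHom_C, MvPolynomial.algebraMap_eq]
    ring
  have hker : idealW a = RingHom.ker θ := by
    apply le_antisymm
    · apply idealW_le
      · rw [RingHom.mem_ker, hθ]; simp [hu0, hv0]
      · rw [RingHom.mem_ker, hθ]; simp [hu1, hv1]
    · intro p hp
      have hmk : (Ideal.Quotient.mkₐ ℂ (idealW a)).comp θ = Ideal.Quotient.mkₐ ℂ (idealW a) := by
        apply MvPolynomial.algHom_ext
        intro i
        simp only [θ, AlgHom.comp_apply, MvPolynomial.aeval_X, Ideal.Quotient.mkₐ_eq_mk]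
        rw [Ideal.Quotient.eq]
        have : MvPolynomial.X i - MvPolynomial.C (u i) * ell a 0
            - MvPolynomial.C (v i) * ell a 1 - MvPolynomial.X i
            = -(MvPolynomial.C (u i) * ell a 0 + MvPolynomial.C (v i) * ell a 1) := by ring
        rw [this]
        exact neg_mem (add_mem (Ideal.mul_mem_left _ _ hl0) (Ideal.mul_mem_left _ _ hl1))
      have h := congrArg (fun f => f p) hmk
      simp only [AlgHom.comp_apply, Ideal.Quotient.mkₐ_eq_mk] at h
      rw [RingHom.mem_ker.mp hp, map_zero] at h
      exact Ideal.Quotient.eq_zero_iff_mem.mp h.symm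
  rw [hker]
  exact RingHom.ker_isPrime _

theorem ell_two_notMem : ell a 2 ∈ (idealW a).primeCompl := by
  have h01 : a 0 - a 1 ≠ 0 := sub_ne_zero.mpr (a.injective.ne (by simp))
  have h02 : a 0 - a 2 ≠ 0 := sub_ne_zero.mpr (a.injective.ne (by
    rw [Ne, Fin.ext_iff, Fin.val_two]; simp))
  have h12 : a 1 - a 2 ≠ 0 := sub_ne_zero.mpr (a.injective.ne (by
    rw [Ne, Fin.ext_iff, Fin.val_two]; simp))
  let u : Fin (g + 3) → ℂ := fun i =>
    (Pi.single 0 (1 / ((a 0 - a 1) * (a 0 - a 2))) : Fin (g + 3) → ℂ) i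
      + (Pi.single 1 (-1 / ((a 0 - a 1) * (a 1 - a 2))) : Fin (g + 3) → ℂ) i
      + (Pi.single 2 (1 / ((a 0 - a 2) * (a 1 - a 2))) : Fin (g + 3) → ℂ) i
  have hev : ∀ k, MvPolynomial.eval u (ell a k) = a 0 ^ k / ((a 0 - a 1) * (a 0 - a 2))
      - a 1 ^ k / ((a 0 - a 1) * (a 1 - a 2)) + a 2 ^ k / ((a 0 - a 2) * (a 1 - a 2)) := by
    intro k
    simp only [ell, u, map_sum, map_mul, MvPolynomial.eval_C, MvPolynomial.eval_X, mul_add,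
      Finset.sum_add_distrib, Pi.single_apply, mul_ite, mul_zero, Finset.sum_ite_eq',
      Finset.mem_univ, if_true]
    field_simp
    ring
  intro hmem
  have hle : idealW a ≤ RingHom.ker (MvPolynomial.eval u) := by
    apply idealW_le
    · rw [RingHom.mem_ker, hev]; field_simp; ring
    · rw [RingHom.mem_ker, hev]; field_simp; ring
  have h := hle hmem
  rw [RingHom.mem_ker, hev] at h
  have h1 : a 0 ^ 2 / ((a 0 - a 1) * (a 0 - a 2))
      - a 1 ^ 2 / ((a 0 - a 1) * (a 1 - a 2)) + a 2 ^ 2 / ((a 0 - a 2) * (a 1 - a 2)) = 1 := by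
    field_simp; ring
  rw [h1] at h
  exact one_ne_zero h

/-- `𝒪 = ℂ(V)_W`, the localization of `S(V)` at the prime ideal generated by `W`. -/
def OW : Type := Localization.AtPrime (idealW a)

instance : CommRing (OW a) := inferInstanceAs (CommRing (Localization.AtPrime (idealW a)))

instance : Algebra (MvPolynomial (Fin (g + 3)) ℂ) (OW a) :=
  inferInstanceAs (Algebra (MvPolynomial (Fin (g + 3)) ℂ) (Localization.AtPrime (idealW a)))

instance : Algebra ℂ (OW a) := inferInstanceAs (Algebra ℂ (Localization.AtPrime (idealW a)))

instance : IsScalarTower ℂ (MvPolynomial (Fin (g + 3)) ℂ) (OW a) :=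
  inferInstanceAs
    (IsScalarTower ℂ (MvPolynomial (Fin (g + 3)) ℂ) (Localization.AtPrime (idealW a)))

instance : IsLocalization.AtPrime (OW a) (idealW a) :=
  inferInstanceAs (IsLocalization.AtPrime (Localization.AtPrime (idealW a)) (idealW a))

instance : IsLocalRing (OW a) := inferInstanceAs (IsLocalRing (Localization.AtPrime (idealW a)))

/-- The homomorphism `S(V) → 𝒪`. -/
def toOW : MvPolynomial (Fin (g + 3)) ℂ →ₐ[ℂ] OW a :=
  IsScalarTower.toAlgHom ℂ (MvPolynomial (Fin (g + 3)) ℂ) (OW a)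

/-- The derivation `∂/∂fᵢ` of `𝒪`. -/
def derU (i : Fin (g + 3)) : Derivation ℂ (OW a) (OW a) :=
  locDer (idealW a).primeCompl (MvPolynomial.pderiv i)

theorem ell_isHomogeneous (k : ℕ) : (ell a k).IsHomogeneous 1 := by
  refine MvPolynomial.IsHomogeneous.sum _ _ _ fun i _ => ?_
  simpa using (MvPolynomial.isHomogeneous_C _ (a i ^ k)).mul (MvPolynomial.isHomogeneous_X ℂ i)

/-- The elements of `𝒪` that are homogeneous of degree `d`: the quotients `p / q` of homogeneous
polynomials with `q ∉ (W)` and `deg p - deg q = d`. -/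
def homog (d : ℤ) : Submodule ℂ (OW a) where
  carrier := {r | ∃ (p q : MvPolynomial (Fin (g + 3)) ℂ) (m n : ℕ), p.IsHomogeneous m ∧
    q.IsHomogeneous n ∧ q ∈ (idealW a).primeCompl ∧ (m : ℤ) - n = d ∧ r * toOW a q = toOW a p}
  add_mem' := by
    rintro r s ⟨p, q, m, n, hp, hq, hqI, hd, hr⟩ ⟨p', q', m', n', hp', hq', hqI', hd', hs⟩
    refine ⟨p * q' + p' * q, q * q', m + n', n + n', ?_, hq.mul hq',
      Submonoid.mul_mem _ hqI hqI', by push_cast; omega, ?_⟩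
    · have h : m' + n = m + n' := by omega
      exact (hp.mul hq').add (h ▸ hp'.mul hq)
    · rw [map_add, map_mul, map_mul, map_mul, ← hr, ← hs]
      ring
  zero_mem' := by
    refine ⟨0, ell a 2 ^ d.natAbs, (d + d.natAbs).toNat, d.natAbs,
      MvPolynomial.isHomogeneous_zero _ _ _, ?_,
      Submonoid.pow_mem _ (ell_two_notMem a) _, by omega, by simp⟩
    simpa using (ell_isHomogeneous a 2).pow d.natAbs
  smul_mem' := by
    rintro c r ⟨p, q, m, n, hp, hq, hqI, hd, hr⟩
    refine ⟨c • p, q, m, n, ?_, hq, hqI, hd, by rw [smul_mul_assoc, hr, map_smul]⟩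
    rw [MvPolynomial.smul_eq_C_mul]
    simpa using (MvPolynomial.isHomogeneous_C _ c).mul hp

theorem toOW_mem_homog {p : MvPolynomial (Fin (g + 3)) ℂ} {m : ℕ} (hp : p.IsHomogeneous m) :
    toOW a p ∈ homog a m :=
  ⟨p, 1, m, 0, hp, MvPolynomial.isHomogeneous_one _ _, Submonoid.one_mem _, by simp, by simp⟩

theorem one_mem_homog : (1 : OW a) ∈ homog a 0 := by
  simpa using toOW_mem_homog a (MvPolynomial.isHomogeneous_one (Fin (g + 3)) ℂ)

theorem homog_mul (d e : ℤ) (r s : OW a) (hr : r ∈ homog a d) (hs : s ∈ homog a e) :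
    r * s ∈ homog a (d + e) := by
  obtain ⟨p, q, m, n, hp, hq, hqI, hd, hr⟩ := hr
  obtain ⟨p', q', m', n', hp', hq', hqI', hd', hs⟩ := hs
  refine ⟨p * p', q * q', m + m', n + n', hp.mul hp', hq.mul hq',
    Submonoid.mul_mem _ hqI hqI', by push_cast; omega, ?_⟩
  rw [map_mul, map_mul, ← hr, ← hs]
  ring

theorem derU_toOW (i : Fin (g + 3)) (p : MvPolynomial (Fin (g + 3)) ℂ) :
    derU a i (toOW a p) = toOW a (MvPolynomial.pderiv i p) :=
  locDer_algebraMap _ _ _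

theorem pderiv_mul_homog {p q : MvPolynomial (Fin (g + 3)) ℂ} {m n : ℕ} (i : Fin (g + 3))
    (hp : p.IsHomogeneous m) (hq : q.IsHomogeneous n) :
    (MvPolynomial.pderiv i p * q).IsHomogeneous (m + n - 1) := by
  rcases Nat.eq_zero_or_pos m with rfl | hm
  · rw [MvPolynomial.totalDegree_eq_zero_iff_eq_C.mp
      ((MvPolynomial.totalDegree_zero_iff_isHomogeneous _).mpr hp), MvPolynomial.pderiv_C, zero_mul]
    exact MvPolynomial.isHomogeneous_zero _ _ _
  · have h : m - 1 + n = m + n - 1 := by omega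
    exact h ▸ (hp.pderiv (i := i)).mul hq

theorem derU_homog (i : Fin (g + 3)) (d : ℤ) (r : OW a) (hr : r ∈ homog a d) :
    derU a i r ∈ homog a (d - 1) := by
  obtain ⟨p, q, m, n, hp, hq, hqI, hd, hr⟩ := hr
  have e : derU a i r * toOW a (q * q)
      = toOW a (MvPolynomial.pderiv i p * q - MvPolynomial.pderiv i q * p) := by
    have h := congrArg (derU a i) hr
    rw [Derivation.leibniz, derU_toOW, derU_toOW, smul_eq_mul, smul_eq_mul] at h
    rw [map_sub, map_mul, map_mul, map_mul, ← h, ← hr]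
    ring
  have hnum : (MvPolynomial.pderiv i p * q - MvPolynomial.pderiv i q * p).IsHomogeneous
      (m + n - 1) := (pderiv_mul_homog i hp hq).sub (by
        rw [add_comm m n]; exact pderiv_mul_homog i hq hp)
  rcases Nat.eq_zero_or_pos (m + n) with h0 | h0
  · have hm : m = 0 := by omega
    have hn : n = 0 := by omega
    subst hm hn
    have hz : MvPolynomial.pderiv i p * q - MvPolynomial.pderiv i q * p = 0 := by
      rw [MvPolynomial.totalDegree_eq_zero_iff_eq_C.mp
        ((MvPolynomial.totalDegree_zero_iff_isHomogeneous _).mpr hp),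
        MvPolynomial.totalDegree_eq_zero_iff_eq_C.mp
        ((MvPolynomial.totalDegree_zero_iff_isHomogeneous _).mpr hq), MvPolynomial.pderiv_C,
        MvPolynomial.pderiv_C]
      simp
    rw [hz, map_zero] at e
    have hu : IsUnit (toOW a (q * q)) :=
      IsLocalization.map_units (OW a)
        (⟨q * q, Submonoid.mul_mem _ hqI hqI⟩ : (idealW a).primeCompl)
    have : derU a i r = 0 := (hu.mul_left_eq_zero).mp e
    rw [this]
    exact zero_mem _
  · exact ⟨_, _, m + n - 1, n + n, hnum, hq.mul hq, Submonoid.mul_mem _ hqI hqI,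
      by push_cast [Nat.cast_sub h0]; omega, e⟩

/-- The field `ℂ(V/W) = 𝒪 / (W)`. -/
abbrev FW : Type := IsLocalRing.ResidueField (OW a)

/-! ### The quantized reduced algebra -/

/-- `A = 𝒪[V*]`, the crossed product of `𝒪` by the derivations `fᵢ* = ∂/∂fᵢ`: a localization of
the Weyl algebra of `V`. -/
abbrev AW : Type := CrossedProduct (derU a)

/-- `Aᵈ`, the part of `A` of degree `d`, where `V` has degree `1` and `V*` has degree `-1`. -/
def AWdeg (d : ℤ) : Submodule ℂ (AW a) := qPiece (derU a) (homog a) d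

/-- The image of `W` in `A`. -/
def WQ : Submodule ℂ (AW a) := (W a).map ((coef (derU a)).comp (toOW a)).toLinearMap

theorem AWdeg_mul {d e : ℤ} {x y : AW a} (hx : x ∈ AWdeg a d) (hy : y ∈ AWdeg a e) :
    x * y ∈ AWdeg a (d + e) :=
  qPiece_mul (derU a) (one_mem_homog a) (homog_mul a) (derU_homog a) hx hy

theorem WQ_mul_AWdeg_mul {d e : ℤ} {x y : AW a} (hx : x ∈ WQ a * AWdeg a d)
    (hy : y ∈ AWdeg a e) : x * y ∈ WQ a * AWdeg a (d + e) := by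
  induction hx using Submodule.mul_induction_on' with
  | mem_mul_mem w hw z hz =>
    rw [mul_assoc]
    exact Submodule.mul_mem_mul hw (AWdeg_mul a hz hy)
  | add x _ y _ h1 h2 => rw [add_mul]; exact add_mem h1 h2

theorem coef_mul_mem_WQ {r : OW a} (hr : r ∈ homog a 0) {w : MvPolynomial (Fin (g + 3)) ℂ}
    (hw : w ∈ W a) : coef (derU a) r * coef (derU a) (toOW a w) ∈ WQ a * AWdeg a 0 := by
  rw [← map_mul, mul_comm, map_mul]
  exact Submodule.mul_mem_mul ⟨w, hw, rfl⟩ (coef_mem_qPiece (derU a) hr)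

/-- `N⁰ = {f ∈ A⁰ | f W ⊂ W A⁰}`. -/
def N0 : Subalgebra ℂ (AW a) where
  carrier := {f | f ∈ AWdeg a 0 ∧
    ∀ w ∈ W a, f * coef (derU a) (toOW a w) ∈ WQ a * AWdeg a 0}
  mul_mem' := by
    rintro x y ⟨hx, hxW⟩ ⟨hy, hyW⟩
    refine ⟨by simpa using AWdeg_mul a hx hy, fun w hw => ?_⟩
    rw [mul_assoc]
    have key : ∀ z ∈ WQ a * AWdeg a 0, x * z ∈ WQ a * AWdeg a 0 := by
      intro z hz
      induction hz using Submodule.mul_induction_on' with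
      | mem_mul_mem w hw z hz =>
        obtain ⟨w, hw, rfl⟩ := hw
        rw [← mul_assoc]
        simpa using WQ_mul_AWdeg_mul a (hxW w hw) hz
      | add x _ y _ h1 h2 => rw [mul_add]; exact add_mem h1 h2
    exact key _ (hyW w hw)
  add_mem' := by
    rintro x y ⟨hx, hxW⟩ ⟨hy, hyW⟩
    exact ⟨add_mem hx hy, fun w hw => by rw [add_mul]; exact add_mem (hxW w hw) (hyW w hw)⟩
  algebraMap_mem' := by
    intro c
    have hc : algebraMap ℂ (OW a) c ∈ homog a 0 := by
      rw [Algebra.algebraMap_eq_smul_one]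
      exact Submodule.smul_mem _ _ (one_mem_homog a)
    rw [← AlgHom.commutes (coef (derU a))]
    exact ⟨coef_mem_qPiece (derU a) hc, fun w hw => coef_mul_mem_WQ a hc hw⟩

theorem coef_mem_N0 {r : OW a} (hr : r ∈ homog a 0) : coef (derU a) r ∈ N0 a :=
  ⟨coef_mem_qPiece (derU a) hr, fun _ hw => coef_mul_mem_WQ a hr hw⟩

/-- The canonical element `Φ = ∑ᵢ fᵢ fᵢ*`. -/
def Phi : AW a := ∑ i, coef (derU a) (toOW a (MvPolynomial.X i)) * gen (derU a) i

/-- The elements of `W A⁻¹`, and `Φ`, are to become zero. -/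
def AURel (x y : N0 a) : Prop :=
  ((x : AW a) ∈ WQ a * AWdeg a (-1) ∨ (x : AW a) = Phi a) ∧ y = 0

/-- `A_𝒰 = N⁰ / (W A⁻¹ + N⁰ Φ)`. The quotient is by the two-sided ideal of `N⁰` generated by
`W A⁻¹` and `Φ`; as `W A⁻¹` is a two-sided ideal and `Φ` is central in `N⁰`, this ideal is
`W A⁻¹ + N⁰ Φ`. -/
abbrev AU : Type := RingQuot (AURel a)

/-- The projection `N⁰ → A_𝒰`. -/
def mkAU : N0 a →ₐ[ℂ] AU a := RingQuot.mkAlgHom ℂ (AURel a)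

/-- Order filtration of `A_𝒰`. -/
def filtAU (k : ℤ) : Set (AU a) :=
  {z | ∃ y : N0 a, (y : AW a) ∈ filt (derU a) k ∧ mkAU a y = z}

/-! ### The classical reduced algebra -/

/-- The commutative algebra `𝒪 ⊗ S(V*)`, with Poisson bracket `bracket (derU a)`. -/
abbrev BW : Type := MvPolynomial (Fin (g + 3)) (OW a)

/-- The part of `𝒪 ⊗ S(V*)` of degree `d`. -/
def BWdeg (d : ℤ) : Submodule ℂ (BW a) := clPiece (homog a) (Fin (g + 3)) d

/-- The image of `W` in `𝒪 ⊗ S(V*)`. -/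
def WC : Submodule ℂ (BW a) :=
  (W a).map ((IsScalarTower.toAlgHom ℂ (OW a) (BW a)).comp (toOW a)).toLinearMap

theorem BWdeg_mul {d e : ℤ} {x y : BW a} (hx : x ∈ BWdeg a d) (hy : y ∈ BWdeg a e) :
    x * y ∈ BWdeg a (d + e) :=
  clPiece_mul (homog_mul a) hx hy

theorem WC_mul_BWdeg_mul {d e : ℤ} {x y : BW a} (hx : x ∈ WC a * BWdeg a d)
    (hy : y ∈ BWdeg a e) : x * y ∈ WC a * BWdeg a (d + e) := by
  induction hx using Submodule.mul_induction_on' with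
  | mem_mul_mem w hw z hz =>
    rw [mul_assoc]
    exact Submodule.mul_mem_mul hw (BWdeg_mul a hz hy)
  | add x _ y _ h1 h2 => rw [add_mul]; exact add_mem h1 h2

/-- `{p ∈ (𝒪 ⊗ S(V*))⁰ | {p, W} ⊂ W (𝒪 ⊗ S(V*))⁰}`. -/
def Ncl0 : Subalgebra ℂ (BW a) where
  carrier := {p | p ∈ BWdeg a 0 ∧
    ∀ w ∈ W a, bracket (derU a) p (MvPolynomial.C (toOW a w)) ∈ WC a * BWdeg a 0}
  mul_mem' := by
    rintro x y ⟨hx, hxW⟩ ⟨hy, hyW⟩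
    refine ⟨by simpa using BWdeg_mul a hx hy, fun w hw => ?_⟩
    have e : bracket (derU a) (x * y) (MvPolynomial.C (toOW a w))
        = bracket (derU a) x (MvPolynomial.C (toOW a w)) * y
          + bracket (derU a) y (MvPolynomial.C (toOW a w)) * x := by
      simp only [bracket_C, Finset.sum_mul, ← Finset.sum_add_distrib]
      refine Finset.sum_congr rfl fun i _ => ?_
      rw [Derivation.leibniz, smul_eq_mul, smul_eq_mul]
      ring
    rw [e]
    exact add_mem (by simpa using WC_mul_BWdeg_mul a (hxW w hw) hy)
      (by simpa using WC_mul_BWdeg_mul a (hyW w hw) hx)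
  add_mem' := by
    rintro x y ⟨hx, hxW⟩ ⟨hy, hyW⟩
    refine ⟨add_mem hx hy, fun w hw => ?_⟩
    have e : bracket (derU a) (x + y) (MvPolynomial.C (toOW a w))
        = bracket (derU a) x (MvPolynomial.C (toOW a w))
          + bracket (derU a) y (MvPolynomial.C (toOW a w)) := by
      simp only [bracket_C, ← Finset.sum_add_distrib, map_add, add_mul]
    rw [e]
    exact add_mem (hxW w hw) (hyW w hw)
  algebraMap_mem' := by
    intro c
    have hc : algebraMap ℂ (OW a) c ∈ homog a 0 := by
      rw [Algebra.algebraMap_eq_smul_one]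
      exact Submodule.smul_mem _ _ (one_mem_homog a)
    have e : algebraMap ℂ (BW a) c = MvPolynomial.C (algebraMap ℂ (OW a) c) := rfl
    refine ⟨by rw [e]; exact clPiece_C hc, fun w hw => ?_⟩
    rw [e, bracket_C]
    simp

theorem C_mem_Ncl0 {r : OW a} (hr : r ∈ homog a 0) : (MvPolynomial.C r : BW a) ∈ Ncl0 a :=
  ⟨clPiece_C hr, fun w _ => by rw [bracket_C]; simp⟩

/-- The canonical element `Φ` of `V ⊗ V*`. -/
def PhiC : BW a := ∑ i, MvPolynomial.C (toOW a (MvPolynomial.X i)) * MvPolynomial.X i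

/-- The ideal generated by `W (𝒪 ⊗ S(V*))⁻¹` and `Φ`. -/
def Jcl : Ideal (Ncl0 a) :=
  Ideal.span {x | (x : BW a) ∈ WC a * BWdeg a (-1) ∨ (x : BW a) = PhiC a}

/-- The classical reduced algebra `S_{𝒰⁰}(𝒰¹)`. -/
abbrev SU : Type := Ncl0 a ⧸ Jcl a

/-- The projection onto the classical reduced algebra. -/
def mkSU : Ncl0 a →ₐ[ℂ] SU a := Ideal.Quotient.mkₐ ℂ (Jcl a)

/-! ### The residue elements -/

/-- `f̄ᵢ = fᵢ / ∑ⱼ aⱼ² fⱼ ∈ 𝒪`. -/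
def fbarO (i : Fin (g + 3)) : OW a :=
  IsLocalization.mk' (OW a) (MvPolynomial.X i : MvPolynomial (Fin (g + 3)) ℂ)
    ⟨ell a 2, ell_two_notMem a⟩

theorem fbarO_mem (i : Fin (g + 3)) : fbarO a i ∈ homog a 0 :=
  ⟨MvPolynomial.X i, ell a 2, 1, 1, MvPolynomial.isHomogeneous_X _ _, ell_isHomogeneous a 2,
    ell_two_notMem a, by simp, IsLocalization.mk'_spec (OW a) _ _⟩

/-- `f̄ᵢ` as an element of `N⁰`. -/
def fbar (i : Fin (g + 3)) : N0 a := ⟨coef (derU a) (fbarO a i), coef_mem_N0 a (fbarO_mem a i)⟩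

/-- `f̄ᵢ` as an element of the classical algebra. -/
def ubar (i : Fin (g + 3)) : Ncl0 a := ⟨MvPolynomial.C (fbarO a i), C_mem_Ncl0 a (fbarO_mem a i)⟩

/-- `∑_{j₁ < … < j_k, all ≠ i} a_{j₁} ⋯ a_{j_k}`. -/
def esymmErase (k : ℕ) (i : Fin (g + 3)) : ℂ :=
  ∑ s ∈ (Finset.univ.erase i).powersetCard k, ∏ j ∈ s, a j

/-- `P_f(X) = ∏ᵢ (X - aᵢ) · ∑ᵢ fᵢ / (X - aᵢ)`, a polynomial over `ℂ(V/W)`. -/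
def Pf : Polynomial (FW a) :=
  ∑ i, Polynomial.C (IsLocalRing.residue (OW a) (toOW a (MvPolynomial.X i))) *
    ∏ j ∈ Finset.univ.erase i, (Polynomial.X - Polynomial.C (algebraMap ℂ (FW a) (a j)))

/-- The residue at `t = ∞` of `r(t) dt`: with the local coordinate `s = 1/t`, so that
`dt = -s⁻² ds`, it is minus the coefficient of `s¹` in the expansion of `r(1/s)` as a Laurent
series in `s`. In particular `Res_{t=∞} dt/t = -1`. -/
def resInfty {F : Type} [Field F] (r : RatFunc F) : F :=
  -(RatFunc.eval (algebraMap F (LaurentSeries F)) (HahnSeries.single (-1 : ℤ) (1 : F)) r).coeff 1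

/-- The coefficient of `hᵢ` in `Ŵ[φ]`:
`Res_{t=∞} ((P_f'/P_f)(t) - (P_f'/P_f)(aᵢ)) / (t - aᵢ) φ(t) dt ∈ ℂ(V/W)`. -/
def wCoef (φ : Polynomial ℂ) (i : Fin (g + 3)) : FW a :=
  resInfty
    ((algebraMap (Polynomial (FW a)) (RatFunc (FW a)) (Polynomial.derivative (Pf a)) /
          algebraMap (Polynomial (FW a)) (RatFunc (FW a)) (Pf a)
        - RatFunc.C ((Polynomial.derivative (Pf a)).eval (algebraMap ℂ (FW a) (a i)) /
            (Pf a).eval (algebraMap ℂ (FW a) (a i)))) /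
      (RatFunc.X - RatFunc.C (algebraMap ℂ (FW a) (a i))) *
      algebraMap (Polynomial (FW a)) (RatFunc (FW a)) (φ.map (algebraMap ℂ (FW a))))

/-- `hᵢ = -2 fᵢ fᵢ*`. -/
def hhat (i : Fin (g + 3)) : AW a :=
  -2 * coef (derU a) (toOW a (MvPolynomial.X i)) * gen (derU a) i

/-- `vᵢ = -2 fᵢ fᵢ*` in `𝒪 ⊗ S(V*)`. -/
def vcl (i : Fin (g + 3)) : BW a :=
  -2 * MvPolynomial.C (toOW a (MvPolynomial.X i)) * MvPolynomial.X i

/-- `r` is a family of lifts to `𝒪⁰` of the coefficients of `Ŵ[φ]`, which lie in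
`ℂ(V/W) = 𝒪 / (W)`. -/
def IsLift (φ : Polynomial ℂ) (r : Fin (g + 3) → OW a) : Prop :=
  ∀ i, r i ∈ homog a 0 ∧ IsLocalRing.residue (OW a) (r i) = wCoef a φ i

/-- `w` is a representative `∑ᵢ rᵢ hᵢ` in `A` of `Ŵ[φ]`, which is an element of `A / W A`. -/
def IsWhat (φ : Polynomial ℂ) (w : AW a) : Prop :=
  ∃ r, IsLift a φ r ∧ w = ∑ i, coef (derU a) (r i) * hhat a i

/-- `w` is a representative `∑ᵢ rᵢ vᵢ` in `𝒪 ⊗ S(V*)` of the classical element `W[φ]`. -/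
def IsWcl (φ : Polynomial ℂ) (w : BW a) : Prop :=
  ∃ r, IsLift a φ r ∧ w = ∑ i, MvPolynomial.C (r i) * vcl a i

/-! ### The isomorphisms -/

/-- The conditions on `Λ̂`: it takes the elementary symmetric functions of the `x̂_α` to
`∑ᵢ f̄ᵢ ∑_{j₁ < … < j_{k+2}, all ≠ i} a_{j₁} ⋯ a_{j_{k+2}}`, and `Ŷ[φ]` to `Ŵ[φ]`. -/
def IsQuantumGNR (L : AX a ≃ₐ[ℂ] AU a) : Prop :=
  (∀ k, 1 ≤ k → k ≤ g →
    L (ehat a k) = ∑ i, esymmErase a (k + 2) i • mkAU a (fbar a i)) ∧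
  ∀ (φ : Polynomial ℂ) (w : N0 a), IsWhat a φ w → L (Yhat a φ) = mkAU a w

/-- The conditions on the classical isomorphism `Λ`, extended to the symmetric algebras: the same
formulas, and compatibility with the gradings and with the Poisson brackets. -/
structure IsClassicalGNR (L : SX g ≃ₐ[ℂ] SU a) : Prop where
  esymm : ∀ k, 1 ≤ k → k ≤ g →
    L (ecl g k) = ∑ i, esymmErase a (k + 2) i • mkSU a (ubar a i)
  residue : ∀ (φ : Polynomial ℂ) (w : BW a), IsWcl a φ w →
    ∃ h : w ∈ Ncl0 a, L (Ycl a φ) = mkSU a ⟨w, h⟩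
  graded : ∀ (k : ℕ) (p : SX g), (p : MvPolynomial (Fin g) (RatX g)).IsHomogeneous k ↔
    ∃ q : Ncl0 a, (q : BW a).IsHomogeneous k ∧ mkSU a q = L p
  poisson : ∀ (p p' : SX g) (q q' : Ncl0 a), L p = mkSU a q → L p' = mkSU a q' →
    ∃ (h : bracket (derX a) (p : MvPolynomial (Fin g) (RatX g)) p' ∈ SX g)
      (h' : bracket (derU a) (q : BW a) q' ∈ Ncl0 a), L ⟨_, h⟩ = mkSU a ⟨_, h'⟩

/-- `M` quantizes `L`: it is an isomorphism of filtered algebras, and its associated graded is `L`,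
i.e. the symbol of `M x` is the image under `L` of the symbol of `x`. -/
def IsQuantizationOf (M : AX a ≃ₐ[ℂ] AU a) (L : SX g ≃ₐ[ℂ] SU a) : Prop :=
  (∀ k, M '' filtAX a k = filtAU a k) ∧
  ∀ (k : ℕ) (x : AX a) (p : SX g), HasSymbol (derX a) k (x : AXfull a) p →
    ∃ (y : N0 a) (q : Ncl0 a), mkAU a y = M x ∧ mkSU a q = L p ∧
      HasSymbol (derU a) k (y : AW a) q

end USide

end

end GNR

open GNR

namespace GNR

set_option linter.unusedSectionVars false

noncomputable section

open MvPolynomial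

/-! ### Polynomials of bounded degree and normal ordering -/

section CrossedTheory

variable {R ι : Type} [CommRing R] [Algebra ℂ R] [Fintype ι] [DecidableEq ι]

/-! Both sides are compared with one explicit model: the algebra `ℂ(q)[∂/∂q]` of differential
operators in the coefficients `q₀, …, q_{g-1}` of a generic monic polynomial `Q = X^g + ∑ qⱼ X^j`
(`genericMonic`, `derE`), with classical limit `ℂ(q)[ξ]`. The comparison maps `quantumX`, `quantumU`
and `classicalX`, `classicalU` become isomorphisms onto the two quantum and the two classical
algebras, and `Λ̂`, `Λ` are the composites.

On the `𝒳` side `Q = ∏ (X - x_α)`. By the theorem on symmetric functions `ℂ(q)` is the field of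
invariants in `ℂ(x)`. The fields `∂/∂qₖ` lift to `ℂ(x)` by implicit differentiation of `Q(x_α) = 0`.
Over `ℂ(x)` passing from the `y_α` to the new momenta is an invertible linear change of variables,
and the new momenta are fixed by `𝔖_g`; so the invariants are the polynomials in them with
coefficients in `ℂ(q)`.

On the `𝒰` side `P_f(aᵢ) = fᵢ Π'(aᵢ)`, and the three top coefficients of `P_f` are triangular
combinations of `ℓₖ = ∑ aᵢᵏ fᵢ`, `k = 0, 1, 2`. Modulo `W` this leaves `P_f = ℓ₂ Q` with `Q` monic
of degree `g`, and every function of degree `0` on `V/W` is a function of the coefficients of `Q`.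
The field `∂/∂qₘ` is `ℓ₂ ∑ aᵢᵐ/Π'(aᵢ) fᵢ*`. A symbol normalizes `W` exactly when, modulo `W`, it is
invariant under the momentum translations in the directions `(1)` and `(aᵢ)`; it is then a
polynomial in the `∂/∂qₘ` and `Φ`. Hence a symbol of the normalizer that vanishes on the reduced
space lies in `W B⁻¹ + N Φ`, where `B = 𝒪 ⊗ S(V*)` and `N` is the classical normalizer
(`exists_of_thetaU_eq_zero`).

The quantum statements follow from the classical ones. Since `W` is linear, commutators with `W`
have no higher order corrections, so normal ordering identifies the classical and quantum
normalizers (`nord_mem_N0_iff`). Injectivity holds because `ℂ(q)[∂/∂q]` acts faithfully on `ℂ(q)`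
(`opHom_injective`); surjectivity is an induction on the order, removing leading symbols. The same
induction shows that the filtrations correspond, and the symbol of an image is computed by
`crossedMap_nord_hasSymbol`.

The generators match because `Ŷ[φ]` and `Ŵ[φ]` are both images of the vector field `Q ↦ -2 (φ Q' mod
Q)`: on one side by its values at the roots `x_α`, on the other by the residue formula
`resInfty_logDeriv` and interpolation at the `aᵢ`. As `Q` and `Q'` are coprime, these fields span
all `∂/∂qₖ` over `ℂ(q)`, which gives uniqueness. -/

/-- Polynomials of total degree at most `k`. -/
def degLE (R ι : Type) [CommRing R] [Algebra ℂ R] (k : ℤ) : Submodule ℂ (MvPolynomial ι R) where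
  carrier := {p | ∀ m, p.coeff m ≠ 0 → (m.degree : ℤ) ≤ k}
  add_mem' := by
    intro p q hp hq m hm
    by_contra hk
    apply hm
    rw [coeff_add, not_not.mp (mt (hp m) hk), not_not.mp (mt (hq m) hk), add_zero]
  zero_mem' := by intro m hm; simp at hm
  smul_mem' := by
    intro c p hp m hm
    apply hp m
    intro h0
    apply hm
    simp [h0]

theorem degLE_mono {k l : ℤ} (h : k ≤ l) : degLE R ι k ≤ degLE R ι l :=
  fun _ hp m hm => (hp m hm).trans h

theorem degree_eq_of_isHomogeneous {p : MvPolynomial ι R} {k : ℕ} (hp : p.IsHomogeneous k)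
    {m : ι →₀ ℕ} (hm : p.coeff m ≠ 0) : m.degree = k := by
  rw [← hp hm, Finsupp.degree_eq_weight_one]
  rfl

theorem IsHomogeneous.mem_degLE {p : MvPolynomial ι R} {k : ℕ} (hp : p.IsHomogeneous k) :
    p ∈ degLE R ι k := by
  intro m hm
  rw [degree_eq_of_isHomogeneous hp hm]

theorem eq_zero_of_mem_degLE {p : MvPolynomial ι R} {k : ℤ} (hk : k < 0) (hp : p ∈ degLE R ι k) :
    p = 0 := by
  ext m
  rw [coeff_zero]
  by_contra h
  have := hp m h
  omega

theorem exists_mem_degLE (p : MvPolynomial ι R) : ∃ k : ℕ, p ∈ degLE R ι k := by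
  refine ⟨p.totalDegree, fun m hm => ?_⟩
  exact_mod_cast le_totalDegree (mem_support_iff.mpr hm)

theorem sub_homogeneousComponent_mem_degLE {p : MvPolynomial ι R} {k : ℕ}
    (hp : p ∈ degLE R ι k) : p - homogeneousComponent k p ∈ degLE R ι ((k : ℤ) - 1) := by
  intro m hm
  rw [coeff_sub, coeff_homogeneousComponent] at hm
  split_ifs at hm with h
  · simp at hm
  · rw [sub_zero] at hm
    have := hp m hm
    omega

theorem pderiv_mem_degLE (i : ι) {p : MvPolynomial ι R} {k : ℤ} (hp : p ∈ degLE R ι k) :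
    pderiv i p ∈ degLE R ι (k - 1) := by
  intro m hm
  rw [coeff_pderiv] at hm
  have := hp _ (left_ne_zero_of_mul hm)
  rw [map_add, Finsupp.degree_single] at this
  push_cast at this
  omega

theorem mul_mem_degLE {p q : MvPolynomial ι R} {k l : ℤ} (hp : p ∈ degLE R ι k)
    (hq : q ∈ degLE R ι l) : p * q ∈ degLE R ι (k + l) := by
  classical
  intro m hm
  rw [coeff_mul] at hm
  obtain ⟨x, hx, hne⟩ := Finset.exists_ne_zero_of_sum_ne_zero hm
  rw [Finset.HasAntidiagonal.mem_antidiagonal] at hx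
  have h1 := hp _ (left_ne_zero_of_mul hne)
  have h2 := hq _ (right_ne_zero_of_mul hne)
  rw [← hx, map_add]
  push_cast
  omega

/-- The positive integers that appear on differentiating are invertible, since `R` is a `ℂ`-algebra;
no nonconstant monomial can then be killed by all partial derivatives. -/
theorem eq_C_of_pderiv_eq_zero {p : MvPolynomial ι R} (h : ∀ i, pderiv i p = 0) :
    p = C (p.coeff 0) := by
  classical
  ext m
  rw [coeff_C]
  split_ifs with hm
  · rw [hm]
  · obtain ⟨i, hi⟩ : ∃ i, m i ≠ 0 := by
      by_contra hc
      push Not at hc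
      exact hm (Finsupp.ext fun i => (hc i).symm)
    have e := congrArg (coeff (m - Finsupp.single i 1)) (h i)
    rw [coeff_pderiv, coeff_zero, tsub_add_cancel_of_le
      (Finsupp.single_le_iff.mpr (Nat.one_le_iff_ne_zero.mpr hi))] at e
    have hu : IsUnit (((m - Finsupp.single i 1 : ι →₀ ℕ) i : R) + 1) := by
      have : (((m - Finsupp.single i 1 : ι →₀ ℕ) i : R) + 1)
          = algebraMap ℂ R (((m - Finsupp.single i 1 : ι →₀ ℕ) i : ℂ) + 1) := by simp
      rw [this]
      exact (isUnit_iff_ne_zero.mpr (Nat.cast_add_one_ne_zero _)).map _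
    exact (hu.mul_left_eq_zero).mp e

/-! ### Coefficientwise derivations, and the actions of a crossed product on functions and on
symbols -/

variable (δ : ι → Derivation ℂ R R)

theorem coeffD_monomial (D : Derivation ℂ R R) (m : ι →₀ ℕ) (r : R) :
    coeffD D (monomial m r) = monomial m (D r) := by
  classical
  ext k
  rw [coeff_coeffD, coeff_monomial, coeff_monomial]
  split_ifs <;> simp

theorem coeffD_C (D : Derivation ℂ R R) (r : R) :
    coeffD D (C r : MvPolynomial ι R) = C (D r) := coeffD_monomial D 0 r

theorem coeffD_X (D : Derivation ℂ R R) (i : ι) : coeffD D (X i : MvPolynomial ι R) = 0 := by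
  rw [X, coeffD_monomial]; simp

theorem coeffD_mul (D : Derivation ℂ R R) (p q : MvPolynomial ι R) :
    coeffD D (p * q) = p * coeffD D q + coeffD D p * q := by
  induction p using MvPolynomial.induction_on' with
  | add p p' h h' => simp only [add_mul, map_add, h, h']; ring
  | monomial m r =>
    induction q using MvPolynomial.induction_on' with
    | add q q' h h' => simp only [mul_add, map_add, h, h']; ring
    | monomial n s =>
      simp only [monomial_mul, coeffD_monomial, Derivation.leibniz, smul_eq_mul, map_add]
      ring_nf

theorem pderiv_coeffD (D : Derivation ℂ R R) (i : ι) (p : MvPolynomial ι R) :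
    pderiv i (coeffD D p) = coeffD D (pderiv i p) := by
  ext m
  rw [coeff_pderiv, coeff_coeffD, coeff_coeffD, coeff_pderiv, Derivation.leibniz]
  have : D ((m i : R) + 1) = 0 := by
    have e : ((m i : R) + 1) = algebraMap ℂ R ((m i : ℂ) + 1) := by simp
    rw [e, Derivation.map_algebraMap]
  rw [this, smul_zero, zero_add, smul_eq_mul, mul_comm]

theorem coeffD_mem_degLE (D : Derivation ℂ R R) {p : MvPolynomial ι R} {k : ℤ}
    (hp : p ∈ degLE R ι k) : coeffD D p ∈ degLE R ι k := by
  intro m hm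
  apply hp m
  intro h0
  rw [coeff_coeffD, h0, map_zero] at hm
  exact hm rfl

/-- The action of the crossed product on `R`. -/
def opHom (hδ : ∀ i j r, δ i (δ j r) = δ j (δ i r)) : CrossedProduct δ →ₐ[ℂ] Module.End ℂ R :=
  RingQuot.liftAlgHom ℂ
    ⟨FreeAlgebra.lift ℂ (Sum.elim (fun r => Algebra.lmul ℂ R r) (fun i => (δ i : R →ₗ[ℂ] R))), by
      intro x y hxy
      cases hxy with
      | add r s => simp
      | mul r s => ext; simp [mul_assoc]
      | scalar c => ext; simp [Algebra.smul_def]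
      | comm i j => ext r; simpa using hδ i j r
      | leibniz i r => ext s; simp [mul_comm]⟩

theorem opHom_coef (hδ : ∀ i j r, δ i (δ j r) = δ j (δ i r)) (r s : R) :
    opHom δ hδ (coef δ r) s = r * s := by
  change opHom δ hδ (RingQuot.mkAlgHom ℂ (CrossedRel δ) _) s = _
  simp [opHom, RingQuot.liftAlgHom_mkAlgHom_apply]

theorem opHom_gen (hδ : ∀ i j r, δ i (δ j r) = δ j (δ i r)) (i : ι) (s : R) :
    opHom δ hδ (gen δ i) s = δ i s := by
  change opHom δ hδ (RingQuot.mkAlgHom ℂ (CrossedRel δ) _) s = _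
  simp [opHom, RingQuot.liftAlgHom_mkAlgHom_apply]

/-- The action of the crossed product on `R[ξ]` by left multiplication on normally ordered
expressions. -/
def symbolHom (hδ : ∀ i j r, δ i (δ j r) = δ j (δ i r)) :
    CrossedProduct δ →ₐ[ℂ] Module.End ℂ (MvPolynomial ι R) :=
  RingQuot.liftAlgHom ℂ
    ⟨FreeAlgebra.lift ℂ (Sum.elim (fun r => Algebra.lmul ℂ (MvPolynomial ι R) (C r))
      (fun i => Algebra.lmul ℂ (MvPolynomial ι R) (X i) + coeffD (δ i))), by
      intro x y hxy
      cases hxy with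
      | add r s => simp
      | mul r s => exact LinearMap.ext fun p => by simp [mul_assoc]
      | scalar c =>
        simp only [FreeAlgebra.lift_ι_apply, Sum.elim_inl, AlgHom.commutes]
        exact AlgHom.commutes _ _
      | comm i j =>
        refine LinearMap.ext fun p => ?_
        have h : coeffD (δ i) (coeffD (δ j) p) = coeffD (δ j) (coeffD (δ i) p) := by
          ext m; simp only [coeff_coeffD, hδ i j]
        simp only [map_mul, FreeAlgebra.lift_ι_apply, Sum.elim_inr, Module.End.mul_apply,
          LinearMap.add_apply, Algebra.coe_lmul_eq_mul, LinearMap.mul_apply', map_add, coeffD_mul,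
          coeffD_X, h]
        ring
      | leibniz i r =>
        refine LinearMap.ext fun p => ?_
        simp only [map_mul, map_add, FreeAlgebra.lift_ι_apply, Sum.elim_inr, Sum.elim_inl,
          Module.End.mul_apply, LinearMap.add_apply, Algebra.coe_lmul_eq_mul,
          LinearMap.mul_apply', coeffD_mul, coeffD_C]
        ring⟩

theorem symbolHom_coef (hδ : ∀ i j r, δ i (δ j r) = δ j (δ i r)) (r : R) (p : MvPolynomial ι R) :
    symbolHom δ hδ (coef δ r) p = C r * p := by
  change symbolHom δ hδ (RingQuot.mkAlgHom ℂ (CrossedRel δ) _) p = _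
  simp [symbolHom, RingQuot.liftAlgHom_mkAlgHom_apply]

theorem symbolHom_gen (hδ : ∀ i j r, δ i (δ j r) = δ j (δ i r)) (i : ι) (p : MvPolynomial ι R) :
    symbolHom δ hδ (gen δ i) p = X i * p + coeffD (δ i) p := by
  change symbolHom δ hδ (RingQuot.mkAlgHom ℂ (CrossedRel δ) _) p = _
  simp [symbolHom, RingQuot.liftAlgHom_mkAlgHom_apply]

/-- Two homomorphisms on a crossed product agree if they agree on coefficients and generators. -/
theorem crossedProduct_hom_ext {B : Type} [Semiring B] [Algebra ℂ B] {F G : CrossedProduct δ →ₐ[ℂ] B}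
    (h1 : ∀ r, F (coef δ r) = G (coef δ r)) (h2 : ∀ i, F (gen δ i) = G (gen δ i)) : F = G := by
  apply RingQuot.ringQuot_ext' ℂ
  apply FreeAlgebra.hom_ext
  funext x
  cases x with
  | inl r => exact h1 r
  | inr i => exact h2 i

/-! ### Normal ordering is a bijection -/

theorem nord_C (r : R) : nord δ (C r) = coef δ r := by
  rw [C_apply, nord_monomial, genPow_zero, mul_one]

theorem nord_X (i : ι) : nord δ (X i) = gen δ i := by
  rw [X, nord_monomial, genPow_single, map_one, one_mul]

theorem nord_C_mul_X (r : R) (i : ι) : nord δ (C r * X i) = coef δ r * gen δ i := by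
  rw [← coef_mul_nord, nord_X]

theorem nord_mul_X (p : MvPolynomial ι R) (i : ι) : nord δ (p * X i) = nord δ p * gen δ i := by
  induction p using MvPolynomial.induction_on' with
  | monomial m s =>
    rw [X, monomial_mul, mul_one, nord_monomial, nord_monomial, genPow_add, genPow_single,
      mul_assoc]
  | add p q hp hq => rw [add_mul, map_add, hp, hq, map_add, add_mul]

/-- The range of `nord` contains `1` and is stable under left multiplication by every generator. -/
theorem nord_surjective : Function.Surjective (nord δ) := by
  intro z
  obtain ⟨x, rfl⟩ := RingQuot.mkAlgHom_surjective ℂ (CrossedRel δ) z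
  have key : ∀ p, ∃ q, RingQuot.mkAlgHom ℂ (CrossedRel δ) x * nord δ p = nord δ q := by
    induction x using FreeAlgebra.induction with
    | grade0 c =>
      intro p
      exact ⟨c • p, by rw [AlgHom.commutes, map_smul, Algebra.smul_def]⟩
    | grade1 s =>
      intro p
      cases s with
      | inl r => exact ⟨C r * p, coef_mul_nord δ r p⟩
      | inr i => exact ⟨_, (gen_mul_nord δ i p).trans (map_add _ _ _).symm⟩
    | mul x y hx hy =>
      intro p
      obtain ⟨q, hq⟩ := hy p
      obtain ⟨q', hq'⟩ := hx q
      exact ⟨q', by rw [map_mul, mul_assoc, hq, hq']⟩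
    | add x y hx hy =>
      intro p
      obtain ⟨q, hq⟩ := hy p
      obtain ⟨q', hq'⟩ := hx p
      exact ⟨q' + q, by rw [map_add, add_mul, hq, hq', map_add]⟩
  obtain ⟨q, hq⟩ := key (C 1)
  refine ⟨q, ?_⟩
  rw [← hq, nord_C, map_one, mul_one]

/-- The Poincaré–Birkhoff–Witt property: acting on `1` through `symbolHom`, a normally ordered
expression returns its own symbol. Commutation of the `δ i` is what makes that action exist. -/
theorem nord_injective (hδ : ∀ i j r, δ i (δ j r) = δ j (δ i r)) :
    Function.Injective (nord δ) := by
  -- Only `q = 1` is needed, but the induction replaces `q` by `X i * q`; constancy of the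
  -- coefficients of `q` is the condition that survives this.
  have key : ∀ p q : MvPolynomial ι R, (∀ i, coeffD (δ i) q = 0) →
      symbolHom δ hδ (nord δ p) q = p * q := by
    intro p
    induction p using MvPolynomial.induction_on with
    | C r => intro q _; rw [nord_C, symbolHom_coef]
    | add p p' hp hp' => intro q hq; rw [map_add, map_add, LinearMap.add_apply, hp q hq, hp' q hq,
        add_mul]
    | mul_X p i hp =>
      intro q hq
      rw [nord_mul_X, map_mul, Module.End.mul_apply, symbolHom_gen, hq i, add_zero, hp, mul_assoc]
      intro j
      rw [coeffD_mul, hq j, coeffD_X]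
      simp
  intro p p' h
  have e1 := key p 1 fun i => by rw [← C_1, coeffD_C]; simp
  have e2 := key p' 1 fun i => by rw [← C_1, coeffD_C]; simp
  rw [h, e2] at e1
  simpa using e1.symm

/-! ### The order filtration -/

theorem nord_mem_filt {k : ℤ} {p : MvPolynomial ι R} (hp : p ∈ degLE R ι k) :
    nord δ p ∈ filt δ k := ⟨p, hp, rfl⟩

theorem filt_mono {k l : ℤ} (h : k ≤ l) : filt δ k ≤ filt δ l :=
  Submodule.map_mono (degLE_mono h)

theorem coef_mul_mem_filt (r : R) {k : ℤ} {z : CrossedProduct δ} (hz : z ∈ filt δ k) :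
    coef δ r * z ∈ filt δ k := by
  obtain ⟨p, hp, rfl⟩ := hz
  rw [coef_mul_nord]
  refine nord_mem_filt δ ?_
  have := mul_mem_degLE (k := 0) (p := C r)
    (IsHomogeneous.mem_degLE (k := 0) (isHomogeneous_C ι r)) hp
  simpa using this

theorem X_mul_mem_degLE (i : ι) {p : MvPolynomial ι R} {k : ℤ} (hp : p ∈ degLE R ι k) :
    X i * p ∈ degLE R ι (k + 1) := by
  rw [add_comm]
  exact mul_mem_degLE (k := 1) (IsHomogeneous.mem_degLE (k := 1) (isHomogeneous_X R i)) hp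

theorem gen_mul_mem_filt (i : ι) {k : ℤ} {z : CrossedProduct δ} (hz : z ∈ filt δ k) :
    gen δ i * z ∈ filt δ (k + 1) := by
  obtain ⟨p, hp, rfl⟩ := hz
  rw [gen_mul_nord]
  exact add_mem (nord_mem_filt δ (X_mul_mem_degLE i hp))
    (filt_mono δ (by omega) (nord_mem_filt δ (coeffD_mem_degLE (δ i) hp)))

theorem monomial_mul_mem_degLE (m : ι →₀ ℕ) (r : R) {k : ℤ} {p : MvPolynomial ι R}
    (hp : p ∈ degLE R ι k) : monomial m r * p ∈ degLE R ι (m.degree + k) :=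
  mul_mem_degLE (IsHomogeneous.mem_degLE (isHomogeneous_monomial r rfl)) hp

/-- Induction on `|m|`, peeling off the leftmost `∂ᵢ`: the only new error is `coeffD (δ i)` of the
product, which does not raise the degree while `∂ᵢ` does. -/
theorem genPow_mul_nord_sub (m : ι →₀ ℕ) {k : ℤ} {p : MvPolynomial ι R} (hp : p ∈ degLE R ι k) :
    genPow δ m * nord δ p - nord δ (monomial m 1 * p) ∈ filt δ (m.degree + k - 1) := by
  suffices H : ∀ n : ℕ, ∀ m : ι →₀ ℕ, m.degree = n →
      genPow δ m * nord δ p - nord δ (monomial m 1 * p) ∈ filt δ (m.degree + k - 1) from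
    H _ m rfl
  intro n
  induction n with
  | zero =>
    intro m hm
    rw [Finsupp.degree_eq_zero_iff] at hm
    subst hm
    have : (monomial (0 : ι →₀ ℕ) (1 : R)) = 1 := rfl
    rw [genPow_zero, this, one_mul, one_mul, sub_self]
    exact zero_mem _
  | succ n ih =>
    intro m hm
    obtain ⟨i, hi⟩ : ∃ i, m i ≠ 0 := by
      by_contra hc
      push Not at hc
      have : m = 0 := Finsupp.ext hc
      rw [this] at hm
      simp at hm
    obtain ⟨m', rfl⟩ : ∃ m', m = Finsupp.single i 1 + m' :=
      ⟨m - Finsupp.single i 1, (add_tsub_cancel_of_le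
        (Finsupp.single_le_iff.mpr (Nat.one_le_iff_ne_zero.mpr hi))).symm⟩
    rw [map_add, Finsupp.degree_single] at hm ⊢
    have h := ih m' (by omega)
    have e1 : (monomial (Finsupp.single i 1 + m') (1 : R)) * p = X i * (monomial m' 1 * p) := by
      rw [X, ← mul_assoc, monomial_mul, one_mul]
    have e2 : genPow δ (Finsupp.single i 1 + m') * nord δ p - nord δ (X i * (monomial m' 1 * p))
        = gen δ i * (genPow δ m' * nord δ p - nord δ (monomial m' 1 * p))
          + nord δ (coeffD (δ i) (monomial m' 1 * p)) := by
      rw [genPow_add, genPow_single, mul_sub, gen_mul_nord, mul_assoc]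
      abel
    rw [e1, e2]
    refine add_mem (filt_mono δ ?_ (gen_mul_mem_filt δ i h))
      (filt_mono δ ?_ (nord_mem_filt δ (coeffD_mem_degLE (δ i) (monomial_mul_mem_degLE m' 1 hp))))
    · push_cast; omega
    · push_cast; omega

/-- Reordering costs at least one order. This is why symbols multiply as commutative polynomials,
and it is the only input to the filtration arguments below. -/
theorem nord_mul_nord_sub {k l : ℤ} {p q : MvPolynomial ι R} (hp : p ∈ degLE R ι k)
    (hq : q ∈ degLE R ι l) : nord δ p * nord δ q - nord δ (p * q) ∈ filt δ (k + l - 1) := by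
  have e : nord δ p * nord δ q - nord δ (p * q) = ∑ m ∈ p.support,
      coef δ (p.coeff m) * (genPow δ m * nord δ q - nord δ (monomial m 1 * q)) := by
    conv_lhs => rw [p.as_sum]
    rw [map_sum, Finset.sum_mul, Finset.sum_mul, map_sum, ← Finset.sum_sub_distrib]
    refine Finset.sum_congr rfl fun m _ => ?_
    rw [nord_monomial, mul_sub, mul_assoc, coef_mul_nord, ← mul_assoc (C _), C_mul_monomial,
      mul_one]
  rw [e]
  refine Submodule.sum_mem _ fun m hm => coef_mul_mem_filt δ _ (filt_mono δ ?_
    (genPow_mul_nord_sub δ m hq))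
  have := hp m (mem_support_iff.mp hm)
  omega

theorem mul_mem_filt {k l : ℤ} {x y : CrossedProduct δ} (hx : x ∈ filt δ k) (hy : y ∈ filt δ l) :
    x * y ∈ filt δ (k + l) := by
  obtain ⟨p, hp, rfl⟩ := hx
  obtain ⟨q, hq, rfl⟩ := hy
  have h := nord_mul_nord_sub δ hp hq
  rw [← sub_add_cancel (nord δ p * nord δ q) (nord δ (p * q))]
  exact add_mem (filt_mono δ (by omega) h) (nord_mem_filt δ (mul_mem_degLE hp hq))

theorem HasSymbol.mem_filt {k : ℕ} {x : CrossedProduct δ} {p : MvPolynomial ι R}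
    (h : HasSymbol δ k x p) : x ∈ filt δ k := by
  rw [← sub_add_cancel x (nord δ p)]
  exact add_mem (filt_mono δ (by omega) h.2) (nord_mem_filt δ (IsHomogeneous.mem_degLE h.1))

theorem HasSymbol.mul {k l : ℕ} {x y : CrossedProduct δ} {p q : MvPolynomial ι R}
    (hx : HasSymbol δ k x p) (hy : HasSymbol δ l y q) : HasSymbol δ (k + l) (x * y) (p * q) := by
  refine ⟨hx.1.mul hy.1, ?_⟩
  have e : x * y - nord δ (p * q) = (x - nord δ p) * y + nord δ p * (y - nord δ q)
      + (nord δ p * nord δ q - nord δ (p * q)) := by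
    rw [sub_mul, mul_sub]; abel
  have hp := nord_mem_filt δ (IsHomogeneous.mem_degLE hx.1)
  rw [e]
  refine add_mem (add_mem (filt_mono δ ?_ (mul_mem_filt δ hx.2 hy.mem_filt))
    (filt_mono δ ?_ (mul_mem_filt δ hp hy.2))) (filt_mono δ ?_ (nord_mul_nord_sub δ
      (IsHomogeneous.mem_degLE hx.1) (IsHomogeneous.mem_degLE hy.1)))
  all_goals push_cast; omega

theorem HasSymbol.sum {κ : Type} (s : Finset κ) {k : ℕ} {x : κ → CrossedProduct δ}
    {p : κ → MvPolynomial ι R} (h : ∀ i ∈ s, HasSymbol δ k (x i) (p i)) :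
    HasSymbol δ k (∑ i ∈ s, x i) (∑ i ∈ s, p i) := by
  refine ⟨IsHomogeneous.sum _ _ _ fun i hi => (h i hi).1, ?_⟩
  rw [map_sum, ← Finset.sum_sub_distrib]
  exact Submodule.sum_mem _ fun i hi => (h i hi).2

theorem HasSymbol.nord {k : ℕ} {p : MvPolynomial ι R} (hp : p.IsHomogeneous k) :
    HasSymbol δ k (nord δ p) p := ⟨hp, by rw [sub_self]; exact zero_mem _⟩

/-- Commutation of a normally ordered expression with a function having constant derivatives. -/
theorem nord_mul_coef_of_const {w : R} {c : ι → ℂ} (hw : ∀ i, δ i w = algebraMap ℂ R (c i))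
    (p : MvPolynomial ι R) :
    nord δ p * coef δ w = coef δ w * nord δ p + nord δ (∑ i, c i • pderiv i p) := by
  induction p using MvPolynomial.induction_on with
  | C r =>
    simp only [pderiv_C, smul_zero, Finset.sum_const_zero, map_zero, add_zero, nord_C, ← map_mul,
      mul_comm]
  | add p p' hp hp' =>
    simp only [map_add, smul_add, Finset.sum_add_distrib, add_mul, mul_add, hp, hp']
    abel
  | mul_X p i hp =>
    have e : ∑ j, c j • pderiv j (p * X i) = (∑ j, c j • pderiv j p) * X i + c i • p := by
      simp only [Derivation.leibniz, pderiv_X, smul_eq_mul, smul_add, Finset.sum_add_distrib]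
      rw [add_comm, Finset.sum_mul]
      congr 1
      · exact Finset.sum_congr rfl fun j _ => by rw [mul_comm, smul_mul_assoc]
      · rw [Finset.sum_eq_single i]
        · simp
        · intro j _ hj; simp [Ne.symm hj]
        · simp
    have h1 : coef δ (algebraMap ℂ R (c i)) = algebraMap ℂ _ (c i) := AlgHom.commutes _ _
    rw [e, map_add, nord_mul_X, nord_mul_X, mul_assoc, gen_mul_coef, mul_add, ← mul_assoc, hp,
      hw, h1, add_mul, map_smul, Algebra.smul_def, mul_assoc, ← Algebra.commutes, add_assoc]

/-- The crossed product by coordinate derivations acts faithfully. -/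
theorem opHom_injective (hδ : ∀ i j r, δ i (δ j r) = δ j (δ i r)) (z : ι → R)
    (hz : ∀ i j, δ i (z j) = if i = j then 1 else 0) : Function.Injective (opHom δ hδ) := by
  have key : ∀ (n : ℕ) (p : MvPolynomial ι R), p ∈ degLE R ι ((n : ℤ) - 1) →
      opHom δ hδ (nord δ p) = 0 → p = 0 := by
    intro n
    induction n with
    | zero => intro p hp _; exact eq_zero_of_mem_degLE (by simp) hp
    | succ n ih =>
      intro p hp h0
      have hd : ∀ j, pderiv j p = 0 := by
        intro j
        refine ih _ (degLE_mono (by push_cast; omega) (pderiv_mem_degLE j hp)) ?_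
        -- The commutator with multiplication by `z j` is the normal ordering of `∂p/∂ξⱼ`. If `p`
        -- acts by zero, so does this derivative, which has smaller order. By induction all
        -- derivatives vanish, so `p` is a function, recovered from its action on `1`.
        have hc := nord_mul_coef_of_const δ (w := z j) (c := fun i => if i = j then 1 else 0)
          (fun i => by rw [hz]; split_ifs <;> simp) p
        have e : ∑ i, (if i = j then (1 : ℂ) else 0) • pderiv i p = pderiv j p := by
          simp
        rw [e] at hc
        have := congrArg (opHom δ hδ) hc
        rw [map_mul, map_add, map_mul, h0] at this
        simpa using this.symm
      rw [eq_C_of_pderiv_eq_zero hd] at h0 ⊢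
      have := congrArg (fun T : Module.End ℂ R => T 1) h0
      simp only [nord_C, opHom_coef, mul_one, LinearMap.zero_apply] at this
      rw [this, C_0]
  rw [injective_iff_map_eq_zero]
  intro x hx
  obtain ⟨p, rfl⟩ := nord_surjective δ x
  obtain ⟨k, hk⟩ := exists_mem_degLE p
  rw [key (k + 1) p (by simpa using hk) hx, map_zero]

/-! ### The Poisson bracket -/

theorem bracket_add_left (p p' q : MvPolynomial ι R) :
    bracket δ (p + p') q = bracket δ p q + bracket δ p' q := by
  simp only [bracket, map_add, ← Finset.sum_add_distrib]
  exact Finset.sum_congr rfl fun i _ => by ring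

theorem bracket_antisymm (p q : MvPolynomial ι R) : bracket δ q p = -bracket δ p q := by
  simp only [bracket, ← Finset.sum_neg_distrib]
  exact Finset.sum_congr rfl fun i _ => by ring

theorem bracket_add_right (p q q' : MvPolynomial ι R) :
    bracket δ p (q + q') = bracket δ p q + bracket δ p q' := by
  simp only [bracket, map_add, ← Finset.sum_add_distrib]
  exact Finset.sum_congr rfl fun i _ => by ring

theorem bracket_mul_left (p p' q : MvPolynomial ι R) :
    bracket δ (p * p') q = p * bracket δ p' q + bracket δ p q * p' := by
  simp only [bracket, coeffD_mul, Derivation.leibniz, smul_eq_mul, Finset.mul_sum, Finset.sum_mul,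
    ← Finset.sum_add_distrib]
  exact Finset.sum_congr rfl fun i _ => by ring

theorem bracket_mul_right (p q q' : MvPolynomial ι R) :
    bracket δ p (q * q') = q * bracket δ p q' + bracket δ p q * q' := by
  rw [bracket_antisymm, bracket_mul_left, bracket_antisymm δ p q, bracket_antisymm δ p q']
  ring

theorem bracket_X_left (i : ι) (q : MvPolynomial ι R) :
    bracket δ (X i) q = coeffD (δ i) q := by
  simp only [bracket, coeffD_X, zero_mul, sub_zero, pderiv_X]
  rw [Finset.sum_eq_single i]
  · simp
  · intro j _ hj; simp [Ne.symm hj]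
  · simp

/-! ### Maps of crossed products induced by a change of derivations -/

variable {R' ι' : Type} [CommRing R'] [Algebra ℂ R'] (δ' : ι' → Derivation ℂ R' R')
  [Fintype ι'] [DecidableEq ι'] (f : R →ₐ[ℂ] R') (c : ι → ι' → R')
  {κ : Type}

/-- The derivations `∑ᵢ c m i δ'ᵢ` extend the `δ m` along `f` and commute. -/
structure DerivationChange : Prop where
  extend : ∀ m r, ∑ i, c m i * δ' i (f r) = f (δ m r)
  comm : ∀ m l i, ∑ j, c m j * δ' j (c l i) = ∑ j, c l j * δ' j (c m i)

/-- The first order operator `∑ᵢ c i ∂ᵢ`. -/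
def vectorField (v : ι' → R') : CrossedProduct δ' := ∑ i, coef δ' (v i) * gen δ' i

theorem vectorField_mul_coef (v : ι' → R') (r : R') :
    vectorField δ' v * coef δ' r = coef δ' r * vectorField δ' v + coef δ' (∑ i, v i * δ' i r) := by
  simp only [vectorField, Finset.sum_mul, Finset.mul_sum, map_sum, ← Finset.sum_add_distrib]
  refine Finset.sum_congr rfl fun i _ => ?_
  rw [mul_assoc, gen_mul_coef, mul_add, ← mul_assoc, ← mul_assoc, ← map_mul, ← map_mul, ← map_mul,
    mul_comm r]

/-- The symbol of `vectorField`. -/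
def linForm (v : ι' → R') : MvPolynomial ι' R' := ∑ i, C (v i) * X i

theorem nord_linForm (v : ι' → R') : nord δ' (linForm v) = vectorField δ' v := by
  rw [linForm, map_sum, vectorField]
  exact Finset.sum_congr rfl fun i _ => nord_C_mul_X δ' _ _

theorem linForm_isHomogeneous (v : ι' → R') : (linForm v).IsHomogeneous 1 := by
  refine IsHomogeneous.sum _ _ _ fun i _ => ?_
  simpa using (isHomogeneous_C ι' (v i)).mul (isHomogeneous_X R' i)

theorem opHom_vectorField (hδ : ∀ i j r, δ' i (δ' j r) = δ' j (δ' i r)) (v : ι' → R') (r : R') :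
    opHom δ' hδ (vectorField δ' v) r = ∑ i, v i * δ' i r := by
  simp [vectorField, opHom_coef, opHom_gen]

/-- The first summand is symmetric in `u` and `v`, so two vector fields commute as soon as the
second summands agree; `DerivationChange.comm` is exactly this condition. -/
theorem vectorField_mul_vectorField (u v : ι' → R') :
    vectorField δ' u * vectorField δ' v = nord δ' (linForm u * linForm v)
      + vectorField δ' fun i => ∑ j, u j * δ' j (v i) := by
  have h : ∀ i, gen δ' i * vectorField δ' v
      = nord δ' (X i * linForm v) + nord δ' (coeffD (δ' i) (linForm v)) := by
    intro i; rw [← nord_linForm, gen_mul_nord]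
  have e : vectorField δ' u * vectorField δ' v
      = ∑ i, coef δ' (u i) * (gen δ' i * vectorField δ' v) := by
    conv_lhs => rw [vectorField, Finset.sum_mul]
    exact Finset.sum_congr rfl fun i _ => mul_assoc _ _ _
  rw [e, ← nord_linForm δ' fun i => ∑ j, u j * δ' j (v i), ← map_add]
  simp only [h, ← map_add, coef_mul_nord, ← map_sum]
  congr 1
  simp only [mul_add, Finset.sum_add_distrib]
  congr 1
  · conv_rhs => rw [linForm, Finset.sum_mul]
    exact Finset.sum_congr rfl fun i _ => by ring
  · simp only [linForm, coeffD_mul, coeffD_C, coeffD_X, mul_zero, zero_add,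
      Finset.mul_sum, map_sum, Finset.sum_mul, map_mul]
    rw [Finset.sum_comm]
    exact Finset.sum_congr rfl fun i _ => Finset.sum_congr rfl fun j _ => by ring

variable {δ δ' f c}

theorem DerivationChange.vectorField_comm (H : DerivationChange δ δ' f c) (m l : ι) :
    vectorField δ' (c m) * vectorField δ' (c l) = vectorField δ' (c l) * vectorField δ' (c m) := by
  rw [vectorField_mul_vectorField, vectorField_mul_vectorField, mul_comm (linForm (c m))]
  congr 2
  funext i
  exact H.comm m l i

/-- The homomorphism of crossed products given by `f` on coefficients and
`∂ₘ ↦ ∑ᵢ c m i ∂ᵢ`. -/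
def crossedMap (H : DerivationChange δ δ' f c) : CrossedProduct δ →ₐ[ℂ] CrossedProduct δ' :=
  RingQuot.liftAlgHom ℂ
    ⟨FreeAlgebra.lift ℂ (Sum.elim (fun r => coef δ' (f r)) (fun m => vectorField δ' (c m))), by
      intro x y hxy
      cases hxy with
      | add r s => simp
      | mul r s => simp
      | scalar c => simp
      | comm i j => simpa using H.vectorField_comm i j
      | leibniz i r => simp [vectorField_mul_coef, H.extend]⟩

theorem crossedMap_coef (H : DerivationChange δ δ' f c) (r : R) :
    crossedMap H (coef δ r) = coef δ' (f r) := by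
  change crossedMap H (RingQuot.mkAlgHom ℂ (CrossedRel δ) _) = _
  simp [crossedMap, RingQuot.liftAlgHom_mkAlgHom_apply]

theorem crossedMap_gen (H : DerivationChange δ δ' f c) (m : ι) :
    crossedMap H (gen δ m) = vectorField δ' (c m) := by
  change crossedMap H (RingQuot.mkAlgHom ℂ (CrossedRel δ) _) = _
  simp [crossedMap, RingQuot.liftAlgHom_mkAlgHom_apply]

variable (f c)

/-- The classical limit of `crossedMap`. -/
def symbolMap : MvPolynomial ι R →ₐ[ℂ] MvPolynomial ι' R' :=
  ((aeval fun m => linForm (c m) : MvPolynomial ι R' →ₐ[R'] MvPolynomial ι' R').restrictScalars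
    ℂ).comp (mapAlgHom f)

theorem symbolMap_C (r : R) : symbolMap f c (C r) = C (f r) := by
  simp [symbolMap]

theorem symbolMap_X (m : ι) : symbolMap f c (X m) = linForm (c m) := by
  simp [symbolMap]

theorem symbolMap_monomial_add_single (m : ι →₀ ℕ) (i : ι) (r : R) :
    symbolMap f c (monomial (m + Finsupp.single i 1) r)
      = symbolMap f c (monomial m r) * linForm (c i) := by
  rw [← symbolMap_X f, ← map_mul, X, monomial_mul, mul_one]

variable {f c}

/-- Each generator goes to a first order operator with symbol `linForm (c i)`, and symbols multiply;
so `crossedMap` is filtered with associated graded map `symbolMap`. -/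
theorem crossedMap_monomial (H : DerivationChange δ δ' f c) (m : ι →₀ ℕ) (r : R) :
    HasSymbol δ' m.degree (crossedMap H (nord δ (monomial m r))) (symbolMap f c (monomial m r)) := by
  suffices K : ∀ n : ℕ, ∀ m : ι →₀ ℕ, m.degree = n → HasSymbol δ' n
      (crossedMap H (nord δ (monomial m r))) (symbolMap f c (monomial m r)) from K _ m rfl
  intro n
  induction n with
  | zero =>
    intro m hm
    rw [Finsupp.degree_eq_zero_iff] at hm
    subst hm
    rw [← C_apply, nord_C, crossedMap_coef, symbolMap_C, ← nord_C]
    exact HasSymbol.nord δ' (isHomogeneous_C ι' _)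
  | succ n ih =>
    intro m hm
    obtain ⟨i, hi⟩ : ∃ i, m i ≠ 0 := by
      by_contra hc
      push Not at hc
      have : m = 0 := Finsupp.ext hc
      rw [this] at hm
      simp at hm
    obtain ⟨m', rfl⟩ : ∃ m', m = m' + Finsupp.single i 1 :=
      ⟨m - Finsupp.single i 1, (tsub_add_cancel_of_le
        (Finsupp.single_le_iff.mpr (Nat.one_le_iff_ne_zero.mpr hi))).symm⟩
    rw [map_add, Finsupp.degree_single] at hm
    have e : monomial (m' + Finsupp.single i 1) r = monomial m' r * X i := by
      rw [X, monomial_mul, mul_one]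
    rw [symbolMap_monomial_add_single, e, nord_mul_X, map_mul, crossedMap_gen, ← nord_linForm]
    exact (ih m' (by omega)).mul δ' (HasSymbol.nord δ' (linForm_isHomogeneous _))

theorem crossedMap_nord_hasSymbol (H : DerivationChange δ δ' f c) {k : ℕ} {p : MvPolynomial ι R}
    (hp : p.IsHomogeneous k) :
    HasSymbol δ' k (crossedMap H (nord δ p)) (symbolMap f c p) := by
  have e1 : crossedMap H (nord δ p)
      = ∑ m ∈ p.support, crossedMap H (nord δ (monomial m (p.coeff m))) := by
    conv_lhs => rw [p.as_sum, map_sum, map_sum]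
  have e2 : symbolMap f c p = ∑ m ∈ p.support, symbolMap f c (monomial m (p.coeff m)) := by
    conv_lhs => rw [p.as_sum, map_sum]
  rw [e1, e2]
  refine HasSymbol.sum δ' _ fun m hm => ?_
  have h := crossedMap_monomial H m (p.coeff m)
  rwa [degree_eq_of_isHomogeneous hp (mem_support_iff.mp hm)] at h

theorem crossedMap_mem_filt (H : DerivationChange δ δ' f c) {k : ℤ} {x : CrossedProduct δ}
    (hx : x ∈ filt δ k) : crossedMap H x ∈ filt δ' k := by
  obtain ⟨p, hp, rfl⟩ := hx
  rw [p.as_sum, map_sum, map_sum]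
  exact Submodule.sum_mem _ fun m hm => filt_mono δ' (hp m (mem_support_iff.mp hm))
    (crossedMap_monomial H m _).mem_filt

theorem symbolMap_isHomogeneous {k : ℕ} {p : MvPolynomial ι R} (hp : p.IsHomogeneous k) :
    (symbolMap f c p).IsHomogeneous k := by
  have e2 : symbolMap f c p = ∑ m ∈ p.support, C (f (p.coeff m)) * ∏ i, linForm (c i) ^ m i := by
    conv_lhs => rw [p.as_sum, map_sum]
    refine Finset.sum_congr rfl fun m _ => ?_
    rw [monomial_eq, map_mul, symbolMap_C, Finsupp.prod_fintype _ _ (by simp), map_prod]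
    simp [symbolMap_X]
  rw [e2]
  refine IsHomogeneous.sum _ _ _ fun m hm => ?_
  have h := (isHomogeneous_C ι' (f (p.coeff m))).mul (IsHomogeneous.prod Finset.univ
    (fun i => linForm (c i) ^ m i) m (fun i _ => by
      simpa using (linForm_isHomogeneous (c i)).pow (m i)))
  rwa [zero_add, ← Finsupp.degree_eq_sum, degree_eq_of_isHomogeneous hp (mem_support_iff.mp hm)] at h

theorem symbolMap_homogeneousComponent (k : ℕ) (p : MvPolynomial ι R) :
    homogeneousComponent k (symbolMap f c p) = symbolMap f c (homogeneousComponent k p) := by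
  conv_lhs => rw [← sum_homogeneousComponent p, map_sum, map_sum]
  have h : ∀ i, homogeneousComponent k (symbolMap f c (homogeneousComponent i p))
      = if i = k then symbolMap f c (homogeneousComponent k p) else 0 := by
    intro i
    have hi := symbolMap_isHomogeneous (f := f) (c := c) (homogeneousComponent_isHomogeneous i p)
    split_ifs with hik
    · subst hik
      exact homogeneousComponent_of_mem hi |>.trans (if_pos rfl)
    · exact homogeneousComponent_of_mem hi |>.trans (if_neg (Ne.symm hik))
  simp only [h]
  rw [Finset.sum_ite_eq']
  split_ifs with hk
  · rfl
  · rw [homogeneousComponent_eq_zero _ _ (by simpa using hk), map_zero]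

theorem pderiv_linForm (v : ι' → R') (i : ι') : pderiv i (linForm v) = C (v i) := by
  rw [linForm, map_sum, Finset.sum_eq_single i]
  · simp
  · intro j _ hj; simp [pderiv_X, hj]
  · simp

theorem coeffD_linForm (D : Derivation ℂ R' R') (v : ι' → R') :
    coeffD D (linForm v) = linForm fun j => D (v j) := by
  simp [linForm, coeffD_mul, coeffD_C, coeffD_X]

theorem C_mul_linForm (r : R') (v : ι' → R') : C r * linForm v = linForm fun j => r * v j := by
  simp [linForm, Finset.mul_sum, mul_assoc]

theorem linForm_sub (v w : ι' → R') : linForm v - linForm w = linForm fun j => v j - w j := by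
  simp [linForm, sub_mul]

theorem linForm_sum (s : Finset κ) (v : κ → ι' → R') :
    ∑ k ∈ s, linForm (v k) = linForm fun j => ∑ k ∈ s, v k j := by
  simp only [linForm, map_sum, Finset.sum_mul]
  rw [Finset.sum_comm]

theorem bracket_linForm (v w : ι' → R') : bracket δ' (linForm v) (linForm w)
    = linForm fun i => ∑ j, (v j * δ' j (w i) - w j * δ' j (v i)) := by
  rw [← linForm_sum]
  refine Finset.sum_congr rfl fun j _ => ?_
  rw [pderiv_linForm, pderiv_linForm, coeffD_linForm, coeffD_linForm, mul_comm (linForm _),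
    C_mul_linForm, C_mul_linForm, linForm_sub]

/-- Both sides are biderivations along `symbolMap`, so generators suffice: a momentum against a
function is `extend`, two momenta commute by `comm`, and two functions always do. -/
theorem symbolMap_bracket (H : DerivationChange δ δ' f c) (p q : MvPolynomial ι R) :
    symbolMap f c (bracket δ p q) = bracket δ' (symbolMap f c p) (symbolMap f c q) := by
  have hXC : ∀ m r, bracket δ' (linForm (c m)) (C (f r)) = C (f (δ m r)) := by
    intro m r
    rw [bracket_C, ← H.extend, map_sum]
    refine Finset.sum_congr rfl fun i _ => ?_
    rw [pderiv_linForm, map_mul]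
  have hXX : ∀ m l, bracket δ' (linForm (c m)) (linForm (c l)) = 0 := by
    intro m l
    rw [bracket_linForm]
    simp only [Finset.sum_sub_distrib, H.comm m l, sub_self]
    simp [linForm]
  have hCC : ∀ r s : R', bracket δ' (C r) (C s) = 0 := by
    intro r s; rw [bracket_C]; simp
  have hX : ∀ i q, symbolMap f c (bracket δ (X i) q)
      = bracket δ' (linForm (c i)) (symbolMap f c q) := by
    intro i q
    induction q using MvPolynomial.induction_on with
    | add q q' hq hq' => simp only [bracket_add_right, map_add, hq, hq']
    | C s => rw [symbolMap_C, hXC, bracket_X_left, coeffD_C, symbolMap_C]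
    | mul_X q j hq =>
      rw [bracket_mul_right, map_add, map_mul, map_mul, hq, map_mul, bracket_mul_right,
        symbolMap_X, hXX, bracket_X_left, coeffD_X, map_zero]
  induction p using MvPolynomial.induction_on with
  | add p p' hp hp' => simp only [bracket_add_left, map_add, hp, hp']
  | C r =>
    induction q using MvPolynomial.induction_on with
    | add q q' hq hq' => simp only [bracket_add_right, map_add, hq, hq']
    | C s => rw [symbolMap_C, symbolMap_C, hCC, bracket_C]; simp
    | mul_X q i hq =>
      rw [bracket_mul_right, map_add, map_mul, map_mul, hq, map_mul, bracket_mul_right,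
        symbolMap_X, symbolMap_C, bracket_antisymm δ (X i), bracket_X_left, coeffD_C,
        bracket_antisymm δ' (linForm _), hXC, map_neg, symbolMap_C]
  | mul_X p i hp =>
    rw [bracket_mul_left, map_add, map_mul, map_mul, hp, map_mul, bracket_mul_left, symbolMap_X, hX]

end CrossedTheory

end

noncomputable section

/-! ### Interpolation and residues -/

section Polynomials

open Polynomial

variable {F : Type} [Field F]

/-- The product of the differences from the `i`-th node. -/
def nodeProd {n : ℕ} (v : Fin n → F) (i : Fin n) : F := ∏ j ∈ Finset.univ.erase i, (v i - v j)

/-- The product of the `X - vⱼ`, `j ≠ i`. -/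
def eraseProd {n : ℕ} (v : Fin n → F) (i : Fin n) : F[X] :=
  ∏ j ∈ Finset.univ.erase i, (X - C (v j))

theorem nodeProd_ne_zero {n : ℕ} {v : Fin n → F} (hv : Function.Injective v) (i : Fin n) :
    nodeProd v i ≠ 0 :=
  Finset.prod_ne_zero_iff.mpr fun _ hj =>
    sub_ne_zero.mpr (hv.ne (Finset.ne_of_mem_erase hj).symm)

theorem eval_eraseProd_self {n : ℕ} (v : Fin n → F) (i : Fin n) :
    (eraseProd v i).eval (v i) = nodeProd v i := by
  simp [eraseProd, nodeProd, eval_prod]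

theorem eval_eraseProd_of_ne {n : ℕ} (v : Fin n → F) {i j : Fin n} (h : j ≠ i) :
    (eraseProd v i).eval (v j) = 0 := by
  rw [eraseProd, eval_prod]
  exact Finset.prod_eq_zero (Finset.mem_erase.mpr ⟨h, Finset.mem_univ j⟩) (by simp)

theorem natDegree_eraseProd {n : ℕ} (v : Fin n → F) (i : Fin n) :
    (eraseProd v i).natDegree = n - 1 := by
  rw [eraseProd, natDegree_finsetProd_X_sub_C_eq_card, Finset.card_erase_of_mem (Finset.mem_univ i),
    Finset.card_univ, Fintype.card_fin]

theorem degree_eraseProd_lt {n : ℕ} (v : Fin n → F) (i : Fin n) :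
    (eraseProd v i).degree < n := by
  refine lt_of_le_of_lt degree_le_natDegree ?_
  rw [natDegree_eraseProd]
  have := i.pos
  exact_mod_cast (by omega : n - 1 < n)

theorem degree_sum_eraseProd_lt {n : ℕ} (v : Fin n → F) (c : Fin n → F) :
    (∑ i, C (c i) * eraseProd v i).degree < n := by
  refine mem_degreeLT.mp (Submodule.sum_mem _ fun i _ => ?_)
  rw [C_mul']
  exact Submodule.smul_mem _ _ (mem_degreeLT.mpr (degree_eraseProd_lt v i))

theorem eval_sum_eraseProd {n : ℕ} (v : Fin n → F) (c : Fin n → F) (j : Fin n) :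
    (∑ i, C (c i) * eraseProd v i).eval (v j) = c j * nodeProd v j := by
  rw [eval_finsetSum, Finset.sum_eq_single j]
  · rw [eval_mul, eval_C, eval_eraseProd_self]
  · intro i _ hi
    rw [eval_mul, eval_eraseProd_of_ne v (Ne.symm hi), mul_zero]
  · simp

/-- A polynomial of degree less than the number of nodes is determined by its values there. -/
theorem eq_of_eval_nodes {n : ℕ} {v : Fin n → F} (hv : Function.Injective v) {p q : F[X]}
    (hp : p.degree < n) (hq : q.degree < n) (h : ∀ i, p.eval (v i) = q.eval (v i)) : p = q :=
  eq_of_degrees_lt_of_eval_index_eq (s := Finset.univ) (v := v) (hvs := hv.injOn)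
    (by simpa using hp) (by simpa using hq) (fun i _ => h i)

/-- Lagrange interpolation. -/
theorem sum_eraseProd_eq {n : ℕ} {v : Fin n → F} (hv : Function.Injective v) {p : F[X]}
    (hp : p.degree < n) : ∑ i, C (p.eval (v i) / nodeProd v i) * eraseProd v i = p :=
  eq_of_eval_nodes hv (degree_sum_eraseProd_lt _ _) hp fun j => by
    rw [eval_sum_eraseProd, div_mul_cancel₀ _ (nodeProd_ne_zero hv j)]

theorem prod_X_sub_C_eq_mul_eraseProd {n : ℕ} (v : Fin n → F) (i : Fin n) :
    ∏ j, (X - C (v j)) = (X - C (v i)) * eraseProd v i :=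
  (Finset.mul_prod_erase _ _ (Finset.mem_univ i)).symm

theorem derivative_prod_X_sub_C {n : ℕ} (v : Fin n → F) :
    derivative (∏ j, (X - C (v j))) = ∑ i, eraseProd v i := by
  rw [derivative_prod_finset]
  simp [eraseProd]

theorem eval_derivative_prod_X_sub_C {n : ℕ} (v : Fin n → F) (i : Fin n) :
    (derivative (∏ j, (X - C (v j)))).eval (v i) = nodeProd v i := by
  rw [derivative_prod_X_sub_C]
  simpa using eval_sum_eraseProd v (fun _ => 1) i

/-- `φ Q' mod Q` as a sum over the roots of `Q`. -/
theorem sum_eval_mul_eraseProd {n : ℕ} {v : Fin n → F} (hv : Function.Injective v) (φ : F[X]) :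
    ∑ i, C (φ.eval (v i)) * eraseProd v i
      = (φ * derivative (∏ j, (X - C (v j)))) %ₘ ∏ j, (X - C (v j)) := by
  have hmon : (∏ j, (X - C (v j))).Monic := monic_prod_of_monic _ _ fun j _ => monic_X_sub_C _
  refine eq_of_eval_nodes hv (degree_sum_eraseProd_lt _ _) ?_ fun i => ?_
  · refine (degree_modByMonic_lt _ hmon).trans_eq ?_
    rw [degree_prod]; simp
  · have h0 : (∏ j, (X - C (v j))).eval (v i) = 0 := by
      rw [prod_X_sub_C_eq_mul_eraseProd v i]; simp
    rw [eval_sum_eraseProd, modByMonic_eq_sub_mul_div _ _, eval_sub, eval_mul, eval_mul, h0,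
      zero_mul, sub_zero, eval_derivative_prod_X_sub_C]

/-- Evaluation of a polynomial at `t = s⁻¹` as a Laurent series in `s`. -/
def evalInfty : F[X] →+* LaurentSeries F :=
  eval₂RingHom (algebraMap F (LaurentSeries F)) (HahnSeries.single (-1 : ℤ) (1 : F))

/-- In the coordinate `s = t⁻¹` the polynomial is `s^{-N}` times its reversal in degree `N`, a power
series whose constant term is the coefficient of `t^N`. Quotients can then be computed in power
series. -/
theorem evalInfty_eq (p : F[X]) {N : ℕ} (hN : p.natDegree ≤ N) :
    evalInfty p = HahnSeries.single (-(N : ℤ)) (1 : F) * HahnSeries.ofPowerSeries ℤ F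
      (∑ k ∈ Finset.range (N + 1), PowerSeries.C (p.coeff k) * PowerSeries.X ^ (N - k)) := by
  conv_lhs => rw [p.as_sum_range' (N + 1) (by omega)]
  rw [map_sum, map_sum, Finset.mul_sum]
  refine Finset.sum_congr rfl fun k hk => ?_
  have hk' : k ≤ N := by have := Finset.mem_range.mp hk; omega
  rw [map_mul, HahnSeries.ofPowerSeries_C, HahnSeries.ofPowerSeries_X_pow, evalInfty,
    coe_eval₂RingHom, eval₂_monomial, HahnSeries.single_pow, HahnSeries.algebraMap_apply', PowerSeries.algebraMap_apply, Algebra.algebraMap_self,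
    RingHom.id_apply, HahnSeries.ofPowerSeries_C, mul_left_comm, HahnSeries.single_mul_single]
  congr 2
  · congr 1; push_cast [hk']; simp only [smul_neg, nsmul_eq_mul, mul_one]; ring
  · simp

/-- Only nonpositive powers of `s` occur, so a polynomial part contributes nothing to the residue at
infinity and numerators may be reduced modulo the denominator. -/
theorem evalInfty_coeff_one (p : F[X]) : (evalInfty p).coeff 1 = 0 := by
  rw [evalInfty_eq p le_rfl]
  have h : (1 : ℤ) = ((p.natDegree + 1 : ℕ) : ℤ) + -(p.natDegree : ℤ) := by push_cast; ring
  rw [h, HahnSeries.coeff_single_mul_add, one_mul, HahnSeries.ofPowerSeries_apply_coeff, map_sum]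
  refine Finset.sum_eq_zero fun k hk => ?_
  rw [PowerSeries.coeff_C_mul, PowerSeries.coeff_X_pow, if_neg (by omega), mul_zero]

theorem constantCoeff_reflected (p : F[X]) (N : ℕ) :
    PowerSeries.constantCoeff (∑ k ∈ Finset.range (N + 1),
      PowerSeries.C (p.coeff k) * PowerSeries.X ^ (N - k) : PowerSeries F) = p.coeff N := by
  rw [map_sum, Finset.sum_eq_single N]
  · simp
  · intro k hk hkN
    have := Finset.mem_range.mp hk
    rw [map_mul, map_pow, PowerSeries.constantCoeff_X, zero_pow (by omega), mul_zero]
  · simp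

theorem evalInfty_ne_zero {Q : F[X]} (hQ : Q.Monic) : evalInfty Q ≠ 0 := by
  rw [evalInfty_eq Q le_rfl]
  refine mul_ne_zero (by simp) ?_
  intro h
  rw [map_eq_zero_iff _ HahnSeries.ofPowerSeries_injective] at h
  have := congrArg PowerSeries.constantCoeff h
  rw [constantCoeff_reflected, hQ.coeff_natDegree] at this
  simp at this

/-- With reversals `U` of `T` in degree `deg Q - 1` and `V` of `Q`, the quotient is `s U V⁻¹`, and
`V` has constant term `1`. Reading the answer off `X * T` in degree `deg Q` also covers constant
`Q`. -/
theorem evalInfty_div_coeff_one {Q T : F[X]} (hQ : Q.Monic) (hT : T.degree < Q.degree) {t : F}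
    (ht : (X * T).coeff Q.natDegree = t) : (evalInfty T / evalInfty Q).coeff 1 = t := by
  rcases Nat.eq_zero_or_pos Q.natDegree with h0 | hpos
  · have hQ1 : Q = 1 := hQ.natDegree_eq_zero.mp h0
    rw [hQ1, degree_one] at hT
    have hT0 : T = 0 := degree_eq_bot.mp (Nat.WithBot.lt_zero_iff.mp hT)
    rw [← ht, hT0]
    simp
  · obtain ⟨d, hd⟩ : ∃ d, Q.natDegree = d + 1 := ⟨Q.natDegree - 1, by omega⟩
    rw [hd, coeff_X_mul] at ht
    have hTd : T.natDegree ≤ d := by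
      rw [degree_eq_natDegree hQ.ne_zero, hd] at hT
      rcases eq_or_ne T 0 with h0 | h0
      · simp [h0]
      · exact Nat.lt_succ_iff.mp ((natDegree_lt_iff_degree_lt h0).mpr hT)
    set U : PowerSeries F := ∑ k ∈ Finset.range (d + 1),
      PowerSeries.C (T.coeff k) * PowerSeries.X ^ (d - k) with hU
    set V : PowerSeries F := ∑ k ∈ Finset.range (d + 1 + 1),
      PowerSeries.C (Q.coeff k) * PowerSeries.X ^ (d + 1 - k) with hV
    have hV1 : PowerSeries.constantCoeff V = 1 := by
      rw [hV, constantCoeff_reflected, ← hd, hQ.coeff_natDegree]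
    have hV0 : PowerSeries.constantCoeff V ≠ 0 := by rw [hV1]; exact one_ne_zero
    have e : evalInfty T / evalInfty Q
        = HahnSeries.single (1 : ℤ) (1 : F) * HahnSeries.ofPowerSeries ℤ F (U * V⁻¹) := by
      rw [div_eq_iff (evalInfty_ne_zero hQ), evalInfty_eq T hTd, evalInfty_eq Q hd.le, ← hU, ← hV,
        mul_mul_mul_comm, ← map_mul, mul_assoc U, PowerSeries.inv_mul_cancel _ hV0, mul_one,
        HahnSeries.single_mul_single, one_mul]
      congr 2
      push_cast
      ring_nf
    have h1 := HahnSeries.coeff_single_mul_add (r := (1 : F))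
      (x := HahnSeries.ofPowerSeries ℤ F (U * V⁻¹)) (a := ((0 : ℕ) : ℤ)) (b := (1 : ℤ))
    rw [Nat.cast_zero, zero_add] at h1
    rw [e, h1, one_mul, ← Nat.cast_zero, HahnSeries.ofPowerSeries_apply_coeff,
      PowerSeries.coeff_zero_eq_constantCoeff_apply, map_mul, hU, constantCoeff_reflected,
      PowerSeries.constantCoeff_inv, hV1, ht]
    simp

theorem resInfty_div {A Q : F[X]} (hQ : Q.Monic) {t : F}
    (ht : (X * (A %ₘ Q)).coeff Q.natDegree = t) :
    resInfty (algebraMap F[X] (RatFunc F) A / algebraMap F[X] (RatFunc F) Q) = -t := by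
  have hev : RatFunc.eval (algebraMap F (LaurentSeries F)) (HahnSeries.single (-1 : ℤ) (1 : F))
      (algebraMap F[X] (RatFunc F) A / algebraMap F[X] (RatFunc F) Q)
        = evalInfty A / evalInfty Q := by
    have hQ0 := evalInfty_ne_zero hQ
    set r := algebraMap F[X] (RatFunc F) A / algebraMap F[X] (RatFunc F) Q with hr
    -- `RatFunc.eval` is computed on the reduced fraction, so it is compared with `A / Q` by cross
    -- multiplication; the reduced denominator divides `Q`, hence does not evaluate to zero.
    have hdvd : r.denom ∣ Q := RatFunc.denom_div_dvd A Q
    have hd0 : evalInfty r.denom ≠ 0 := by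
      obtain ⟨c, hc⟩ := hdvd
      intro h0
      apply hQ0
      rw [hc, map_mul, h0, zero_mul]
    have h : r.num * Q = A * r.denom := by
      apply RatFunc.algebraMap_injective F
      have h1 : algebraMap F[X] (RatFunc F) Q ≠ 0 := by simpa using hQ.ne_zero
      have h2 : algebraMap F[X] (RatFunc F) r.denom ≠ 0 := by simpa using r.denom_ne_zero
      have h3 := RatFunc.num_div_denom r
      conv_rhs at h3 => rw [hr]
      rw [div_eq_div_iff h2 h1] at h3
      rw [map_mul, map_mul, h3]
    change evalInfty r.num / evalInfty r.denom = _
    rw [div_eq_div_iff hd0 hQ0, ← map_mul, h, map_mul]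
  rw [resInfty, hev]
  have hA := modByMonic_add_div A Q
  have : evalInfty A / evalInfty Q = evalInfty (A %ₘ Q) / evalInfty Q + evalInfty (A /ₘ Q) := by
    conv_lhs => rw [← hA]
    rw [map_add, map_mul, add_div, mul_div_cancel_left₀ _ (evalInfty_ne_zero hQ)]
  rw [this, HahnSeries.coeff_add, evalInfty_coeff_one, add_zero,
    evalInfty_div_coeff_one hQ (degree_modByMonic_lt A hQ) ht]

/-- The residue at infinity of `((Q'/Q)(t) - (Q'/Q)(b)) / (t - b) φ(t) dt`. -/
theorem resInfty_logDeriv {Q : F[X]} (hQ : Q.Monic) (φ : F[X]) {b l : F} (hb : Q.eval b ≠ 0)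
    (hl : l ≠ 0) :
    resInfty ((algebraMap F[X] (RatFunc F) (derivative (C l * Q)) /
          algebraMap F[X] (RatFunc F) (C l * Q)
        - RatFunc.C ((derivative (C l * Q)).eval b / (C l * Q).eval b)) /
      (RatFunc.X - RatFunc.C b) * algebraMap F[X] (RatFunc F) φ)
    = ((φ * derivative Q) %ₘ Q).eval b / Q.eval b := by
  -- The numerator of the difference of logarithmic derivatives vanishes at `b`, so the pole at `b`
  -- disappears and the integrand is `Q(b)⁻¹ S φ / Q`; the scalar `l` cancels.
  obtain ⟨S, hS⟩ : (X - C b) ∣ C (Q.eval b) * derivative Q - C ((derivative Q).eval b) * Q := by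
    rw [dvd_iff_isRoot]
    simp [mul_comm]
  have e : (algebraMap F[X] (RatFunc F) (derivative (C l * Q)) /
          algebraMap F[X] (RatFunc F) (C l * Q)
        - RatFunc.C ((derivative (C l * Q)).eval b / (C l * Q).eval b)) /
      (RatFunc.X - RatFunc.C b) * algebraMap F[X] (RatFunc F) φ
      = algebraMap F[X] (RatFunc F) (C (Q.eval b)⁻¹ * (S * φ)) / algebraMap F[X] (RatFunc F) Q := by
    have h1 : algebraMap F[X] (RatFunc F) Q ≠ 0 := by simpa using hQ.ne_zero
    have h2 : RatFunc.X - RatFunc.C b ≠ 0 := by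
      have h := (map_ne_zero_iff _ (RatFunc.algebraMap_injective F)).mpr (X_sub_C_ne_zero b)
      simpa using h
    have h3 : RatFunc.C l ≠ 0 := by simpa using hl
    have h4 : RatFunc.C (Q.eval b) ≠ 0 := by simpa using hb
    have hS' := congrArg (algebraMap F[X] (RatFunc F)) hS
    simp only [map_sub, map_mul, RatFunc.algebraMap_C, RatFunc.algebraMap_X] at hS'
    simp only [derivative_C_mul, eval_mul, eval_C, map_mul, map_div₀, RatFunc.algebraMap_C, map_inv₀]
    field_simp
    linear_combination algebraMap F[X] (RatFunc F) φ * hS'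
  set t := ((φ * derivative Q) %ₘ Q).eval b / Q.eval b with ht
  rw [e, resInfty_div hQ (t := -t), neg_neg]
  set T := (C (Q.eval b)⁻¹ * (S * φ)) %ₘ Q with hT
  set R := (φ * derivative Q) %ₘ Q with hR
  set τ := (X * T).coeff Q.natDegree with hτ
  have hTdeg : T.degree < Q.degree := degree_modByMonic_lt _ hQ
  have hRdeg : R.degree < Q.degree := degree_modByMonic_lt _ hQ
  -- Modulo `Q`, multiplying `Q(b)⁻¹ S φ` by `X - b` gives `φ Q'`. Here `τ` is the coefficient of
  -- `(X - b) T` in degree `deg Q`, so subtracting `τ Q` brings the degree below `deg Q` and the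
  -- multiple of `Q` is zero. Its value at `b` is the claim.
  have hdvd : Q ∣ (X - C b) * T - C τ * Q - R := by
    obtain ⟨B, hB⟩ : ∃ B, T = C (Q.eval b)⁻¹ * (S * φ) - Q * B :=
      ⟨_, modByMonic_eq_sub_mul_div _ _⟩
    obtain ⟨B', hB'⟩ : ∃ B', R = φ * derivative Q - Q * B' := ⟨_, modByMonic_eq_sub_mul_div _ _⟩
    have h1 : C (Q.eval b)⁻¹ * C (Q.eval b) = 1 := by
      rw [← C_mul, inv_mul_cancel₀ hb, C_1]
    refine ⟨-(C (Q.eval b)⁻¹ * C ((derivative Q).eval b) * φ) - (X - C b) * B - C τ + B', ?_⟩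
    rw [hB, hB']
    linear_combination (-C (Q.eval b)⁻¹ * φ) * hS + φ * derivative Q * h1
  have hz : (X - C b) * T - C τ * Q - R = 0 := by
    refine eq_zero_of_dvd_of_degree_lt hdvd ?_
    rw [degree_eq_natDegree hQ.ne_zero, degree_lt_iff_coeff_zero] at hTdeg hRdeg ⊢
    intro m hm
    rcases eq_or_lt_of_le hm with rfl | hm'
    · rw [coeff_sub, coeff_sub, sub_mul, coeff_sub, ← hτ, coeff_C_mul, coeff_C_mul, hTdeg _ le_rfl,
        hRdeg _ le_rfl, hQ.coeff_natDegree]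
      ring
    · obtain ⟨d, rfl⟩ : ∃ d, m = d + 1 := ⟨m - 1, by omega⟩
      rw [coeff_sub, coeff_sub, sub_mul, coeff_sub, coeff_X_mul, coeff_C_mul, coeff_C_mul,
        hTdeg _ (by omega), hTdeg _ (by omega), hRdeg _ (by omega),
        coeff_eq_zero_of_natDegree_lt hm']
      ring
  have hev := congrArg (eval b) hz
  simp only [eval_sub, eval_mul, eval_X, eval_C, sub_self, zero_mul, eval_zero] at hev
  rw [ht]
  field_simp
  linear_combination -hev

end Polynomials

/-! ### Polynomials constant in a direction -/

section Directional

open MvPolynomial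

variable {F ι : Type} [Field F] [CharZero F] [Fintype ι] [DecidableEq ι]

/-- If the derivative of `p` in the direction `c` vanishes, then `p` is invariant under
translations along `c`. -/
theorem aeval_sub_eq_aeval {p η : MvPolynomial ι F} {c : ι → F} (x : ι → MvPolynomial ι F)
    (hp : ∑ i, C (c i) * pderiv i p = 0) :
    aeval (fun i => x i - C (c i) * η) p = aeval x p := by
  -- Translation along `c` by a formal parameter `T`. By the chain rule `ψ p` has zero derivative in
  -- `T`, so in characteristic zero it is constant; its values at `T = η` and `T = 0` are the two
  -- sides.
  let ψ : MvPolynomial ι F →ₐ[F] Polynomial (MvPolynomial ι F) :=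
    aeval fun i => Polynomial.C (x i) - Polynomial.C (C (c i)) * Polynomial.X
  have hψC : ∀ r, ψ (C r) = Polynomial.C (C r) := fun r => by
    simp only [ψ, algHom_C]; rfl
  have hψ : ∀ q, Polynomial.derivative (ψ q) = -ψ (∑ i, C (c i) * pderiv i q) := by
    intro q
    induction q using MvPolynomial.induction_on with
    | C r => simp [hψC]
    | add q q' h h' =>
      rw [map_add, map_add, h, h']
      simp only [map_add, mul_add, Finset.sum_add_distrib]
      ring
    | mul_X q i h =>
      have e : ∑ j, C (c j) * pderiv j (q * X i) = (∑ j, C (c j) * pderiv j q) * X i + q * C (c i) := by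
        simp only [Derivation.leibniz, pderiv_X, smul_eq_mul, mul_add, Finset.sum_add_distrib]
        rw [add_comm, Finset.sum_mul]
        congr 1
        · exact Finset.sum_congr rfl fun j _ => by ring
        · rw [Finset.sum_eq_single i]
          · simp [mul_comm]
          · intro j _ hj; simp [Ne.symm hj]
          · simp
      have hX : ψ (X i) = Polynomial.C (x i) - Polynomial.C (C (c i)) * Polynomial.X := by
        simp [ψ]
      rw [e, map_mul, Polynomial.derivative_mul, h, map_add, map_mul, map_mul, hψC, hX]
      simp
      ring
  have h0 : Polynomial.derivative (ψ p) = 0 := by rw [hψ, hp, map_zero, neg_zero]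
  rw [Polynomial.derivative_eq_zero] at h0
  have hev : ∀ z : MvPolynomial ι F, ∀ q, (ψ q).eval z = aeval (fun i => x i - C (c i) * z) q := by
    intro z q
    induction q using MvPolynomial.induction_on with
    | C r => simp [hψC]
    | add q q' h h' => rw [map_add, Polynomial.eval_add, h, h', map_add]
    | mul_X q i h => rw [map_mul, Polynomial.eval_mul, h, map_mul]; simp [ψ]
  rw [← hev, Polynomial.eq_C_of_natDegree_eq_zero h0, Polynomial.eval_C,
    Polynomial.coeff_zero_eq_eval_zero, hev]
  simp

end Directional

end

noncomputable section

open MvPolynomial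

/-! ### Actions and vector fields under maps of crossed products -/

section CrossedMaps

variable {R ι : Type} [CommRing R] [Algebra ℂ R] [Fintype ι] [DecidableEq ι]
  {R' ι' : Type} [CommRing R'] [Algebra ℂ R'] [Fintype ι'] [DecidableEq ι']
  {δ : ι → Derivation ℂ R R} {δ' : ι' → Derivation ℂ R' R'} {f : R →ₐ[ℂ] R'} {c : ι → ι' → R'}

theorem crossedProduct_induction {P : CrossedProduct δ → Prop} (hc : ∀ r, P (coef δ r))
    (hg : ∀ i, P (gen δ i)) (hm : ∀ x y, P x → P y → P (x * y))
    (ha : ∀ x y, P x → P y → P (x + y)) (x : CrossedProduct δ) : P x := by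
  obtain ⟨p, rfl⟩ := nord_surjective δ x
  induction p using MvPolynomial.induction_on with
  | C r => rw [nord_C]; exact hc r
  | add p q hp hq => rw [map_add]; exact ha _ _ hp hq
  | mul_X p i hp => rw [nord_mul_X]; exact hm _ _ hp (hg i)

/-- The image operator, restricted along `f`, is the original operator. A faithful action of the
source therefore makes `crossedMap` injective whenever `f` is. -/
theorem opHom_crossedMap (H : DerivationChange δ δ' f c)
    (hδ : ∀ i j r, δ i (δ j r) = δ j (δ i r)) (hδ' : ∀ i j r, δ' i (δ' j r) = δ' j (δ' i r))
    (x : CrossedProduct δ) (r : R) :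
    opHom δ' hδ' (crossedMap H x) (f r) = f (opHom δ hδ x r) := by
  induction x using crossedProduct_induction generalizing r with
  | hc s => rw [crossedMap_coef, opHom_coef, opHom_coef, map_mul]
  | hg i => rw [crossedMap_gen, opHom_vectorField, opHom_gen, H.extend]
  | hm x y hx hy => rw [map_mul, map_mul, map_mul, Module.End.mul_apply, hy, hx]; rfl
  | ha x y hx hy => rw [map_add, map_add, map_add, LinearMap.add_apply, hx, hy, ← map_add]; rfl

theorem crossedMap_vectorField (H : DerivationChange δ δ' f c) (v : ι → R) :
    crossedMap H (vectorField δ v) = vectorField δ' fun i => ∑ m, f (v m) * c m i := by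
  rw [vectorField, map_sum]
  simp only [map_mul, crossedMap_coef, crossedMap_gen]
  simp only [vectorField, Finset.mul_sum, map_sum, Finset.sum_mul]
  rw [Finset.sum_comm]
  exact Finset.sum_congr rfl fun i _ => Finset.sum_congr rfl fun j _ => by
    rw [map_mul, mul_assoc]

theorem symbolMap_linForm (v : ι → R) :
    symbolMap f c (linForm v) = linForm fun i => ∑ m, f (v m) * c m i := by
  have h : ∀ m, symbolMap f c (C (v m) * X m) = linForm fun i => f (v m) * c m i := by
    intro m
    rw [map_mul, symbolMap_C, symbolMap_X, C_mul_linForm]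
  conv_lhs => rw [linForm, map_sum]
  simp only [h]
  rw [linForm_sum]

theorem isHomogeneous_of_symbolMap (hinj : Function.Injective (symbolMap f c)) {k : ℕ}
    {p : MvPolynomial ι R} (hp : (symbolMap f c p).IsHomogeneous k) : p.IsHomogeneous k := by
  have : homogeneousComponent k p = p := by
    apply hinj
    rw [← symbolMap_homogeneousComponent]
    exact (homogeneousComponent_of_mem hp).trans (if_pos rfl)
  rw [← this]
  exact homogeneousComponent_isHomogeneous k p

end CrossedMaps

/-! ### Derivations of localized polynomial rings -/

section LocalizedPolynomials

variable {n : ℕ} {S L : Type} [CommRing S] [Algebra ℂ S] [Algebra (MvPolynomial (Fin n) ℂ) S]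
  [IsScalarTower ℂ (MvPolynomial (Fin n) ℂ) S] [CommRing L] [Algebra ℂ L]

/-- A derivation along `f` that vanishes on the variables is zero. -/
theorem twistedDerivation_eq_zero (M : Submonoid (MvPolynomial (Fin n) ℂ))
    [IsLocalization M S] (f : S →ₐ[ℂ] L) (D : S →ₗ[ℂ] L)
    (hD : ∀ x y, D (x * y) = f x * D y + f y * D x)
    (h : ∀ i, D (algebraMap (MvPolynomial (Fin n) ℂ) S (X i)) = 0) (z : S) : D z = 0 := by
  have h1 : D 1 = 0 := by simpa using hD 1 1
  have hp : ∀ p, D (algebraMap (MvPolynomial (Fin n) ℂ) S p) = 0 := by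
    intro p
    induction p using MvPolynomial.induction_on with
    | C c =>
      have : algebraMap (MvPolynomial (Fin n) ℂ) S (C c) = c • 1 := by
        rw [← algebraMap_eq, ← IsScalarTower.algebraMap_apply, Algebra.algebraMap_eq_smul_one]
      rw [this, map_smul, h1, smul_zero]
    | add p q hp hq => rw [map_add, map_add, hp, hq, add_zero]
    | mul_X p i hp => rw [map_mul, hD, hp, h, mul_zero, mul_zero, add_zero]
  -- From `z q = p` with `D p = D q = 0` the Leibniz rule leaves `f(q) D z = 0`, and `f(q)` is a
  -- unit.
  obtain ⟨⟨p, q⟩, hz⟩ := IsLocalization.surj M z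
  have e := hD z (algebraMap _ S (q : MvPolynomial (Fin n) ℂ))
  rw [hz, hp, hp, mul_zero, zero_add] at e
  exact ((IsLocalization.map_units S q).map f).mul_right_eq_zero.mp e.symm

theorem derivation_comm (M : Submonoid (MvPolynomial (Fin n) ℂ)) [IsLocalization M S]
    (D E : Derivation ℂ S S)
    (h : ∀ i, D (E (algebraMap (MvPolynomial (Fin n) ℂ) S (X i)))
      = E (D (algebraMap (MvPolynomial (Fin n) ℂ) S (X i)))) (z : S) : D (E z) = E (D z) := by
  have := twistedDerivation_eq_zero M (AlgHom.id ℂ S) (⁅D, E⁆ : Derivation ℂ S S).toLinearMap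
    (fun x y => (⁅D, E⁆ : Derivation ℂ S S).leibniz x y) (fun i => by
      change ⁅D, E⁆ _ = 0
      rw [Derivation.commutator_apply, h, sub_self]) z
  change ⁅D, E⁆ z = 0 at this
  rw [Derivation.commutator_apply] at this
  exact sub_eq_zero.mp this

end LocalizedPolynomials

/-! ### Monic polynomials with prescribed coefficients -/

section MonicOf

variable {K : Type} [CommRing K] {g : ℕ}

/-- The polynomial `X ^ g + ∑ⱼ cⱼ X ^ j`. -/
def monicOf (c : Fin g → K) : Polynomial K :=
  Polynomial.X ^ g + ∑ j : Fin g, Polynomial.C (c j) * Polynomial.X ^ (j : ℕ)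

theorem degree_monicOf_tail (c : Fin g → K) :
    (∑ j : Fin g, Polynomial.C (c j) * Polynomial.X ^ (j : ℕ)).degree < (g : WithBot ℕ) :=
  Polynomial.degree_sum_fin_lt c

theorem monicOf_monic (c : Fin g → K) : (monicOf c).Monic :=
  Polynomial.monic_X_pow_add (degree_monicOf_tail c)

theorem natDegree_monicOf [Nontrivial K] (c : Fin g → K) : (monicOf c).natDegree = g := by
  rw [monicOf, Polynomial.natDegree_add_eq_left_of_degree_lt, Polynomial.natDegree_X_pow]
  rw [Polynomial.degree_X_pow]
  exact degree_monicOf_tail c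

theorem coeff_sum_fin (c : Fin g → K) (k : Fin g) :
    (∑ j : Fin g, Polynomial.C (c j) * Polynomial.X ^ (j : ℕ)).coeff k = c k := by
  rw [Polynomial.finsetSum_coeff, Finset.sum_eq_single k]
  · simp
  · intro j _ hj
    rw [Polynomial.coeff_C_mul, Polynomial.coeff_X_pow, if_neg (fun h => hj (Fin.ext h.symm)),
      mul_zero]
  · simp

theorem coeff_monicOf (c : Fin g → K) (k : Fin g) : (monicOf c).coeff k = c k := by
  rw [monicOf, Polynomial.coeff_add, coeff_sum_fin, Polynomial.coeff_X_pow,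
    if_neg (by have := k.2; omega), zero_add]

theorem map_monicOf {L : Type} [CommRing L] (f : K →+* L) (c : Fin g → K) :
    (monicOf c).map f = monicOf fun j => f (c j) := by
  simp [monicOf, Polynomial.map_sum]

theorem eval_monicOf (c : Fin g → K) (x : K) :
    (monicOf c).eval x = x ^ g + ∑ j, c j * x ^ (j : ℕ) := by
  simp [monicOf, Polynomial.eval_finsetSum]

theorem sum_fin_of_degree_lt {p : Polynomial K} (hp : p.degree < g) :
    ∑ j : Fin g, Polynomial.C (p.coeff j) * Polynomial.X ^ (j : ℕ) = p := by
  rw [Fin.sum_univ_eq_sum_range (fun j => Polynomial.C (p.coeff j) * Polynomial.X ^ j)]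
  rcases eq_or_ne p 0 with rfl | h0
  · simp
  · have hlt := (Polynomial.natDegree_lt_iff_degree_lt h0).mpr hp
    exact (p.as_sum_range_C_mul_X_pow' hlt).symm

theorem sum_coeff_mul_pow {p : Polynomial K} (hp : p.degree < g) (x : K) :
    ∑ j : Fin g, p.coeff j * x ^ (j : ℕ) = p.eval x := by
  conv_rhs => rw [← sum_fin_of_degree_lt hp]
  simp [Polynomial.eval_finsetSum]

theorem eq_monicOf [Nontrivial K] {p : Polynomial K} (hp : p.Monic) (hd : p.natDegree = g) :
    p = monicOf fun j : Fin g => p.coeff j := by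
  have h := hp.as_sum
  rw [hd] at h
  rw [monicOf, Fin.sum_univ_eq_sum_range (fun j => Polynomial.C (p.coeff j) * Polynomial.X ^ j)]
  exact h

/-- The chain rule when coefficients and point both vary. At a root `x` the left side is zero, and
the derivative of the root is expressed by those of the coefficients. -/
theorem derivation_eval_monicOf [Algebra ℂ K] (D : Derivation ℂ K K) (c : Fin g → K) (x : K) :
    D ((monicOf c).eval x)
      = ∑ j, D (c j) * x ^ (j : ℕ) + (Polynomial.derivative (monicOf c)).eval x * D x := by
  rw [eval_monicOf, map_add, map_sum]
  simp only [monicOf, Derivation.leibniz, Derivation.leibniz_pow, Polynomial.derivative_add,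
    Polynomial.derivative_sum, Polynomial.derivative_mul, Polynomial.derivative_C,
    Polynomial.derivative_X_pow, Polynomial.eval_add, Polynomial.eval_finsetSum,
    Polynomial.eval_mul, Polynomial.eval_C, Polynomial.eval_X, Polynomial.eval_pow, zero_mul,
    zero_add, smul_eq_mul, nsmul_eq_mul, Finset.sum_add_distrib, add_mul, Finset.sum_mul]
  have h1 : ∑ j : Fin g, c j * ((j : ℕ) * (x ^ ((j : ℕ) - 1) * D x))
      = ∑ j : Fin g, c j * ((j : ℕ) * x ^ ((j : ℕ) - 1)) * D x :=
    Finset.sum_congr rfl fun j _ => by ring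
  have h2 : ∑ j : Fin g, x ^ (j : ℕ) * D (c j) = ∑ j : Fin g, D (c j) * x ^ (j : ℕ) :=
    Finset.sum_congr rfl fun j _ => by ring
  rw [h1, h2]
  ring

end MonicOf

/-! ### The field of coefficients of a generic monic polynomial -/

section Generic

variable (g : ℕ)

/-- The partial derivatives of `ℂ(q₀, …, q_{g-1})`. -/
def derE (j : Fin g) : Derivation ℂ (RatX g) (RatX g) :=
  locDer (nonZeroDivisors (MvPolynomial (Fin g) ℂ)) (pderiv j)

/-- The generic monic polynomial `X ^ g + ∑ⱼ qⱼ X ^ j`. -/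
def genericMonic : Polynomial (RatX g) := monicOf (xvar : Fin g → RatX g)

variable {g}

theorem derE_xvar (i j : Fin g) : derE g i (xvar j) = if i = j then 1 else 0 := by
  rw [derE, xvar, locDer_algebraMap, pderiv_X, Pi.single_apply]
  split_ifs with h h' h'
  · simp
  · exact absurd h.symm h'
  · exact absurd h'.symm h
  · simp

theorem derE_comm (i j : Fin g) (r : RatX g) : derE g i (derE g j r) = derE g j (derE g i r) := by
  refine derivation_comm (nonZeroDivisors (MvPolynomial (Fin g) ℂ)) _ _ (fun k => ?_) r
  change derE g i (derE g j (xvar k)) = derE g j (derE g i (xvar k))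
  rw [derE_xvar, derE_xvar]
  split_ifs <;> simp

theorem opHom_derE_injective : Function.Injective (opHom (derE g) derE_comm) :=
  opHom_injective _ _ xvar derE_xvar

instance : CharZero (RatX g) := charZero_of_injective_algebraMap (algebraMap ℂ (RatX g)).injective

theorem xvar_injective : Function.Injective (xvar : Fin g → RatX g) := fun _ _ h =>
  X_injective (IsFractionRing.injective (MvPolynomial (Fin g) ℂ) (RatX g) h)

end Generic

end

noncomputable section

open MvPolynomial

/-! ### The field of symmetric rational functions -/

section SymmetricFunctions

variable {g : ℕ}

/-- The coefficient of `T ^ j` in `∏_α (T - X_α)`. -/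
def rootCoeff (j : Fin g) : MvPolynomial (Fin g) ℂ :=
  (∏ α : Fin g, (Polynomial.X - Polynomial.C (X α : MvPolynomial (Fin g) ℂ))).coeff j

theorem prod_X_sub_C_coeff_eq (k : ℕ) (hk : k ≤ g) :
    (∏ α : Fin g, (Polynomial.X - Polynomial.C (X α : MvPolynomial (Fin g) ℂ))).coeff k
      = (-1) ^ (g - k) * esymm (Fin g) ℂ (g - k) := by
  have h := Multiset.prod_X_sub_C_coeff
    ((Finset.univ : Finset (Fin g)).val.map (X : Fin g → MvPolynomial (Fin g) ℂ)) (k := k)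
    (by simpa using hk)
  have e := aeval_esymm_eq_multiset_esymm (Fin g) ℂ (g - k) (X : Fin g → MvPolynomial (Fin g) ℂ)
  rw [aeval_X_left_apply] at e
  simp only [Multiset.map_map, Function.comp_def, Multiset.card_map, Finset.card_val,
    Finset.card_univ, Fintype.card_fin] at h
  rw [e, ← h]
  rfl

theorem rootCoeff_eq (j : Fin g) :
    rootCoeff j = (-1) ^ (g - j : ℕ) * esymm (Fin g) ℂ (g - j) :=
  prod_X_sub_C_coeff_eq _ j.2.le

theorem esymm_eq_rootCoeff {k : ℕ} (h1 : 1 ≤ k) (hk : k ≤ g) :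
    esymm (Fin g) ℂ k = (-1) ^ k * rootCoeff ⟨g - k, by omega⟩ := by
  rw [rootCoeff_eq]
  simp only [Nat.sub_sub_self hk]
  rw [← mul_assoc, ← mul_pow]
  simp

/-- The substitution of the coefficients of `∏_α (T - X_α)`. -/
def rootHom (g : ℕ) : MvPolynomial (Fin g) ℂ →ₐ[ℂ] MvPolynomial (Fin g) ℂ := aeval rootCoeff

/-- The passage from coefficients to elementary symmetric functions. -/
def signRev (g : ℕ) : MvPolynomial (Fin g) ℂ →ₐ[ℂ] MvPolynomial (Fin g) ℂ :=
  aeval fun j => (-1) ^ (g - j : ℕ) * X j.rev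

/-- The inverse of `signRev`. -/
def signRevInv (g : ℕ) : MvPolynomial (Fin g) ℂ →ₐ[ℂ] MvPolynomial (Fin g) ℂ :=
  aeval fun j => (-1) ^ (j + 1 : ℕ) * X j.rev

theorem signRevInv_signRev (p : MvPolynomial (Fin g) ℂ) : signRevInv g (signRev g p) = p := by
  have : (signRevInv g).comp (signRev g) = AlgHom.id ℂ _ := by
    apply algHom_ext
    intro j
    have hj : (j.rev : ℕ) + 1 = g - j := by have := j.2; rw [Fin.val_rev]; omega
    simp only [signRev, signRevInv, AlgHom.comp_apply, aeval_X, map_mul, map_pow, map_neg, map_one,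
      hj, Fin.rev_rev, ← mul_assoc, ← mul_pow]
    simp
  exact congrArg (fun f => f p) this

theorem signRev_signRevInv (p : MvPolynomial (Fin g) ℂ) : signRev g (signRevInv g p) = p := by
  have : (signRev g).comp (signRevInv g) = AlgHom.id ℂ _ := by
    apply algHom_ext
    intro j
    have hj : g - (j.rev : ℕ) = j + 1 := by have := j.2; rw [Fin.val_rev]; omega
    simp only [signRev, signRevInv, AlgHom.comp_apply, aeval_X, map_mul, map_pow, map_neg, map_one,
      hj, Fin.rev_rev, ← mul_assoc, ← mul_pow]
    simp
  exact congrArg (fun f => f p) this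

/-- Coefficients and elementary symmetric functions differ by signs and a reversal of indices, so
the fundamental theorem on symmetric polynomials yields injectivity of `rootHom` and its image. -/
theorem rootHom_eq (p : MvPolynomial (Fin g) ℂ) :
    rootHom g p = (esymmAlgHom (Fin g) ℂ g (signRev g p) : MvPolynomial (Fin g) ℂ) := by
  have : rootHom g = ((symmetricSubalgebra (Fin g) ℂ).val.comp (esymmAlgHom (Fin g) ℂ g)).comp
      (signRev g) := by
    apply algHom_ext
    intro j
    have hj : (j.rev : ℕ) + 1 = g - j := by have := j.2; rw [Fin.val_rev]; omega
    simp only [rootHom, signRev, AlgHom.comp_apply, aeval_X, map_mul, map_pow, map_neg, map_one,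
      rootCoeff_eq, esymmAlgHom, Subalgebra.coe_val, hj]
  rw [this]
  rfl

theorem rootHom_injective : Function.Injective (rootHom g) := by
  intro p q h
  rw [rootHom_eq, rootHom_eq] at h
  have h2 := esymmAlgHom_fin_injective ℂ le_rfl (Subtype.ext h)
  rw [← signRevInv_signRev p, h2, signRevInv_signRev]

theorem exists_rootHom_eq {p : MvPolynomial (Fin g) ℂ} (hp : p.IsSymmetric) :
    ∃ q, rootHom g q = p := by
  obtain ⟨q, hq⟩ := esymmAlgHom_fin_surjective ℂ (le_refl g) ⟨p, hp⟩
  exact ⟨signRevInv g q, by rw [rootHom_eq, signRev_signRevInv, hq]⟩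

/-- The embedding of `ℂ(q₀, …, q_{g-1})` into `ℂ(x₁, …, x_g)` that takes `qⱼ` to the coefficient
of `T ^ j` in `∏_α (T - x_α)`. -/
def rootEmb (g : ℕ) : RatX g →ₐ[ℂ] RatX g :=
  IsLocalization.liftAlgHom (M := nonZeroDivisors (MvPolynomial (Fin g) ℂ))
    (f := (IsScalarTower.toAlgHom ℂ (MvPolynomial (Fin g) ℂ) (RatX g)).comp (rootHom g))
    (fun y => by
      refine isUnit_iff_ne_zero.mpr ?_
      have h : rootHom g (y : MvPolynomial (Fin g) ℂ) ≠ 0 := by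
        rw [Ne, map_eq_zero_iff _ rootHom_injective]
        exact nonZeroDivisors.ne_zero y.2
      simpa using h)

theorem rootEmb_algebraMap (p : MvPolynomial (Fin g) ℂ) :
    rootEmb g (algebraMap _ (RatX g) p) = algebraMap _ (RatX g) (rootHom g p) := by
  simp [rootEmb]

theorem rootEmb_xvar (j : Fin g) :
    rootEmb g (xvar j) = algebraMap _ (RatX g) (rootCoeff j) := by
  rw [xvar, rootEmb_algebraMap, rootHom, aeval_X]

theorem map_genericMonic :
    (genericMonic g).map (rootEmb g : RatX g →+* RatX g)
      = ∏ α : Fin g, (Polynomial.X - Polynomial.C (xvar α)) := by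
  have h : (∏ α : Fin g, (Polynomial.X - Polynomial.C (xvar α)) : Polynomial (RatX g))
      = (∏ α : Fin g, (Polynomial.X - Polynomial.C (X α : MvPolynomial (Fin g) ℂ))).map
        (algebraMap _ (RatX g)) := by
    simp [Polynomial.map_prod, xvar]
  have hm : (∏ α : Fin g, (Polynomial.X - Polynomial.C (xvar α)) : Polynomial (RatX g)).Monic :=
    Polynomial.monic_prod_of_monic _ _ fun j _ => Polynomial.monic_X_sub_C _
  have hd : (∏ α : Fin g, (Polynomial.X - Polynomial.C (xvar α)) :
      Polynomial (RatX g)).natDegree = g := by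
    rw [Polynomial.natDegree_finsetProd_X_sub_C_eq_card]; simp
  rw [eq_monicOf hm hd, genericMonic, map_monicOf]
  congr 1
  funext j
  rw [h, Polynomial.coeff_map, RingHom.coe_coe, rootEmb_xvar, rootCoeff]

theorem permX_xvar (σ : Equiv.Perm (Fin g)) (α : Fin g) : permX σ (xvar α) = xvar (σ α) := by
  rw [xvar, permX_algebraMap, rename_X]; rfl

theorem permX_rootEmb (σ : Equiv.Perm (Fin g)) (r : RatX g) :
    permX σ (rootEmb g r) = rootEmb g r := by
  have h : ∀ p : MvPolynomial (Fin g) ℂ, permX σ (rootEmb g (algebraMap _ (RatX g) p))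
      = rootEmb g (algebraMap _ (RatX g) p) := by
    intro p
    rw [rootEmb_algebraMap, permX_algebraMap, rootHom_eq,
      ((esymmAlgHom (Fin g) ℂ g (signRev g p)).2 : IsSymmetric _) σ]
  obtain ⟨p, q, hq, rfl⟩ := IsFractionRing.div_surjective (A := MvPolynomial (Fin g) ℂ) r
  rw [map_div₀, map_div₀, h, h]

/-- The invariants of the symmetric group in `ℂ(x₁, …, x_g)`. -/
theorem exists_rootEmb_eq {r : RatX g} (hr : ∀ σ, permX σ r = r) : ∃ e, rootEmb g e = r := by
  obtain ⟨p, q, hq, rfl⟩ := IsFractionRing.div_surjective (A := MvPolynomial (Fin g) ℂ) r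
  have hq0 : q ≠ 0 := nonZeroDivisors.ne_zero hq
  -- Extending the fraction by the conjugates of `q` makes the denominator symmetric; invariance of
  -- the fraction then forces the numerator to be symmetric.
  set N : MvPolynomial (Fin g) ℂ := ∏ σ : Equiv.Perm (Fin g), rename σ q with hN
  have hNsym : N.IsSymmetric := by
    intro τ
    rw [hN, map_prod]
    refine Fintype.prod_equiv (Equiv.mulLeft τ) _ _ fun σ => ?_
    rw [rename_rename]
    rfl
  have hN0 : N ≠ 0 := Finset.prod_ne_zero_iff.mpr fun σ _ => by
    rw [Ne, map_eq_zero_iff _ (rename_injective σ σ.injective)]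
    exact hq0
  obtain ⟨d, hd⟩ : q ∣ N := by
    have := Finset.dvd_prod_of_mem (fun σ : Equiv.Perm (Fin g) => rename σ q)
      (Finset.mem_univ (1 : Equiv.Perm (Fin g)))
    simpa using this
  have hqK : algebraMap _ (RatX g) q ≠ 0 := by simpa using hq0
  have hNK : algebraMap _ (RatX g) N ≠ 0 := by simpa using hN0
  have hr' : algebraMap _ (RatX g) p / algebraMap _ (RatX g) q
      = algebraMap _ (RatX g) (p * d) / algebraMap _ (RatX g) N := by
    rw [div_eq_div_iff hqK hNK, hd, map_mul, map_mul]; ring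
  have hsym : (p * d).IsSymmetric := by
    intro σ
    apply IsFractionRing.injective (MvPolynomial (Fin g) ℂ) (RatX g)
    have h := hr σ
    rw [hr', map_div₀, permX_algebraMap, permX_algebraMap, hNsym σ,
      div_left_inj' hNK] at h
    exact h
  obtain ⟨u, hu⟩ := exists_rootHom_eq hsym
  obtain ⟨v, hv⟩ := exists_rootHom_eq hNsym
  refine ⟨algebraMap _ (RatX g) u / algebraMap _ (RatX g) v, ?_⟩
  rw [map_div₀, rootEmb_algebraMap, rootEmb_algebraMap, hu, hv, hr']

end SymmetricFunctions

/-! ### Changing from the derivations `ŷ_α` to coefficient derivations -/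

section XMaps

variable {g : ℕ} (a : Fin (g + 3) ↪ ℂ)

theorem aeval_bigPi_ne_zero (α : Fin g) : Polynomial.aeval (xvar α) (bigPi a) ≠ 0 := by
  rw [bigPi, map_prod]
  refine Finset.prod_ne_zero_iff.mpr fun i _ => ?_
  have h : Polynomial.aeval (xvar α) (Polynomial.X - Polynomial.C (a i))
      = algebraMap _ (RatX g) (X α - C (a i) : MvPolynomial (Fin g) ℂ) := by
    rw [map_sub, map_sub, Polynomial.aeval_X, Polynomial.aeval_C, ← algebraMap_eq,
      ← IsScalarTower.algebraMap_apply]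
    rfl
  rw [h, Ne, map_eq_zero_iff _ (IsFractionRing.injective (MvPolynomial (Fin g) ℂ) (RatX g))]
  intro h0
  have := congrArg (eval fun _ => a i + 1) h0
  simp at this

theorem derX_xvar (α β : Fin g) :
    derX a α (xvar β) = if α = β then 2 * Polynomial.aeval (xvar α) (bigPi a) else 0 := by
  have h := derE_xvar α β
  rw [derE] at h
  rw [derX, Derivation.smul_apply, h]
  split_ifs <;> simp

theorem derivation_two_mul {K : Type} [CommRing K] [Algebra ℂ K] (D : Derivation ℂ K K) (x : K) :
    D (2 * x) = 2 * D x := by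
  rw [two_mul, map_add, two_mul]

theorem derX_comm (α β : Fin g) (r : RatX g) :
    derX a α (derX a β r) = derX a β (derX a α r) := by
  rcases eq_or_ne α β with rfl | hne
  · rfl
  refine derivation_comm (nonZeroDivisors (MvPolynomial (Fin g) ℂ)) _ _ (fun k => ?_) r
  change derX a α (derX a β (xvar k)) = derX a β (derX a α (xvar k))
  have h : ∀ γ δ : Fin g, γ ≠ δ → derX a γ (2 * Polynomial.aeval (xvar δ) (bigPi a)) = 0 := by
    intro γ δ hγ
    rw [derivation_two_mul, Derivation.map_aeval, derX_xvar, if_neg hγ, smul_zero, mul_zero]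
  rw [derX_xvar, derX_xvar]
  split_ifs with h1 h2 h2
  · exact absurd (h2.trans h1.symm) hne
  · rw [h α β hne, map_zero]
  · rw [h β α hne.symm, map_zero]
  · rw [map_zero, map_zero]

/-- Coefficients of the derivation `∂/∂qₖ` in terms of the `ŷ_α`. -/
def coeffX (k α : Fin g) : RatX g :=
  -(xvar α ^ (k : ℕ)) / nodeProd xvar α / (2 * Polynomial.aeval (xvar α) (bigPi a))

/-- The derivation `∂/∂qₖ` of `ℂ(x₁, …, x_g)`. -/
def derQ (k : Fin g) : Derivation ℂ (RatX g) (RatX g) := ∑ α, coeffX a k α • derX a α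

theorem derQ_apply (k : Fin g) (r : RatX g) : derQ a k r = ∑ α, coeffX a k α * derX a α r := by
  simp only [derQ, ← Derivation.coeFnAddMonoidHom_apply, map_sum, Finset.sum_apply]
  rfl

/-- This is implicit differentiation of `Q(x_α) = 0`, namely `x_α^k + Q'(x_α) ∂x_α/∂qₖ = 0`; it is
the origin of the formula for `coeffX`, where the factor `2 Π(x_α)` of `derX` is divided out. -/
theorem derQ_xvar (k α : Fin g) :
    derQ a k (xvar α) = -(xvar α ^ (k : ℕ)) / nodeProd xvar α := by
  rw [derQ_apply, Finset.sum_eq_single α]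
  · rw [derX_xvar, if_pos rfl, coeffX, div_mul_cancel₀]
    exact mul_ne_zero two_ne_zero (aeval_bigPi_ne_zero a α)
  · intro β _ hβ
    rw [derX_xvar, if_neg hβ, mul_zero]
  · simp

/-- Apply `D` to `Q(x_α) = 0`. Since `Q'(x_α) ≠ 0`, a derivation of `ℂ(x)` is determined by its
restriction to `ℂ(q)`. -/
theorem derivation_xvar (D : Derivation ℂ (RatX g) (RatX g)) (α : Fin g) :
    ∑ j, D (rootEmb g (xvar j)) * xvar α ^ (j : ℕ) = -(nodeProd xvar α * D (xvar α)) := by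
  have h := map_genericMonic (g := g)
  rw [genericMonic, map_monicOf] at h
  have h0 := derivation_eval_monicOf D (fun j => rootEmb g (xvar j)) (xvar α)
  simp only [RingHom.coe_coe] at h
  rw [h, eval_derivative_prod_X_sub_C, prod_X_sub_C_eq_mul_eraseProd _ α] at h0
  simp only [Polynomial.eval_mul, Polynomial.eval_sub, Polynomial.eval_X, Polynomial.eval_C,
    sub_self, zero_mul, map_zero] at h0
  linear_combination -h0

/-- The polynomials with coefficients `derQ a k (qⱼ)` and `δ_{kj}` have degree below `g` and agree
at the `g` distinct points `x_α`. -/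
theorem derQ_rootEmb_xvar (k j : Fin g) :
    derQ a k (rootEmb g (xvar j)) = if k = j then 1 else 0 := by
  have h : (∑ j : Fin g, Polynomial.C (derQ a k (rootEmb g (xvar j))) * Polynomial.X ^ (j : ℕ))
      = ∑ j : Fin g, Polynomial.C (if k = j then 1 else 0) * Polynomial.X ^ (j : ℕ) := by
    refine eq_of_eval_nodes xvar_injective (degree_monicOf_tail _) (degree_monicOf_tail _)
      fun α => ?_
    simp only [Polynomial.eval_finsetSum, Polynomial.eval_mul, Polynomial.eval_C,
      Polynomial.eval_pow, Polynomial.eval_X]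
    rw [derivation_xvar, derQ_xvar, mul_div_cancel₀ _ (nodeProd_ne_zero xvar_injective α)]
    simp
  have := congrArg (fun p => Polynomial.coeff p j) h
  simpa only [coeff_sum_fin] using this

theorem derQ_rootEmb (k : Fin g) (r : RatX g) :
    derQ a k (rootEmb g r) = rootEmb g (derE g k r) := by
  have := twistedDerivation_eq_zero (nonZeroDivisors (MvPolynomial (Fin g) ℂ)) (rootEmb g)
    ((derQ a k).toLinearMap.comp (rootEmb g).toLinearMap
      - (rootEmb g).toLinearMap.comp (derE g k).toLinearMap)
    (fun x y => by
      change derQ a k (rootEmb g (x * y)) - rootEmb g (derE g k (x * y))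
        = rootEmb g x * (derQ a k (rootEmb g y) - rootEmb g (derE g k y))
          + rootEmb g y * (derQ a k (rootEmb g x) - rootEmb g (derE g k x))
      simp only [map_mul, Derivation.leibniz, map_add, smul_eq_mul]
      ring)
    (fun i => by
      change derQ a k (rootEmb g (xvar i)) - rootEmb g (derE g k (xvar i)) = 0
      rw [derQ_rootEmb_xvar, derE_xvar]
      split_ifs <;> simp) r
  exact sub_eq_zero.mp this

/-- The commutator is a derivation that kills `ℂ(q)`, hence kills every `x_α` by `derivation_xvar`.
-/
theorem derQ_comm (k l : Fin g) (r : RatX g) : derQ a k (derQ a l r) = derQ a l (derQ a k r) := by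
  refine derivation_comm (nonZeroDivisors (MvPolynomial (Fin g) ℂ)) _ _ (fun α => ?_) r
  change derQ a k (derQ a l (xvar α)) = derQ a l (derQ a k (xvar α))
  have h := derivation_xvar ⁅derQ a k, derQ a l⁆ α
  simp only [Derivation.commutator_apply, derQ_rootEmb, derE_comm k l, sub_self, zero_mul,
    Finset.sum_const_zero] at h
  have h2 := (mul_eq_zero.mp (neg_eq_zero.mp h.symm)).resolve_left
    (nodeProd_ne_zero xvar_injective α)
  exact sub_eq_zero.mp h2

theorem derivationChangeX : DerivationChange (derE g) (derX a) (rootEmb g) (coeffX a) where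
  extend k r := by rw [← derQ_apply, derQ_rootEmb]
  comm k l α := by
    rw [← derQ_apply, ← derQ_apply]
    obtain ⟨u, hu⟩ : ∃ u, u = 2 * Polynomial.aeval (xvar α) (bigPi a) := ⟨_, rfl⟩
    have hu0 : u ≠ 0 := hu ▸ mul_ne_zero two_ne_zero (aeval_bigPi_ne_zero a α)
    have hx : ∀ k, derQ a k (xvar α) = coeffX a k α * u := by
      intro k
      rw [derQ_xvar, coeffX, ← hu, div_mul_cancel₀ _ hu0]
    have hDu : ∀ k, derQ a k u
        = 2 * Polynomial.aeval (xvar α) (Polynomial.derivative (bigPi a)) * derQ a k (xvar α) := by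
      intro k
      rw [hu, derivation_two_mul, Derivation.map_aeval, smul_eq_mul, mul_assoc]
    -- With `∂x_α/∂qₖ = coeffX a k α * u`, the terms in which `u = 2 Π(x_α)` is differentiated are
    -- symmetric in `k`, `l` and cancel; what remains is `u` times the claim.
    have h := derQ_comm a k l (xvar α)
    rw [hx, hx, Derivation.leibniz, Derivation.leibniz, hDu, hDu, hx, hx] at h
    simp only [smul_eq_mul] at h
    apply mul_left_cancel₀ hu0
    linear_combination h

theorem permX_coeffX (σ : Equiv.Perm (Fin g)) (k α : Fin g) :
    permX σ (coeffX a k α) = coeffX a k (σ α) := by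
  have h : permX σ (nodeProd xvar α) = nodeProd xvar (σ α) := by
    rw [nodeProd, nodeProd, map_prod]
    refine Finset.prod_bij (fun β _ => σ β) ?_ ?_ ?_ ?_
    · intro β hβ
      simpa using hβ
    · intro β _ γ _ h
      exact σ.injective h
    · intro β hβ
      exact ⟨σ.symm β, by
        simp only [Finset.mem_erase, Finset.mem_univ, and_true, ne_eq] at hβ ⊢
        rintro rfl
        simp at hβ, by simp⟩
    · intro β _
      rw [map_sub, permX_xvar, permX_xvar]
  simp only [coeffX, map_div₀, map_neg, map_pow, map_mul, permX_xvar, permX_aeval, h, map_ofNat]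

/-- The homomorphism `ℂ(q)[∂/∂q] → A_𝒳`. -/
def quantumX : CrossedProduct (derE g) →ₐ[ℂ] AX a :=
  (crossedMap (derivationChangeX a)).codRestrict (AX a) (by
    intro x
    rw [mem_AX]
    intro σ
    have h : (permAX a σ).comp (crossedMap (derivationChangeX a))
        = crossedMap (derivationChangeX a) := by
      apply crossedProduct_hom_ext
      · intro r
        rw [AlgHom.comp_apply, crossedMap_coef, permAX, permHom_coef, permX_rootEmb]
      · intro k
        rw [AlgHom.comp_apply, crossedMap_gen, vectorField, map_sum]
        simp only [permAX, map_mul, permHom_coef, permHom_gen, permX_coeffX]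
        exact Equiv.sum_comp σ fun α => coef (derX a) (coeffX a k α) * gen (derX a) α
    exact congrArg (fun f => f x) h)

theorem permSX_linForm_coeffX (σ : Equiv.Perm (Fin g)) (k : Fin g) :
    permSX σ (linForm (coeffX a k)) = linForm (coeffX a k) := by
  rw [linForm, map_sum]
  simp only [permSX, map_mul, AlgHom.comp_apply, mapAlgHom_apply, map_C, map_X,
    AlgHom.restrictScalars_apply, rename_C, rename_X, RingHom.coe_coe, permX_coeffX]
  exact Equiv.sum_comp σ fun α => (C (coeffX a k α) * X α : MvPolynomial (Fin g) (RatX g))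

theorem permSX_C (σ : Equiv.Perm (Fin g)) (r : RatX g) : permSX σ (C r) = C (permX σ r) := by
  simp [permSX]

theorem permSX_X (σ : Equiv.Perm (Fin g)) (α : Fin g) :
    permSX σ (X α) = (X (σ α) : MvPolynomial (Fin g) (RatX g)) := by
  simp [permSX]

/-- The homomorphism `ℂ(q)[ξ] → S_𝒳`. -/
def classicalX : MvPolynomial (Fin g) (RatX g) →ₐ[ℂ] SX g :=
  (symbolMap (rootEmb g) (coeffX a)).codRestrict (SX g) (by
    intro p
    rw [mem_SX]
    intro σ
    induction p using MvPolynomial.induction_on with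
    | C r => rw [symbolMap_C, permSX_C, permX_rootEmb]
    | add p q hp hq => rw [map_add, map_add, hp, hq]
    | mul_X p i hp => rw [map_mul, map_mul, hp, symbolMap_X, permSX_linForm_coeffX])

/-! ### Bijectivity on the `𝒳` side -/

theorem coe_quantumX (x : CrossedProduct (derE g)) :
    (quantumX a x : AXfull a) = crossedMap (derivationChangeX a) x := rfl

theorem coe_classicalX (p : MvPolynomial (Fin g) (RatX g)) :
    (classicalX a p : MvPolynomial (Fin g) (RatX g)) = symbolMap (rootEmb g) (coeffX a) p := rfl

/-- The product of the two square matrices in the other order is `derQ_rootEmb_xvar`, and a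
one-sided inverse of a square matrix is two-sided. -/
theorem sum_derX_mul_coeffX (α β : Fin g) :
    ∑ k, derX a α (rootEmb g (xvar k)) * coeffX a k β = if α = β then 1 else 0 := by
  have h : (Matrix.of fun k α => coeffX a k α) *
      (Matrix.of fun α j => derX a α (rootEmb g (xvar j))) = 1 := by
    ext k j
    rw [Matrix.mul_apply, Matrix.one_apply]
    simp only [Matrix.of_apply]
    rw [← derQ_apply, derQ_rootEmb_xvar]
  rw [mul_eq_one_comm] at h
  have h2 := congrArg (fun M => M α β) h
  simpa only [Matrix.mul_apply, Matrix.one_apply, Matrix.of_apply] using h2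

/-- The linear change of variables `ξₖ ↦ ∑_α c_{kα} y_α`. -/
def changeVar : MvPolynomial (Fin g) (RatX g) →ₐ[RatX g] MvPolynomial (Fin g) (RatX g) :=
  aeval fun k => linForm (coeffX a k)

/-- The inverse of `changeVar`. -/
def changeVarInv : MvPolynomial (Fin g) (RatX g) →ₐ[RatX g] MvPolynomial (Fin g) (RatX g) :=
  aeval fun α => linForm fun k => derX a α (rootEmb g (xvar k))

theorem changeVar_C (r : RatX g) : changeVar a (C r) = C r := algHom_C _ r

theorem changeVar_X (k : Fin g) : changeVar a (X k) = linForm (coeffX a k) := aeval_X _ k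

theorem aeval_linForm (u : Fin g → Fin g → RatX g) (v : Fin g → RatX g) :
    aeval (fun k => linForm (u k)) (linForm v) = linForm fun i => ∑ k, v k * u k i := by
  rw [← linForm_sum]
  conv_lhs => rw [linForm, map_sum]
  refine Finset.sum_congr rfl fun k _ => ?_
  rw [map_mul, aeval_X, algHom_C, algebraMap_eq, C_mul_linForm]

theorem changeVar_changeVarInv (p : MvPolynomial (Fin g) (RatX g)) :
    changeVar a (changeVarInv a p) = p := by
  have : (changeVar a).comp (changeVarInv a) = AlgHom.id _ _ := by
    apply algHom_ext
    intro α
    rw [AlgHom.comp_apply, changeVarInv, aeval_X, changeVar, aeval_linForm]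
    simp [sum_derX_mul_coeffX, linForm]
  exact congrArg (fun f => f p) this

theorem changeVarInv_changeVar (p : MvPolynomial (Fin g) (RatX g)) :
    changeVarInv a (changeVar a p) = p := by
  have : (changeVarInv a).comp (changeVar a) = AlgHom.id _ _ := by
    apply algHom_ext
    intro k
    rw [AlgHom.comp_apply, changeVar, aeval_X, changeVarInv, aeval_linForm]
    simp [← derQ_apply, derQ_rootEmb_xvar, linForm]
  exact congrArg (fun f => f p) this

theorem symbolMap_eq_changeVar (p : MvPolynomial (Fin g) (RatX g)) :
    symbolMap (rootEmb g) (coeffX a) p = changeVar a (map (rootEmb g : RatX g →+* RatX g) p) := rfl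

theorem symbolMapX_injective : Function.Injective (symbolMap (rootEmb g) (coeffX a)) := by
  intro p q h
  rw [symbolMap_eq_changeVar, symbolMap_eq_changeVar] at h
  have := congrArg (changeVarInv a) h
  rw [changeVarInv_changeVar, changeVarInv_changeVar] at this
  exact map_injective _ (rootEmb g : RatX g →+* RatX g).injective this

theorem permSX_changeVar (σ : Equiv.Perm (Fin g)) (p : MvPolynomial (Fin g) (RatX g)) :
    permSX σ (changeVar a p) = changeVar a (map (permX σ : RatX g →+* RatX g) p) := by
  induction p using MvPolynomial.induction_on with
  | C r => rw [map_C, changeVar_C, changeVar_C, permSX_C, RingHom.coe_coe]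
  | add p q hp hq => simp only [map_add, hp, hq]
  | mul_X p i hp =>
    rw [map_mul, map_mul, hp, map_mul, map_mul, map_X, changeVar_X, permSX_linForm_coeffX]

/-- In the new momenta `𝔖_g` acts on coefficients only (`permSX_changeVar`), so a polynomial is
invariant exactly when its coefficients are symmetric, that is, come from `ℂ(q)`. -/
theorem classicalX_bijective : Function.Bijective (classicalX a) := by
  refine ⟨fun p q h => symbolMapX_injective a (congrArg Subtype.val h), ?_⟩
  rintro ⟨p, hp⟩
  rw [mem_SX] at hp
  have hinv : ∀ σ : Equiv.Perm (Fin g), map (permX σ : RatX g →+* RatX g) (changeVarInv a p) = changeVarInv a p := by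
    intro σ
    have h := permSX_changeVar a σ (changeVarInv a p)
    rw [changeVar_changeVarInv, hp σ] at h
    rw [← changeVarInv_changeVar a (map _ _), ← h]
  have hcoef : ∀ m, ∃ e, rootEmb g e = (changeVarInv a p).coeff m := by
    intro m
    refine exists_rootEmb_eq fun σ => ?_
    have := congrArg (coeff m) (hinv σ)
    rwa [coeff_map] at this
  have hmem : changeVarInv a p ∈
      Set.range (map (σ := Fin g) (rootEmb g : RatX g →+* RatX g)) := by
    rw [mem_range_map_iff_coeffs_subset]
    intro r hr
    obtain ⟨m, -, rfl⟩ := mem_coeffs_iff.mp hr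
    exact hcoef m
  obtain ⟨q, hq⟩ := hmem
  refine ⟨q, Subtype.ext ?_⟩
  rw [coe_classicalX, symbolMap_eq_changeVar, hq, changeVar_changeVarInv]

theorem permAX_nord (σ : Equiv.Perm (Fin g)) (p : MvPolynomial (Fin g) (RatX g)) :
    permAX a σ (nord (derX a) p) = nord (derX a) (permSX σ p) := by
  induction p using MvPolynomial.induction_on with
  | C r => rw [nord_C, permSX_C, nord_C, permAX, permHom_coef]
  | add p q hp hq => simp only [map_add, hp, hq]
  | mul_X p i hp =>
    rw [nord_mul_X, map_mul, map_mul, hp, permSX_X, nord_mul_X]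
    congr 1
    rw [permAX, permHom_gen]

theorem nord_mem_AX_iff (p : MvPolynomial (Fin g) (RatX g)) :
    nord (derX a) p ∈ AX a ↔ p ∈ SX g := by
  rw [mem_AX, mem_SX]
  refine forall_congr' fun σ => ?_
  rw [permAX_nord, (nord_injective (derX a) (derX_comm a)).eq_iff]

/-- The symbol of an invariant operator is invariant, so it lifts by `classicalX_bijective`;
subtracting the image of the normally ordered lift of the leading part lowers the order. The shift
`n - 1` starts the induction at negative order, where only `0` lives. -/
theorem exists_quantumX_eq (n : ℕ) (x : AX a) (hx : (x : AXfull a) ∈ filt (derX a) ((n : ℤ) - 1)) :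
    ∃ e ∈ filt (derE g) ((n : ℤ) - 1), quantumX a e = x := by
  induction n generalizing x with
  | zero =>
    obtain ⟨p, hp, hpx⟩ := hx
    have h0 := eq_zero_of_mem_degLE (by simp) hp
    rw [h0, map_zero] at hpx
    exact ⟨0, zero_mem _, by rw [map_zero]; exact Subtype.ext hpx⟩
  | succ n ih =>
    rw [Nat.cast_succ, add_sub_cancel_right] at hx ⊢
    obtain ⟨p, hp, hpx⟩ := hx
    have hpS : p ∈ SX g := by rw [← nord_mem_AX_iff a, hpx]; exact x.2
    obtain ⟨q, hq⟩ := (classicalX_bijective a).2 ⟨p, hpS⟩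
    have hqp : symbolMap (rootEmb g) (coeffX a) q = p := congrArg Subtype.val hq
    set q' := homogeneousComponent n q with hq'
    have hsym := crossedMap_nord_hasSymbol (derivationChangeX a)
      (homogeneousComponent_isHomogeneous n q)
    rw [← hq', ← symbolMap_homogeneousComponent, hqp] at hsym
    have hrest : ((x - quantumX a (nord (derE g) q') : AX a) : AXfull a)
        ∈ filt (derX a) ((n : ℤ) - 1) := by
      have e : ((x - quantumX a (nord (derE g) q') : AX a) : AXfull a)
          = nord (derX a) (p - homogeneousComponent n p)
            - (crossedMap (derivationChangeX a) (nord (derE g) q')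
              - nord (derX a) (homogeneousComponent n p)) := by
        rw [Subalgebra.coe_sub, coe_quantumX, ← hpx, map_sub]
        abel
      rw [e]
      exact sub_mem (nord_mem_filt _ (sub_homogeneousComponent_mem_degLE hp)) hsym.2
    obtain ⟨e, he, hee⟩ := ih _ hrest
    refine ⟨e + nord (derE g) q', add_mem (filt_mono _ (by omega) he)
      (nord_mem_filt _ (IsHomogeneous.mem_degLE (homogeneousComponent_isHomogeneous n q))), ?_⟩
    rw [map_add, hee]
    exact sub_add_cancel x _

theorem quantumX_filt (k : ℤ) : quantumX a '' (filt (derE g) k) = filtAX a k := by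
  apply Set.Subset.antisymm
  · rintro _ ⟨e, he, rfl⟩
    exact crossedMap_mem_filt (derivationChangeX a) he
  · intro x hx
    rcases lt_or_ge k 0 with hk | hk
    · obtain ⟨p, hp, hpx⟩ := hx
      rw [eq_zero_of_mem_degLE hk hp, map_zero] at hpx
      exact ⟨0, zero_mem _, by rw [map_zero]; exact Subtype.ext hpx⟩
    · obtain ⟨n, rfl⟩ := Int.eq_ofNat_of_zero_le hk
      obtain ⟨e, he, hee⟩ := exists_quantumX_eq a (n + 1) x (by
        rw [Nat.cast_succ, add_sub_cancel_right]; exact hx)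
      rw [Nat.cast_succ, add_sub_cancel_right] at he
      exact ⟨e, he, hee⟩

/-- Injectivity comes from the faithful action on `ℂ(q) ⊂ ℂ(x)`, surjectivity from exhaustion by the
order filtration. -/
theorem quantumX_bijective : Function.Bijective (quantumX a) := by
  constructor
  · intro x y h
    apply opHom_derE_injective
    refine LinearMap.ext fun r => (rootEmb g : RatX g →+* RatX g).injective ?_
    have h' : crossedMap (derivationChangeX a) x = crossedMap (derivationChangeX a) y :=
      congrArg Subtype.val h
    have e := opHom_crossedMap (derivationChangeX a) derE_comm (derX_comm a)
    rw [RingHom.coe_coe, ← e, ← e, h']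
  · intro x
    obtain ⟨p, hp⟩ := nord_surjective (derX a) x
    obtain ⟨k, hk⟩ := exists_mem_degLE p
    have : x ∈ filtAX a k := ⟨p, hk, hp⟩
    rw [← quantumX_filt] at this
    obtain ⟨e, -, he⟩ := this
    exact ⟨e, he⟩

/-! ### The elements `Ŷ[φ]` in coefficient coordinates -/

/-- The vector field on the space of monic polynomials `Q` given by `Q ↦ -2 (ψ Q' mod Q)`. -/
def fieldE (ψ : Polynomial (RatX g)) (k : Fin g) : RatX g :=
  -2 * ((ψ * Polynomial.derivative (genericMonic g)) %ₘ genericMonic g).coeff k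

theorem genericMonic_monic : (genericMonic g).Monic := monicOf_monic _

theorem degree_genericMonic : (genericMonic g).degree = g := by
  rw [Polynomial.degree_eq_natDegree genericMonic_monic.ne_zero, genericMonic, natDegree_monicOf]

/-- At the root `x_α` the remainder of `φ Q'` takes the value `φ(x_α) Q'(x_α)`. The denominator of
`coeffX` cancels `Q'(x_α)` and the factor `-2`, and leaves `φ/Π`. -/
theorem sum_rootEmb_fieldE (φ : Polynomial ℂ) (α : Fin g) :
    ∑ k, rootEmb g (fieldE (φ.map (algebraMap ℂ (RatX g))) k) * coeffX a k α = yCoef a φ α := by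
  have hn := nodeProd_ne_zero (xvar_injective (g := g)) α
  have hP := aeval_bigPi_ne_zero a α
  have hφ : ((φ.map (algebraMap ℂ (RatX g))).map (rootEmb g : RatX g →+* RatX g))
      = φ.map (algebraMap ℂ (RatX g)) := by
    rw [Polynomial.map_map]
    congr 1
    ext c
    exact (rootEmb g).commutes c
  set R := ((φ.map (algebraMap ℂ (RatX g))) * Polynomial.derivative (genericMonic g))
    %ₘ genericMonic g with hR
  have hRmap : R.map (rootEmb g : RatX g →+* RatX g)
      = ∑ i, Polynomial.C ((φ.map (algebraMap ℂ (RatX g))).eval (xvar i)) * eraseProd xvar i := by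
    rw [hR, Polynomial.map_modByMonic _ genericMonic_monic, Polynomial.map_mul,
      ← Polynomial.derivative_map, map_genericMonic, hφ, sum_eval_mul_eraseProd xvar_injective]
  have hev := congrArg (Polynomial.eval (xvar α)) hRmap
  rw [eval_sum_eraseProd] at hev
  have hdeg : (R.map (rootEmb g : RatX g →+* RatX g)).degree < g := by
    rw [hRmap]; exact degree_sum_eraseProd_lt _ _
  rw [← sum_coeff_mul_pow hdeg] at hev
  have e : ∑ k, rootEmb g (fieldE (φ.map (algebraMap ℂ (RatX g))) k) * coeffX a k α
      = (∑ k : Fin g, (R.map (rootEmb g : RatX g →+* RatX g)).coeff k * xvar α ^ (k : ℕ))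
        * ((nodeProd xvar α)⁻¹ * (Polynomial.aeval (xvar α) (bigPi a))⁻¹) := by
    rw [Finset.sum_mul]
    refine Finset.sum_congr rfl fun k _ => ?_
    rw [fieldE, ← hR, coeffX, Polynomial.coeff_map, RingHom.coe_coe, map_mul, map_neg, map_ofNat]
    field_simp
  rw [e, hev, yCoef, Polynomial.eval_map_algebraMap]
  field_simp

theorem quantumX_vectorField (φ : Polynomial ℂ) :
    quantumX a (vectorField (derE g) (fieldE (φ.map (algebraMap ℂ (RatX g))))) = Yhat a φ := by
  apply Subtype.ext
  rw [coe_quantumX, crossedMap_vectorField]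
  simp only [sum_rootEmb_fieldE]
  rfl

theorem classicalX_linForm (φ : Polynomial ℂ) :
    classicalX a (linForm (fieldE (φ.map (algebraMap ℂ (RatX g))))) = Ycl a φ := by
  apply Subtype.ext
  rw [coe_classicalX, symbolMap_linForm]
  simp only [sum_rootEmb_fieldE]
  rfl

theorem rootEmb_esymm {k : ℕ} (h1 : 1 ≤ k) (hk : k ≤ g) :
    rootEmb g ((-1) ^ k * xvar ⟨g - k, by omega⟩)
      = algebraMap _ (RatX g) (esymm (Fin g) ℂ k) := by
  rw [esymm_eq_rootCoeff h1 hk, map_mul, rootEmb_xvar, map_mul]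
  simp

theorem quantumX_coef_esymm {k : ℕ} (h1 : 1 ≤ k) (hk : k ≤ g) :
    quantumX a (coef (derE g) ((-1) ^ k * xvar ⟨g - k, by omega⟩)) = ehat a k := by
  apply Subtype.ext
  rw [coe_quantumX, crossedMap_coef, rootEmb_esymm h1 hk]
  rfl

theorem classicalX_C_esymm {k : ℕ} (h1 : 1 ≤ k) (hk : k ≤ g) :
    classicalX a (C ((-1) ^ k * xvar ⟨g - k, by omega⟩)) = ecl g k := by
  apply Subtype.ext
  rw [coe_classicalX, symbolMap_C, rootEmb_esymm h1 hk]
  rfl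

/-! ### Generation by symmetric functions and the elements `Ŷ[X ^ j]` -/

/-- Every `∂/∂qₖ` is a combination of the vector fields attached to powers of `X`. -/
theorem exists_sum_fieldE (k : Fin g) : ∃ B : Polynomial (RatX g), ∀ m,
    ∑ j ∈ Finset.range (B.natDegree + 1), B.coeff j * fieldE ((Polynomial.X ^ j : Polynomial ℂ).map
      (algebraMap ℂ (RatX g))) m = if m = k then 1 else 0 := by
  have hcop : IsCoprime (genericMonic g) (Polynomial.derivative (genericMonic g)) := by
    change (genericMonic g).Separable
    rw [← Polynomial.separable_map (rootEmb g : RatX g →+* RatX g), map_genericMonic]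
    exact Polynomial.separable_prod_X_sub_C_iff.mpr xvar_injective
  obtain ⟨u, v, huv⟩ := hcop
  -- By the Bézout relation `u Q + v Q' = 1` one has `B Q' ≡ -½ X^k` modulo `Q`, and the factor `-2`
  -- in `fieldE` turns this into the constant field `X^k`, i.e. `∂/∂qₖ`.
  set B : Polynomial (RatX g) := Polynomial.C (-2⁻¹) * (Polynomial.X ^ (k : ℕ) * v) with hB
  refine ⟨B, fun m => ?_⟩
  have hlin : ∑ j ∈ Finset.range (B.natDegree + 1), B.coeff j *
      fieldE ((Polynomial.X ^ j : Polynomial ℂ).map (algebraMap ℂ (RatX g))) m = fieldE B m := by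
    have e : B * Polynomial.derivative (genericMonic g)
        = ∑ j ∈ Finset.range (B.natDegree + 1), B.coeff j •
          ((Polynomial.X ^ j : Polynomial ℂ).map (algebraMap ℂ (RatX g)) *
            Polynomial.derivative (genericMonic g)) := by
      conv_lhs => rw [B.as_sum_range_C_mul_X_pow]
      rw [Finset.sum_mul]
      refine Finset.sum_congr rfl fun j _ => ?_
      rw [Polynomial.smul_eq_C_mul, Polynomial.map_pow, Polynomial.map_X, mul_assoc]
    simp only [fieldE]
    rw [e, ← Polynomial.modByMonicHom_apply, map_sum, Polynomial.finsetSum_coeff, Finset.mul_sum]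
    refine Finset.sum_congr rfl fun j _ => ?_
    rw [map_smul, Polynomial.modByMonicHom_apply, Polynomial.coeff_smul, smul_eq_mul]
    ring
  rw [hlin, fieldE]
  have hmod : (B * Polynomial.derivative (genericMonic g)) %ₘ genericMonic g
      = Polynomial.C (-2⁻¹) * Polynomial.X ^ (k : ℕ) := by
    have hd : (Polynomial.C (-2⁻¹ : RatX g) * Polynomial.X ^ (k : ℕ)).degree
        < (genericMonic g).degree := by
      rw [degree_genericMonic]
      exact lt_of_le_of_lt (Polynomial.degree_C_mul_X_pow_le _ _) (by exact_mod_cast k.2)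
    have e : B * Polynomial.derivative (genericMonic g)
        = Polynomial.C (-2⁻¹) * Polynomial.X ^ (k : ℕ)
          + genericMonic g * (-(Polynomial.C (-2⁻¹) * Polynomial.X ^ (k : ℕ) * u)) := by
      rw [hB]
      linear_combination Polynomial.C (-2⁻¹ : RatX g) * Polynomial.X ^ (k : ℕ) * huv
    exact (Polynomial.div_modByMonic_unique _ _ genericMonic_monic ⟨e.symm, hd⟩).2
  rw [hmod, Polynomial.coeff_C_mul, Polynomial.coeff_X_pow]
  split_ifs with h1 h2 h2
  · simp
  · exact absurd (Fin.ext h1) h2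
  · exact absurd (congrArg Fin.val h2) h1
  · simp

theorem algHom_ratX_ext {B : Type} [Semiring B] [Algebra ℂ B] {F G : RatX g →ₐ[ℂ] B}
    (h : ∀ j, F (xvar j) = G (xvar j)) : F = G := by
  have hp : ∀ p, F (algebraMap (MvPolynomial (Fin g) ℂ) _ p) = G (algebraMap _ _ p) := by
    intro p
    have : F.comp (IsScalarTower.toAlgHom ℂ (MvPolynomial (Fin g) ℂ) (RatX g))
        = G.comp (IsScalarTower.toAlgHom ℂ (MvPolynomial (Fin g) ℂ) (RatX g)) :=
      algHom_ext h
    exact congrArg (fun f => f p) this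
  ext r
  obtain ⟨p, q, hq, rfl⟩ := IsFractionRing.div_surjective (A := MvPolynomial (Fin g) ℂ) r
  have hqK : algebraMap _ (RatX g) q ≠ 0 := by
    simpa using nonZeroDivisors.ne_zero hq
  -- The target may be noncommutative, so the values on inverses are compared as a left and a right
  -- inverse of the same element.
  have hinv : F (algebraMap _ (RatX g) q)⁻¹ = G (algebraMap _ (RatX g) q)⁻¹ := by
    refine left_inv_eq_right_inv (a := F (algebraMap _ (RatX g) q)) ?_ ?_
    · rw [← map_mul, inv_mul_cancel₀ hqK, map_one]
    · rw [hp, ← map_mul, mul_inv_cancel₀ hqK, map_one]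
  rw [div_eq_mul_inv, map_mul, map_mul, hp, hinv]

/-- Every `∂/∂qₖ` is a combination of the listed vector fields with coefficients in `ℂ(q)` by
`exists_sum_fieldE`; this carries the uniqueness of `Λ̂`. -/
theorem quantum_hom_ext {B : Type} [Semiring B] [Algebra ℂ B]
    {F G : CrossedProduct (derE g) →ₐ[ℂ] B}
    (h : ∀ j, F (coef (derE g) (xvar j)) = G (coef (derE g) (xvar j)))
    (h' : ∀ φ : Polynomial ℂ, F (vectorField (derE g) (fieldE (φ.map (algebraMap ℂ (RatX g)))))
      = G (vectorField (derE g) (fieldE (φ.map (algebraMap ℂ (RatX g)))))) : F = G := by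
  have hc : ∀ r, F (coef (derE g) r) = G (coef (derE g) r) := by
    have : F.comp (coef (derE g)) = G.comp (coef (derE g)) := algHom_ratX_ext h
    exact fun r => congrArg (fun f => f r) this
  refine crossedProduct_hom_ext _ hc fun k => ?_
  obtain ⟨B, hB⟩ := exists_sum_fieldE k
  have e : gen (derE g) k = ∑ j ∈ Finset.range (B.natDegree + 1), coef (derE g) (B.coeff j) *
      vectorField (derE g) (fieldE ((Polynomial.X ^ j : Polynomial ℂ).map
        (algebraMap ℂ (RatX g)))) := by
    simp only [vectorField, Finset.mul_sum]
    rw [Finset.sum_comm]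
    simp only [← mul_assoc, ← map_mul, ← Finset.sum_mul, ← map_sum, hB]
    simp
  rw [e, map_sum, map_sum]
  exact Finset.sum_congr rfl fun j _ => by rw [map_mul, map_mul, hc, h']

theorem classical_hom_ext {B : Type} [Semiring B] [Algebra ℂ B]
    {F G : MvPolynomial (Fin g) (RatX g) →ₐ[ℂ] B}
    (h : ∀ j, F (C (xvar j)) = G (C (xvar j)))
    (h' : ∀ φ : Polynomial ℂ, F (linForm (fieldE (φ.map (algebraMap ℂ (RatX g)))))
      = G (linForm (fieldE (φ.map (algebraMap ℂ (RatX g)))))) : F = G := by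
  have hc : ∀ r, F (C r) = G (C r) := by
    have : F.comp (IsScalarTower.toAlgHom ℂ (RatX g) (MvPolynomial (Fin g) (RatX g)))
        = G.comp (IsScalarTower.toAlgHom ℂ (RatX g) (MvPolynomial (Fin g) (RatX g))) :=
      algHom_ratX_ext h
    exact fun r => congrArg (fun f => f r) this
  have hX : ∀ k, F (X k) = G (X k) := by
    intro k
    obtain ⟨B, hB⟩ := exists_sum_fieldE k
    have e : X k = ∑ j ∈ Finset.range (B.natDegree + 1), C (B.coeff j) *
        linForm (fieldE ((Polynomial.X ^ j : Polynomial ℂ).map (algebraMap ℂ (RatX g)))) := by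
      simp only [C_mul_linForm]
      rw [linForm_sum]
      simp only [hB]
      simp [linForm]
    rw [e, map_sum, map_sum]
    exact Finset.sum_congr rfl fun j _ => by rw [map_mul, map_mul, hc, h']
  refine AlgHom.ext fun p => ?_
  induction p using MvPolynomial.induction_on with
  | C r => exact hc r
  | add p q hp hq => rw [map_add, map_add, hp, hq]
  | mul_X p i hp => rw [map_mul, map_mul, hp, hX]

end XMaps

end

noncomputable section

open MvPolynomial

section UBasics

variable {g : ℕ} (a : Fin (g + 3) ↪ ℂ)

/-! ### Coordinates on `V` adapted to `W` -/

/-- The coefficient of `T ^ j` in `∑ᵢ fᵢ ∏_{j ≠ i} (T - aⱼ)`. -/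
def coefForm (j : ℕ) : MvPolynomial (Fin (g + 3)) ℂ :=
  ∑ i, C ((eraseProd (⇑a) i).coeff j) * X i

/-- Compare coefficients in `Π = (T - aᵢ) ∏_{j ≠ i} (T - aⱼ)`. Descending from the top coefficient
`1`, this makes the three top coefficients of `P_f` triangular combinations of `ell a 0`, `ell a 1`,
`ell a 2`. -/
theorem eraseProd_coeff_succ (i : Fin (g + 3)) (k : ℕ) :
    (eraseProd (⇑a) i).coeff k
      = (∏ j, (Polynomial.X - Polynomial.C (a j))).coeff (k + 1)
        + a i * (eraseProd (⇑a) i).coeff (k + 1) := by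
  have h := congrArg (fun p => Polynomial.coeff p (k + 1)) (prod_X_sub_C_eq_mul_eraseProd (⇑a) i)
  simp only [sub_mul, Polynomial.coeff_sub, Polynomial.coeff_X_mul, Polynomial.coeff_C_mul] at h
  linear_combination -h

theorem eraseProd_coeff_top (i : Fin (g + 3)) : (eraseProd (⇑a) i).coeff (g + 2) = 1 := by
  have hm : (eraseProd (⇑a) i).Monic :=
    Polynomial.monic_prod_of_monic _ _ fun j _ => Polynomial.monic_X_sub_C _
  have := hm.coeff_natDegree
  rwa [natDegree_eraseProd] at this

theorem coefForm_succ (k : ℕ) :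
    coefForm a k = C ((∏ j, (Polynomial.X - Polynomial.C (a j))).coeff (k + 1)) * ell a 0
      + ∑ i, C (a i * (eraseProd (⇑a) i).coeff (k + 1)) * X i := by
  rw [coefForm, ell, Finset.mul_sum, ← Finset.sum_add_distrib]
  refine Finset.sum_congr rfl fun i _ => ?_
  rw [eraseProd_coeff_succ a i k, map_add, pow_zero, C_1]
  ring

theorem coefForm_top : coefForm a (g + 2) = ell a 0 := by
  simp [coefForm, ell, eraseProd_coeff_top]

theorem coefForm_top_sub_one :
    coefForm a (g + 1) = C ((∏ j, (Polynomial.X - Polynomial.C (a j))).coeff (g + 2)) * ell a 0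
      + ell a 1 := by
  rw [coefForm_succ]
  simp [ell, eraseProd_coeff_top]

theorem coefForm_middle :
    coefForm a g = C ((∏ j, (Polynomial.X - Polynomial.C (a j))).coeff (g + 1)) * ell a 0
      + C ((∏ j, (Polynomial.X - Polynomial.C (a j))).coeff (g + 2)) * ell a 1 + ell a 2 := by
  rw [coefForm_succ, add_assoc]
  congr 1
  simp only [ell]
  rw [Finset.mul_sum, ← Finset.sum_add_distrib]
  refine Finset.sum_congr rfl fun i _ => ?_
  rw [eraseProd_coeff_succ a i (g + 1), eraseProd_coeff_top]
  simp only [map_mul, map_add, pow_one, map_pow, mul_one]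
  ring

/-- A linear map on linear forms, recovered from its values on the coordinates `coefForm`. -/
theorem ell_of_coefForm {L : Type} [CommRing L] [Algebra ℂ L]
    (F : MvPolynomial (Fin (g + 3)) ℂ →ₗ[ℂ] L) (h2 : F (coefForm a (g + 2)) = 0)
    (h1 : F (coefForm a (g + 1)) = 0) :
    F (ell a 0) = 0 ∧ F (ell a 1) = 0 ∧ F (ell a 2) = F (coefForm a g) := by
  have e0 : F (ell a 0) = 0 := by rw [← coefForm_top]; exact h2
  have e1 : F (ell a 1) = 0 := by
    rw [coefForm_top_sub_one, ← smul_eq_C_mul, map_add, map_smul, e0, smul_zero, zero_add] at h1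
    exact h1
  refine ⟨e0, e1, ?_⟩
  rw [coefForm_middle, ← smul_eq_C_mul, ← smul_eq_C_mul, map_add, map_add, map_smul, map_smul, e0,
    e1, smul_zero, smul_zero, zero_add, zero_add]

/-- This is `P_f(aᵢ) = Π'(aᵢ) fᵢ`: all summands of `P_f` but the `i`-th vanish at `aᵢ`. -/
theorem sum_coefForm_mul_pow (i : Fin (g + 3)) :
    ∑ j ∈ Finset.range (g + 3), C (a i ^ j) * coefForm a j = C (nodeProd (⇑a) i) * X i := by
  have h : ∀ k, ∑ j ∈ Finset.range (g + 3), (eraseProd (⇑a) k).coeff j * a i ^ j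
      = if k = i then nodeProd (⇑a) i else 0 := by
    intro k
    rw [← Polynomial.eval_eq_sum_range' (by rw [natDegree_eraseProd]; omega)]
    split_ifs with h
    · rw [h, eval_eraseProd_self]
    · exact eval_eraseProd_of_ne _ (Ne.symm h)
  simp only [coefForm, Finset.mul_sum]
  rw [Finset.sum_comm]
  have e : ∀ k, ∑ j ∈ Finset.range (g + 3), C (a i ^ j) * (C ((eraseProd (⇑a) k).coeff j) * X k)
      = C (if k = i then nodeProd (⇑a) i else 0) * (X k : MvPolynomial (Fin (g + 3)) ℂ) := by
    intro k
    rw [← h k, map_sum, Finset.sum_mul]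
    exact Finset.sum_congr rfl fun j _ => by rw [map_mul]; ring
  simp only [e]
  rw [Finset.sum_eq_single i]
  · simp
  · intro k _ hk; simp [hk]
  · simp

/-- The unit `∑ᵢ aᵢ² fᵢ` of `𝒪`. -/
def lU : OW a := toOW a (ell a 2)

theorem isUnit_toOW {p : MvPolynomial (Fin (g + 3)) ℂ} (hp : p ∈ (idealW a).primeCompl) :
    IsUnit (toOW a p) :=
  IsLocalization.map_units (OW a) (⟨p, hp⟩ : (idealW a).primeCompl)

theorem isUnit_lU : IsUnit (lU a) := isUnit_toOW a (ell_two_notMem a)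

theorem lU_mul_fbarO (i : Fin (g + 3)) : lU a * fbarO a i = toOW a (X i) := by
  rw [mul_comm]
  exact IsLocalization.mk'_spec (OW a) _ _

/-- The quotient of `coefForm j` by `∑ᵢ aᵢ² fᵢ`. -/
def coefO (j : ℕ) : OW a := ∑ i, (eraseProd (⇑a) i).coeff j • fbarO a i

theorem lU_mul_coefO (j : ℕ) : lU a * coefO a j = toOW a (coefForm a j) := by
  rw [coefO, coefForm, Finset.mul_sum, map_sum]
  refine Finset.sum_congr rfl fun i _ => ?_
  rw [mul_smul_comm, lU_mul_fbarO, ← smul_eq_C_mul, map_smul]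

theorem coefO_mem (j : ℕ) : coefO a j ∈ homog a 0 :=
  Submodule.sum_mem _ fun i _ => Submodule.smul_mem _ _ (fbarO_mem a i)

theorem mem_maximalIdeal_iff (p : MvPolynomial (Fin (g + 3)) ℂ) :
    toOW a p ∈ IsLocalRing.maximalIdeal (OW a) ↔ p ∈ idealW a :=
  IsLocalization.AtPrime.to_map_mem_maximal_iff (OW a) (idealW a) p

/-- The residue homomorphism `𝒪 → ℂ(V/W)`. -/
def resU : OW a →ₐ[ℂ] FW a := IsScalarTower.toAlgHom ℂ (OW a) (FW a)

theorem resU_apply (r : OW a) : resU a r = IsLocalRing.residue (OW a) r := rfl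

theorem resU_eq_zero_iff (r : OW a) : resU a r = 0 ↔ r ∈ IsLocalRing.maximalIdeal (OW a) :=
  IsLocalRing.residue_eq_zero_iff r

theorem resU_toOW_eq_zero_iff (p : MvPolynomial (Fin (g + 3)) ℂ) :
    resU a (toOW a p) = 0 ↔ p ∈ idealW a := by
  rw [resU_eq_zero_iff, mem_maximalIdeal_iff]

theorem isUnit_of_resU_ne_zero {r : OW a} (h : resU a r ≠ 0) : IsUnit r := by
  by_contra hr
  exact h ((resU_eq_zero_iff a r).mpr ((IsLocalRing.mem_maximalIdeal r).mpr hr))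

theorem resU_ell_zero : resU a (toOW a (ell a 0)) = 0 :=
  (resU_toOW_eq_zero_iff a _).mpr (Ideal.subset_span (ell_mem_W_zero a))

theorem resU_ell_one : resU a (toOW a (ell a 1)) = 0 :=
  (resU_toOW_eq_zero_iff a _).mpr (Ideal.subset_span (ell_mem_W_one a))

theorem resU_lU_ne_zero : resU a (lU a) ≠ 0 :=
  (isUnit_lU a |>.map (resU a)).ne_zero

/-! ### The embedding of `ℂ(q)` into `𝒪` -/

/-- Restriction to the affine chart `∑ᵢ aᵢ² fᵢ = 1` of `W^⊥`. -/
def chiU : MvPolynomial (Fin (g + 3)) ℂ →ₐ[ℂ] RatX g :=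
  aeval fun i => (genericMonic g).eval (algebraMap ℂ (RatX g) (a i))
    / algebraMap ℂ (RatX g) (nodeProd (⇑a) i)

theorem nodeProd_a_ne_zero (i : Fin (g + 3)) : nodeProd (⇑a) i ≠ 0 :=
  nodeProd_ne_zero a.injective i

theorem map_eraseProd {K : Type} [Field K] [Algebra ℂ K] (i : Fin (g + 3)) :
    (eraseProd (⇑a) i).map (algebraMap ℂ K) = eraseProd (fun j => algebraMap ℂ K (a j)) i := by
  simp [eraseProd, Polynomial.map_prod]

theorem algebraMap_nodeProd {K : Type} [Field K] [Algebra ℂ K] (i : Fin (g + 3)) :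
    algebraMap ℂ K (nodeProd (⇑a) i) = nodeProd (fun j => algebraMap ℂ K (a j)) i := by
  simp [nodeProd, map_prod]

theorem chiU_coefForm (j : ℕ) : chiU a (coefForm a j) = (genericMonic g).coeff j := by
  have hinj : Function.Injective fun j => algebraMap ℂ (RatX g) (a j) :=
    (algebraMap ℂ (RatX g)).injective.comp a.injective
  have h := sum_eraseProd_eq hinj (p := genericMonic g) (by
    rw [degree_genericMonic]; exact_mod_cast (by omega : g < g + 3))
  conv_rhs => rw [← h]
  rw [coefForm, map_sum, Polynomial.finsetSum_coeff]
  refine Finset.sum_congr rfl fun i _ => ?_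
  rw [map_mul, chiU, aeval_X, Polynomial.coeff_C_mul, ← map_eraseProd, Polynomial.coeff_map,
    algHom_C, ← algebraMap_nodeProd, mul_comm]

theorem chiU_ell : chiU a (ell a 0) = 0 ∧ chiU a (ell a 1) = 0 ∧ chiU a (ell a 2) = 1 := by
  have hd : (genericMonic g).natDegree = g := natDegree_monicOf _
  have h := ell_of_coefForm a (chiU a).toLinearMap
    (by change chiU a _ = 0
        rw [chiU_coefForm, Polynomial.coeff_eq_zero_of_natDegree_lt (by omega)])
    (by change chiU a _ = 0
        rw [chiU_coefForm, Polynomial.coeff_eq_zero_of_natDegree_lt (by omega)])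
  have hc : chiU a (coefForm a g) = 1 := by
    rw [chiU_coefForm]
    have := (genericMonic_monic (g := g)).coeff_natDegree
    rwa [hd] at this
  exact ⟨h.1, h.2.1, h.2.2.trans hc⟩

theorem chiU_eq_zero {p : MvPolynomial (Fin (g + 3)) ℂ} (hp : p ∈ idealW a) : chiU a p = 0 := by
  have h : idealW a ≤ RingHom.ker (chiU a) := idealW_le a (chiU_ell a).1 (chiU_ell a).2.1
  exact h hp

/-- A power of `ℓ₂` turns a polynomial in the `coefO a j` into an element of `S(V)`, and on the
chart `ℓ₂ = 1` that power becomes invisible. -/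
theorem exists_clear_denominators (p : MvPolynomial (Fin g) ℂ) :
    ∃ (N : ℕ) (H : MvPolynomial (Fin (g + 3)) ℂ),
      lU a ^ N * aeval (fun j : Fin g => coefO a j) p = toOW a H ∧
        chiU a H = algebraMap _ (RatX g) p := by
  have hl : chiU a (ell a 2) = 1 := (chiU_ell a).2.2
  induction p using MvPolynomial.induction_on with
  | C c => exact ⟨0, C c, by simp, by simp [IsScalarTower.algebraMap_apply ℂ (MvPolynomial (Fin g) ℂ) (RatX g)]⟩
  | add p q hp hq =>
    obtain ⟨N, H, h1, h2⟩ := hp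
    obtain ⟨N', H', h1', h2'⟩ := hq
    refine ⟨N + N', ell a 2 ^ N' * H + ell a 2 ^ N * H', ?_, ?_⟩
    · rw [map_add, map_add, map_mul, map_mul, map_pow, map_pow, ← h1, ← h1', lU]
      ring
    · rw [map_add, map_mul, map_mul, map_pow, map_pow, hl, h2, h2', map_add]
      simp
  | mul_X p j hp =>
    obtain ⟨N, H, h1, h2⟩ := hp
    refine ⟨N + 1, H * coefForm a j, ?_, ?_⟩
    · rw [map_mul, aeval_X, map_mul, ← h1, ← lU_mul_coefO]
      ring
    · rw [map_mul, h2, chiU_coefForm, map_mul, genericMonic, coeff_monicOf]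
      rfl

/-- If the value were zero modulo `W`, then `chiU`, which kills `W`, would give `p = 0`. Thus the
`coefO a j` are algebraically independent modulo `W`, and `ℂ(q)` embeds into `𝒪`. -/
theorem isUnit_aeval_coefO {p : MvPolynomial (Fin g) ℂ} (hp : p ≠ 0) :
    IsUnit (aeval (fun j : Fin g => coefO a j) p) := by
  apply isUnit_of_resU_ne_zero
  intro h0
  obtain ⟨N, H, h1, h2⟩ := exists_clear_denominators a p
  have h3 : resU a (toOW a H) = 0 := by rw [← h1, map_mul, h0, mul_zero]
  rw [resU_toOW_eq_zero_iff] at h3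
  rw [chiU_eq_zero a h3] at h2
  apply hp
  exact (map_eq_zero_iff _ (IsFractionRing.injective (MvPolynomial (Fin g) ℂ) (RatX g))).mp h2.symm

/-- The embedding `ℂ(q) → 𝒪` that takes `qⱼ` to the quotient of `coefForm j` by
`∑ᵢ aᵢ² fᵢ`. -/
def secU : RatX g →ₐ[ℂ] OW a :=
  IsLocalization.liftAlgHom (M := nonZeroDivisors (MvPolynomial (Fin g) ℂ))
    (f := aeval fun j : Fin g => coefO a j)
    (fun y => isUnit_aeval_coefO a (nonZeroDivisors.ne_zero y.2))

theorem secU_algebraMap (p : MvPolynomial (Fin g) ℂ) :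
    secU a (algebraMap _ (RatX g) p) = aeval (fun j : Fin g => coefO a j) p := by
  simp [secU]

theorem secU_xvar (j : Fin g) : secU a (xvar j) = coefO a j := by
  rw [xvar, secU_algebraMap, aeval_X]

theorem resU_secU_injective : Function.Injective fun e => resU a (secU a e) :=
  ((resU a).comp (secU a) : RatX g →+* FW a).injective

theorem inv_mem_homog {r r' : OW a} (h : r * r' = 1) (hr : r ∈ homog a 0) : r' ∈ homog a 0 := by
  obtain ⟨p, q, m, n, hp, hq, hqI, hd, e⟩ := hr
  refine ⟨q, p, n, m, hq, hp, ?_, by omega, ?_⟩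
  · intro hpI
    have h1 : IsUnit (toOW a p) := by
      rw [← e]
      exact (IsUnit.of_mul_eq_one _ h).mul (isUnit_toOW a hqI)
    exact ((IsLocalRing.mem_maximalIdeal _).mp ((mem_maximalIdeal_iff a p).mpr hpI)) h1
  · rw [← e, ← mul_assoc, mul_comm r', h, one_mul]

theorem aeval_coefO_mem (p : MvPolynomial (Fin g) ℂ) :
    aeval (fun j : Fin g => coefO a j) p ∈ homog a 0 := by
  induction p using MvPolynomial.induction_on with
  | C c =>
    rw [algHom_C, Algebra.algebraMap_eq_smul_one]
    exact Submodule.smul_mem _ _ (one_mem_homog a)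
  | add p q hp hq => rw [map_add]; exact add_mem hp hq
  | mul_X p j hp =>
    rw [map_mul, aeval_X]
    simpa using homog_mul a 0 0 _ _ hp (coefO_mem a j)

theorem secU_mem (e : RatX g) : secU a e ∈ homog a 0 := by
  obtain ⟨p, q, hq, rfl⟩ := IsFractionRing.div_surjective (A := MvPolynomial (Fin g) ℂ) e
  have hqK : algebraMap _ (RatX g) q ≠ 0 := by simpa using nonZeroDivisors.ne_zero hq
  have h : secU a (algebraMap _ (RatX g) q)⁻¹ ∈ homog a 0 := by
    refine inv_mem_homog a (r := secU a (algebraMap _ (RatX g) q)) ?_ ?_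
    · rw [← map_mul, mul_inv_cancel₀ hqK, map_one]
    · rw [secU_algebraMap]; exact aeval_coefO_mem a q
  rw [div_eq_mul_inv, map_mul, secU_algebraMap]
  simpa using homog_mul a 0 0 _ _ (aeval_coefO_mem a p) h

theorem secU_genericMonic_eval (b : ℂ) :
    lU a * secU a ((genericMonic g).eval (algebraMap ℂ (RatX g) b))
      = algebraMap ℂ (OW a) (b ^ g) * lU a
        + ∑ j ∈ Finset.range g, algebraMap ℂ (OW a) (b ^ j) * toOW a (coefForm a j) := by
  rw [genericMonic, eval_monicOf, map_add, map_sum, mul_add, ← map_pow, AlgHom.commutes,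
    mul_comm (lU a), Finset.mul_sum,
    ← Fin.sum_univ_eq_sum_range (fun j => algebraMap ℂ (OW a) (b ^ j) * toOW a (coefForm a j))]
  congr 1
  refine Finset.sum_congr rfl fun j _ => ?_
  rw [map_mul, secU_xvar, ← map_pow, AlgHom.commutes, ← mul_assoc, lU_mul_coefO, mul_comm]

/-! ### Homogeneous functions modulo `W` -/

theorem resU_coefForm_top : resU a (toOW a (coefForm a (g + 2))) = 0 := by
  rw [coefForm_top, resU_ell_zero]

theorem resU_coefForm_top_sub_one : resU a (toOW a (coefForm a (g + 1))) = 0 := by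
  rw [coefForm_top_sub_one, map_add, map_mul, map_add, map_mul, resU_ell_zero, resU_ell_one]
  simp

theorem resU_coefForm_middle : resU a (toOW a (coefForm a g)) = resU a (lU a) := by
  rw [coefForm_middle]
  simp only [map_add, map_mul, resU_ell_zero, resU_ell_one, mul_zero, zero_add]
  rfl

/-- Modulo `W` the polynomial `P_f` is `ℓ₂ Q`; evaluate at `aᵢ` and divide by `Π'(aᵢ)`. -/
theorem resU_X (i : Fin (g + 3)) :
    resU a (toOW a (X i)) = resU a (lU a) * resU a (secU a (chiU a (X i))) := by
  have hn : algebraMap ℂ (RatX g) (nodeProd (⇑a) i) ≠ 0 := by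
    simpa using nodeProd_a_ne_zero a i
  have h1 : lU a * secU a (chiU a (X i)) * algebraMap ℂ (OW a) (nodeProd (⇑a) i)
      = lU a * secU a ((genericMonic g).eval (algebraMap ℂ (RatX g) (a i))) := by
    rw [← AlgHom.commutes (secU a), mul_assoc, ← map_mul, chiU, aeval_X, div_mul_cancel₀ _ hn]
  have h2 := congrArg (toOW a) (sum_coefForm_mul_pow a i)
  have hC : ∀ c : ℂ, toOW a (C c) = algebraMap ℂ (OW a) c := fun c => (toOW a).commutes c
  rw [Finset.sum_range_succ, Finset.sum_range_succ, Finset.sum_range_succ, map_add, map_add,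
    map_add, map_sum] at h2
  simp only [map_mul, hC] at h2
  have h3 := congrArg (resU a) h2
  have h4 := congrArg (resU a) h1
  rw [secU_genericMonic_eval] at h4
  simp only [map_add, map_mul, resU_coefForm_top, resU_coefForm_top_sub_one, resU_coefForm_middle,
    mul_zero, add_zero] at h3 h4
  have hn' : resU a (algebraMap ℂ (OW a) (nodeProd (⇑a) i)) ≠ 0 := by
    rw [AlgHom.commutes]
    simpa using nodeProd_a_ne_zero a i
  apply mul_left_cancel₀ hn'
  rw [← h3, mul_comm (resU a (algebraMap ℂ (OW a) (nodeProd (⇑a) i))), h4, add_comm]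

theorem aeval_mul_of_isHomogeneous {ι K : Type} [CommRing K] [Algebra ℂ K] {m : ℕ}
    {p : MvPolynomial ι ℂ} (hp : p.IsHomogeneous m) (l : K) (y : ι → K) :
    aeval (fun i => l * y i) p = l ^ m * aeval y p := by
  conv_lhs => rw [p.as_sum, map_sum]
  conv_rhs => rw [p.as_sum, map_sum, Finset.mul_sum]
  refine Finset.sum_congr rfl fun d hd => ?_
  have hdeg : d.sum (fun _ k => k) = m := by
    have := hp (mem_support_iff.mp hd)
    rwa [Finsupp.weight_apply, Finsupp.sum_congr (g2 := fun _ k => k)] at this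
    intro i _
    simp
  rw [aeval_monomial, aeval_monomial]
  have e : (d.prod fun i k => (l * y i) ^ k) = l ^ m * d.prod fun i k => y i ^ k := by
    simp only [mul_pow]
    rw [Finsupp.prod_mul]
    congr 1
    rw [← hdeg, Finsupp.sum, Finsupp.prod, Finset.prod_pow_eq_pow_sum]
  rw [e]
  ring

theorem resU_toOW_of_isHomogeneous {p : MvPolynomial (Fin (g + 3)) ℂ} {m : ℕ}
    (hp : p.IsHomogeneous m) :
    resU a (toOW a p) = resU a (lU a) ^ m * resU a (secU a (chiU a p)) := by
  have h1 : resU a (toOW a p) = aeval (fun i => resU a (lU a) * resU a (secU a (chiU a (X i)))) p := by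
    have : (resU a).comp (toOW a)
        = aeval fun i => resU a (lU a) * resU a (secU a (chiU a (X i))) :=
      algHom_ext fun i => by rw [AlgHom.comp_apply, aeval_X, resU_X]
    exact congrArg (fun f => f p) this
  have h2 : resU a (secU a (chiU a p)) = aeval (fun i => resU a (secU a (chiU a (X i)))) p := by
    have : ((resU a).comp (secU a)).comp (chiU a)
        = aeval fun i => resU a (secU a (chiU a (X i))) :=
      algHom_ext fun i => by rw [aeval_X]; rfl
    exact congrArg (fun f => f p) this
  rw [h1, h2, aeval_mul_of_isHomogeneous hp]

/-- Every homogeneous element of degree `0` of `𝒪` is congruent to an element of `ℂ(q)`. -/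
theorem exists_resU_secU_eq {r : OW a} (hr : r ∈ homog a 0) :
    ∃ e, resU a (secU a e) = resU a r := by
  obtain ⟨p, q, m, n, hp, hq, hqI, hd, e⟩ := hr
  have hmn : m = n := by omega
  subst hmn
  have hq0 : resU a (toOW a q) ≠ 0 := fun h => hqI ((resU_toOW_eq_zero_iff a q).mp h)
  have hl := pow_ne_zero m (resU_lU_ne_zero a)
  rw [resU_toOW_of_isHomogeneous a hq] at hq0
  have hc : chiU a q ≠ 0 := by
    intro h
    rw [h, map_zero, map_zero, mul_zero] at hq0
    exact hq0 rfl
  -- Numerator and denominator have the same degree, so passing from the chart `ℓ₂ = 1` back to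
  -- `V/W` multiplies both by the same power of `ℓ₂`.
  refine ⟨chiU a p / chiU a q, ?_⟩
  have h2 := congrArg (resU a) e
  rw [map_mul, resU_toOW_of_isHomogeneous a hq, resU_toOW_of_isHomogeneous a hp] at h2
  have h3 : resU a (secU a (chiU a p / chiU a q)) * resU a (secU a (chiU a q))
      = resU a (secU a (chiU a p)) := by
    rw [← map_mul, ← map_mul, div_mul_cancel₀ _ hc]
  apply mul_right_cancel₀ hq0
  rw [h2, ← h3]
  ring

/-! ### The coordinate vector fields on the `𝒰` side -/

theorem derU_X (i k : Fin (g + 3)) : derU a i (toOW a (X k)) = if i = k then 1 else 0 := by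
  rw [derU_toOW, pderiv_X, Pi.single_apply]
  split_ifs with h h' h'
  · simp
  · exact absurd h.symm h'
  · exact absurd h'.symm h
  · simp

theorem derU_comm (i j : Fin (g + 3)) (r : OW a) :
    derU a i (derU a j r) = derU a j (derU a i r) := by
  refine derivation_comm (idealW a).primeCompl _ _ (fun k => ?_) r
  change derU a i (derU a j (toOW a (X k))) = derU a j (derU a i (toOW a (X k)))
  rw [derU_X, derU_X]
  split_ifs <;> simp

theorem derU_linear (i : Fin (g + 3)) (c : Fin (g + 3) → ℂ) :
    derU a i (toOW a (∑ k, C (c k) * X k)) = algebraMap ℂ (OW a) (c i) := by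
  rw [map_sum, map_sum, Finset.sum_eq_single i]
  · rw [← smul_eq_C_mul, map_smul, Derivation.map_smul, derU_X, if_pos rfl,
      Algebra.algebraMap_eq_smul_one]
  · intro k _ hk
    rw [← smul_eq_C_mul, map_smul, Derivation.map_smul, derU_X, if_neg (Ne.symm hk), smul_zero]
  · simp

theorem derU_ell (i : Fin (g + 3)) (k : ℕ) :
    derU a i (toOW a (ell a k)) = algebraMap ℂ (OW a) (a i ^ k) := derU_linear a i _

/-- The coefficients of the vector field `∂/∂qₘ` in terms of the `fᵢ*`. -/
def coeffU (m : Fin g) (i : Fin (g + 3)) : OW a :=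
  lU a * algebraMap ℂ (OW a) (a i ^ (m : ℕ) / nodeProd (⇑a) i)

/-- The derivation `∂/∂qₘ` of `𝒪`. -/
def derQU (m : Fin g) : Derivation ℂ (OW a) (OW a) := ∑ i, coeffU a m i • derU a i

theorem derQU_apply (m : Fin g) (r : OW a) : derQU a m r = ∑ i, coeffU a m i * derU a i r := by
  simp only [derQU, ← Derivation.coeFnAddMonoidHom_apply, map_sum, Finset.sum_apply]
  rfl

/-- Lagrange interpolation of `X^m` at the `aᵢ`: the weights `aᵢᵐ / Π'(aᵢ)` of `coeffU` pair with
the coefficients of `P_f` as a dual basis. -/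
theorem derQU_coefForm (m : Fin g) (j : ℕ) :
    derQU a m (toOW a (coefForm a j)) = if j = m then lU a else 0 := by
  have h := sum_eraseProd_eq a.injective (p := (Polynomial.X ^ (m : ℕ) : Polynomial ℂ)) (by
    rw [Polynomial.degree_X_pow]; exact_mod_cast (by have := m.2; omega : (m : ℕ) < g + 3))
  have h2 := congrArg (fun p => Polynomial.coeff p j) h
  simp only [Polynomial.finsetSum_coeff, Polynomial.coeff_C_mul, Polynomial.coeff_X_pow,
    Polynomial.eval_pow, Polynomial.eval_X] at h2
  rw [derQU_apply]
  simp only [coefForm, derU_linear, coeffU, mul_assoc, ← map_mul, ← Finset.mul_sum, ← map_sum]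
  rw [h2]
  split_ifs <;> simp

/-- `ℓ₀`, `ℓ₁`, `ℓ₂` are controlled by the coefficients of `P_f` of index `g + 2`, `g + 1`, `g`, and
`m < g`. So these fields normalize `W` and treat `ℓ₂` as a constant. -/
theorem derQU_ell (m : Fin g) : derQU a m (toOW a (ell a 0)) = 0 ∧
    derQU a m (toOW a (ell a 1)) = 0 ∧ derQU a m (lU a) = 0 := by
  have hm := m.2
  have h := ell_of_coefForm a ((derQU a m).toLinearMap.comp (toOW a).toLinearMap)
    (by change derQU a m (toOW a (coefForm a (g + 2))) = 0
        rw [derQU_coefForm, if_neg (by omega)])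
    (by change derQU a m (toOW a (coefForm a (g + 1))) = 0
        rw [derQU_coefForm, if_neg (by omega)])
  refine ⟨h.1, h.2.1, h.2.2.trans ?_⟩
  change derQU a m (toOW a (coefForm a g)) = 0
  rw [derQU_coefForm, if_neg (by omega)]

theorem derQU_coefO (m : Fin g) (j : ℕ) : derQU a m (coefO a j) = if j = m then 1 else 0 := by
  have h := congrArg (derQU a m) (lU_mul_coefO a j)
  rw [Derivation.leibniz, (derQU_ell a m).2.2, smul_zero, add_zero, derQU_coefForm,
    smul_eq_mul] at h
  apply (isUnit_lU a).mul_left_cancel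
  rw [h]
  split_ifs <;> simp

theorem derQU_secU (m : Fin g) (r : RatX g) : derQU a m (secU a r) = secU a (derE g m r) := by
  have := twistedDerivation_eq_zero (nonZeroDivisors (MvPolynomial (Fin g) ℂ)) (secU a)
    ((derQU a m).toLinearMap.comp (secU a).toLinearMap
      - (secU a).toLinearMap.comp (derE g m).toLinearMap)
    (fun x y => by
      change derQU a m (secU a (x * y)) - secU a (derE g m (x * y))
        = secU a x * (derQU a m (secU a y) - secU a (derE g m y))
          + secU a y * (derQU a m (secU a x) - secU a (derE g m x))
      simp only [map_mul, Derivation.leibniz, map_add, smul_eq_mul]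
      ring)
    (fun i => by
      change derQU a m (secU a (xvar i)) - secU a (derE g m (xvar i)) = 0
      rw [secU_xvar, derQU_coefO, derE_xvar]
      by_cases h : m = i
      · simp [h]
      · rw [if_neg (fun h' => h (Fin.ext h'.symm)), if_neg h, map_zero, sub_zero]) r
  exact sub_eq_zero.mp this

theorem derivationChangeU : DerivationChange (derE g) (derU a) (secU a) (coeffU a) where
  extend m r := by rw [← derQU_apply, derQU_secU]
  comm m l i := by
    -- The coefficients are complex multiples of `ℓ₂`, which every `derQU a m` kills; both sides of
    -- the commutation identity are zero.
    have h : ∀ m l, derQU a m (coeffU a l i) = 0 := by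
      intro m l
      rw [coeffU, Derivation.leibniz, (derQU_ell a m).2.2, Derivation.map_algebraMap]
      simp
    rw [← derQU_apply, ← derQU_apply, h, h]

/-! ### Homogeneous elements of the maximal ideal -/

theorem homogeneousComponent_linear_mul {R ι : Type} [CommRing R] {l : MvPolynomial ι R}
    (hl : l.IsHomogeneous 1) (k : ℕ) (p : MvPolynomial ι R) :
    homogeneousComponent (k + 1) (l * p) = l * homogeneousComponent k p := by
  conv_lhs => rw [← sum_homogeneousComponent p, Finset.mul_sum, map_sum]
  have h : ∀ i, homogeneousComponent (k + 1) (l * homogeneousComponent i p)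
      = if i = k then l * homogeneousComponent k p else 0 := by
    intro i
    have hi := hl.mul (homogeneousComponent_isHomogeneous i p)
    split_ifs with hik
    · subst hik
      exact homogeneousComponent_of_mem hi |>.trans (if_pos (add_comm _ _))
    · exact homogeneousComponent_of_mem hi |>.trans (if_neg (by omega))
  simp only [h]
  rw [Finset.sum_ite_eq']
  split_ifs with hk
  · rfl
  · rw [homogeneousComponent_eq_zero _ _ (by simpa using hk), mul_zero]

theorem homog_of_mul_eq {d : ℤ} {r : OW a} {p q : MvPolynomial (Fin (g + 3)) ℂ} {m n : ℕ}
    (hp : p.IsHomogeneous m) (hq : q.IsHomogeneous n) (hqI : q ∈ (idealW a).primeCompl)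
    (hd : (m : ℤ) - n = d) (h : r * toOW a q = toOW a p) : r ∈ homog a d :=
  ⟨p, q, m, n, hp, hq, hqI, hd, h⟩

/-- A homogeneous element of the maximal ideal is a combination of `W` with homogeneous
coefficients. -/
theorem exists_homog_of_resU_eq_zero {d : ℤ} {r : OW a} (hr : r ∈ homog a d)
    (h0 : resU a r = 0) : ∃ r0 ∈ homog a (d - 1), ∃ r1 ∈ homog a (d - 1),
      r = toOW a (ell a 0) * r0 + toOW a (ell a 1) * r1 := by
  obtain ⟨p, q, m, n, hp, hq, hqI, hd, e⟩ := hr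
  have hpI : p ∈ idealW a := by
    rw [← resU_toOW_eq_zero_iff, ← e, map_mul, h0, zero_mul]
  have hspan : idealW a = Ideal.span {ell a 0, ell a 1} := by
    apply le_antisymm
    · exact idealW_le a (Ideal.subset_span (by simp)) (Ideal.subset_span (by simp))
    · rw [Ideal.span_le]
      rintro x (rfl | rfl)
      · exact Ideal.subset_span (ell_mem_W_zero a)
      · exact Ideal.subset_span (ell_mem_W_one a)
  rw [hspan, Ideal.mem_span_pair] at hpI
  obtain ⟨p0, p1, hpp⟩ := hpI
  obtain ⟨u, hu⟩ := isUnit_toOW a hqI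
  have huq : (↑u⁻¹ : OW a) * toOW a q = 1 := by rw [← hu]; exact u.inv_mul
  -- A numerator of degree `0` is a constant lying in an ideal generated by linear forms, hence
  -- zero. In positive degree the homogeneous parts of the cofactors are taken.
  cases m with
  | zero =>
    have hp0 : p = 0 := by
      have hhc : homogeneousComponent 0 p = p :=
        (homogeneousComponent_of_mem hp).trans (if_pos rfl)
      rw [← hhc, homogeneousComponent_zero, ← hpp]
      have hc : ∀ k, coeff 0 (ell a k) = 0 := by
        intro k
        rw [ell, coeff_sum]
        exact Finset.sum_eq_zero fun i _ => by
          rw [coeff_C_mul, coeff_zero_X, mul_zero]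
      rw [coeff_add, ← constantCoeff_eq, map_mul, map_mul, constantCoeff_eq, hc, hc]
      simp
    have hr0 : r = 0 := by
      rw [hp0, map_zero, ← hu] at e
      exact (Units.mul_left_eq_zero u).mp e
    exact ⟨0, zero_mem _, 0, zero_mem _, by rw [hr0]; simp⟩
  | succ m =>
    have hhc : homogeneousComponent (m + 1) p = p :=
      (homogeneousComponent_of_mem hp).trans (if_pos rfl)
    have hp' : p = ell a 0 * homogeneousComponent m p0 + ell a 1 * homogeneousComponent m p1 := by
      rw [← homogeneousComponent_linear_mul (ell_isHomogeneous a 0),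
        ← homogeneousComponent_linear_mul (ell_isHomogeneous a 1), ← map_add, mul_comm (ell a 0),
        mul_comm (ell a 1), hpp, hhc]
    have hmem : ∀ p', ↑u⁻¹ * toOW a (homogeneousComponent m p') ∈ homog a (d - 1) := by
      intro p'
      refine homog_of_mul_eq a (homogeneousComponent_isHomogeneous m p') hq hqI ?_ ?_
      · push_cast at hd; omega
      · rw [mul_right_comm, huq, one_mul]
    refine ⟨_, hmem p0, _, hmem p1, ?_⟩
    have hr' : r = ↑u⁻¹ * toOW a p := by rw [← e, mul_left_comm, huq, mul_one]
    rw [hr', hp', map_add, map_mul, map_mul]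
    ring

/-- Euler's identity. -/
theorem euler_homog {d : ℤ} {r : OW a} (hr : r ∈ homog a d) :
    ∑ i, toOW a (X i) * derU a i r = d • r := by
  obtain ⟨p, q, m, n, hp, hq, hqI, hd, e⟩ := hr
  have hE : ∀ {p : MvPolynomial (Fin (g + 3)) ℂ} {m : ℕ}, p.IsHomogeneous m →
      ∑ i, toOW a (X i) * derU a i (toOW a p) = (m : OW a) * toOW a p := by
    intro p m hp
    have := congrArg (toOW a) hp.sum_X_mul_pderiv
    rw [map_sum] at this
    simp only [map_mul, nsmul_eq_mul, map_natCast] at this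
    simp only [derU_toOW]
    exact this
  have hP := hE hp
  rw [← e] at hP
  simp only [Derivation.leibniz, smul_eq_mul, mul_add, Finset.sum_add_distrib] at hP
  have e1 : ∑ i, toOW a (X i) * (r * derU a i (toOW a q)) = r * ((n : OW a) * toOW a q) := by
    rw [← hE hq, Finset.mul_sum]
    exact Finset.sum_congr rfl fun i _ => by ring
  have e2 : ∑ i, toOW a (X i) * (toOW a q * derU a i r)
      = toOW a q * ∑ i, toOW a (X i) * derU a i r := by
    rw [Finset.mul_sum]
    exact Finset.sum_congr rfl fun i _ => by ring
  rw [e1, e2] at hP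
  apply (isUnit_toOW a hqI).mul_left_cancel
  rw [← hd, zsmul_eq_mul]
  push_cast
  linear_combination hP

end UBasics

end

noncomputable section

open MvPolynomial

/-! ### Constant coefficient derivations -/

section Directional

variable {R ι : Type} [CommRing R] [Algebra ℂ R] [Fintype ι] [DecidableEq ι]

/-- The derivation `∑ᵢ cᵢ ∂/∂ξᵢ` of `R[ξ]`. -/
def dirD (R : Type) [CommRing R] [Algebra ℂ R] (c : ι → ℂ) :
    Derivation R (MvPolynomial ι R) (MvPolynomial ι R) :=
  mkDerivation R fun i => C (algebraMap ℂ R (c i))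

theorem dirD_apply (c : ι → ℂ) (p : MvPolynomial ι R) : dirD R c p = ∑ i, c i • pderiv i p := by
  induction p using MvPolynomial.induction_on with
  | C r => simp [dirD]
  | add p q hp hq => rw [map_add, hp, hq, ← Finset.sum_add_distrib]; simp
  | mul_X p i hp =>
    have h : ∀ j, c j • pderiv j (p * X i) = X i * (c j • pderiv j p) + c j • (p * pderiv j (X i)) := by
      intro j
      rw [Derivation.leibniz, smul_eq_mul, smul_eq_mul, smul_add, mul_smul_comm, add_comm]
    have hX : dirD R c (X i) = C (algebraMap ℂ R (c i)) := mkDerivation_X _ _ _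
    simp only [h, Finset.sum_add_distrib, ← Finset.mul_sum, ← hp]
    rw [Derivation.leibniz, smul_eq_mul, smul_eq_mul, hX, add_comm, Finset.sum_eq_single i]
    · rw [pderiv_X_self, mul_one, Algebra.smul_def, mul_comm p]
      rfl
    · intro j _ hj
      rw [pderiv_X_of_ne (Ne.symm hj), mul_zero, smul_zero]
    · simp

theorem dirD_eq_sum_C_mul (c : ι → ℂ) (p : MvPolynomial ι R) :
    dirD R c p = ∑ i, C (algebraMap ℂ R (c i)) * pderiv i p := by
  rw [dirD_apply]
  exact Finset.sum_congr rfl fun i _ => Algebra.smul_def _ _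

theorem map_dirD {R' : Type} [CommRing R'] [Algebra ℂ R'] (f : R →ₐ[ℂ] R') (c : ι → ℂ)
    (p : MvPolynomial ι R) : mapAlgHom f (dirD R c p) = dirD R' c (mapAlgHom f p) := by
  simp only [dirD_apply, map_sum, map_smul]
  exact Finset.sum_congr rfl fun i _ => congrArg _ (pderiv_map (φ := (f : R →+* R'))).symm

theorem dirD_linForm (c : ι → ℂ) (v : ι → R) :
    dirD R c (linForm v) = C (∑ i, algebraMap ℂ R (c i) * v i) := by
  rw [dirD_eq_sum_C_mul, map_sum]
  exact Finset.sum_congr rfl fun i _ => by rw [pderiv_linForm, map_mul]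

theorem dirD_coeffD (c : ι → ℂ) (D : Derivation ℂ R R) (p : MvPolynomial ι R) :
    dirD R c (coeffD D p) = coeffD D (dirD R c p) := by
  simp only [dirD_apply, map_sum, map_smul, pderiv_coeffD]

theorem dirD_pderiv (c : ι → ℂ) (i : ι) (p : MvPolynomial ι R) :
    dirD R c (pderiv i p) = pderiv i (dirD R c p) := by
  have h : (⁅dirD R c, (pderiv i : Derivation R (MvPolynomial ι R) (MvPolynomial ι R))⁆ :
      Derivation R (MvPolynomial ι R) (MvPolynomial ι R)) = 0 := by
    apply MvPolynomial.derivation_ext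
    intro j
    rw [Derivation.commutator_apply, dirD, mkDerivation_X, pderiv_C, pderiv_X, Pi.single_apply]
    split_ifs <;> simp
  have h2 := congrArg (fun D : Derivation R (MvPolynomial ι R) (MvPolynomial ι R) => D p) h
  simp only [Derivation.commutator_apply] at h2
  exact sub_eq_zero.mp h2

theorem dirD_bracket (δ : ι → Derivation ℂ R R) (c : ι → ℂ) (p q : MvPolynomial ι R) :
    dirD R c (bracket δ p q) = bracket δ (dirD R c p) q + bracket δ p (dirD R c q) := by
  simp only [bracket, map_sum, map_sub, Derivation.leibniz, smul_eq_mul, dirD_coeffD, dirD_pderiv,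
    ← Finset.sum_add_distrib]
  exact Finset.sum_congr rfl fun i _ => by ring

theorem dirD_homogeneousComponent_succ (c : ι → ℂ) (k : ℕ) (p : MvPolynomial ι R) :
    dirD R c (homogeneousComponent (k + 1) p) = homogeneousComponent k (dirD R c p) := by
  ext m
  simp only [dirD_apply, coeff_sum, coeff_homogeneousComponent, coeff_smul, coeff_pderiv, map_add,
    Finsupp.degree_single]
  split_ifs with h h' h'
  · rfl
  · omega
  · omega
  · simp

theorem dirD_homogeneousComponent_zero (c : ι → ℂ) (p : MvPolynomial ι R) :
    dirD R c (homogeneousComponent 0 p) = 0 := by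
  rw [homogeneousComponent_zero, dirD_apply]
  simp

end Directional

section UClassical

variable {g : ℕ} (a : Fin (g + 3) ↪ ℂ)

/-! ### The graded pieces of `𝒪 ⊗ S(V*)` and reduction modulo `W` -/

theorem BWdeg_monomial {d : ℤ} {r : OW a} (m : Fin (g + 3) →₀ ℕ) (hr : r ∈ homog a (d + m.degree)) :
    (monomial m r : BW a) ∈ BWdeg a d := by
  classical
  intro k
  rw [coeff_monomial]
  split_ifs with h
  · rw [← h]; exact hr
  · exact zero_mem _

/-- Induction on the elements of a given degree of `𝒪 ⊗ S(V*)`. -/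
theorem BWdeg_induction {P : ℤ → BW a → Prop} (hC : ∀ d, ∀ r ∈ homog a d, P d (C r))
    (hadd : ∀ d p q, P d p → P d q → P d (p + q))
    (hX : ∀ d p i, p ∈ BWdeg a d → P d p → P (d - 1) (p * X i)) {d : ℤ} {p : BW a}
    (hp : p ∈ BWdeg a d) : P d p := by
  have hmon : ∀ n : ℕ, ∀ m : Fin (g + 3) →₀ ℕ, m.degree = n → ∀ d r, r ∈ homog a (d + m.degree) →
      P d (monomial m r) := by
    intro n
    induction n with
    | zero =>
      intro m hm d r hr
      rw [Finsupp.degree_eq_zero_iff] at hm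
      subst hm
      exact hC d r (by simpa using hr)
    | succ n ih =>
      intro m hm d r hr
      have hm0 : m ≠ 0 := by
        rintro rfl
        simp at hm
      obtain ⟨i, hi⟩ := Finsupp.ne_iff.mp hm0
      have hle : Finsupp.single i 1 ≤ m := by
        rw [Finsupp.single_le_iff]
        exact Nat.one_le_iff_ne_zero.mpr hi
      obtain ⟨m', rfl⟩ := exists_add_of_le hle
      rw [map_add, Finsupp.degree_single] at hm
      have e : (monomial (Finsupp.single i 1 + m') r : BW a) = monomial m' r * X i := by
        rw [X, monomial_mul, mul_one, add_comm m']
      have hr' : r ∈ homog a (d + 1 + m'.degree) := by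
        rw [map_add, Finsupp.degree_single] at hr
        convert hr using 1
        push_cast
        ring_nf
      have := hX (d + 1) _ i (BWdeg_monomial a m' hr') (ih m' (by omega) (d + 1) r hr')
      rw [e]
      simpa using this
  have h0 : ∀ d, P d 0 := fun d => by simpa using hC d 0 (zero_mem _)
  rw [p.as_sum]
  exact Finset.sum_induction _ (P d) (hadd d) (h0 d) fun m _ => hmon _ m rfl d _ (hp m)

theorem natCast_mul_mem_homog {d : ℤ} {r : OW a} (hr : r ∈ homog a d) (n : ℕ) :
    r * (n : OW a) ∈ homog a d := by
  rw [mul_comm, ← nsmul_eq_mul]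
  exact nsmul_mem hr n

theorem pderiv_mem_BWdeg (i : Fin (g + 3)) {d : ℤ} {p : BW a} (hp : p ∈ BWdeg a d) :
    pderiv i p ∈ BWdeg a (d + 1) := by
  intro m
  rw [coeff_pderiv]
  have h := hp (m + Finsupp.single i 1)
  rw [map_add, Finsupp.degree_single] at h
  have h2 := natCast_mul_mem_homog a h (m i + 1)
  push_cast at h2
  convert h2 using 1
  ring_nf

theorem coeffD_mem_BWdeg (i : Fin (g + 3)) {d : ℤ} {p : BW a} (hp : p ∈ BWdeg a d) :
    coeffD (derU a i) p ∈ BWdeg a (d - 1) := by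
  intro m
  rw [coeff_coeffD]
  convert derU_homog a i _ _ (hp m) using 1
  ring_nf

theorem bracket_mem_BWdeg {d e : ℤ} {p q : BW a} (hp : p ∈ BWdeg a d) (hq : q ∈ BWdeg a e) :
    bracket (derU a) p q ∈ BWdeg a (d + e) := by
  refine Submodule.sum_mem _ fun i _ => sub_mem ?_ ?_
  · convert BWdeg_mul a (pderiv_mem_BWdeg a i hp) (coeffD_mem_BWdeg a i hq) using 1
    ring_nf
  · convert BWdeg_mul a (coeffD_mem_BWdeg a i hp) (pderiv_mem_BWdeg a i hq) using 1
    ring_nf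

theorem dirD_mem_BWdeg (c : Fin (g + 3) → ℂ) {d : ℤ} {p : BW a} (hp : p ∈ BWdeg a d) :
    dirD (OW a) c p ∈ BWdeg a (d + 1) := by
  rw [dirD_apply]
  exact Submodule.sum_mem _ fun i _ => Submodule.smul_mem _ _ (pderiv_mem_BWdeg a i hp)

theorem homogeneousComponent_mem_BWdeg (k : ℕ) {d : ℤ} {p : BW a} (hp : p ∈ BWdeg a d) :
    homogeneousComponent k p ∈ BWdeg a d := by
  intro m
  rw [coeff_homogeneousComponent]
  split_ifs
  · exact hp m
  · exact zero_mem _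

theorem linForm_mem_BWdeg {d : ℤ} {v : Fin (g + 3) → OW a} (hv : ∀ i, v i ∈ homog a (d + 1)) :
    linForm v ∈ BWdeg a d := by
  refine Submodule.sum_mem _ fun i _ => ?_
  convert BWdeg_mul a (clPiece_C (hv i)) (clPiece_X (one_mem_homog a) i) using 1
  ring_nf

/-- Reduction modulo `W`. -/
def redU : BW a →ₐ[ℂ] MvPolynomial (Fin (g + 3)) (FW a) := mapAlgHom (resU a)

theorem redU_C (r : OW a) : redU a (C r) = C (resU a r) := map_C _ _

theorem redU_X (i : Fin (g + 3)) : redU a (X i) = X i := map_X _ _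

theorem coeff_redU (p : BW a) (m : Fin (g + 3) →₀ ℕ) : (redU a p).coeff m = resU a (p.coeff m) :=
  coeff_map _ _ _

theorem redU_linForm (v : Fin (g + 3) → OW a) :
    redU a (linForm v) = linForm fun i => resU a (v i) := by
  simp only [linForm, map_sum, map_mul, redU_C, redU_X]

theorem redU_dirD (c : Fin (g + 3) → ℂ) (p : BW a) :
    redU a (dirD (OW a) c p) = dirD (FW a) c (redU a p) := map_dirD _ _ _

theorem redU_homogeneousComponent (k : ℕ) (p : BW a) :
    redU a (homogeneousComponent k p) = homogeneousComponent k (redU a p) := by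
  ext m
  rw [coeff_redU, coeff_homogeneousComponent, coeff_homogeneousComponent, coeff_redU]
  split_ifs <;> simp

theorem C_toOW_mem_WC {w : MvPolynomial (Fin (g + 3)) ℂ} (hw : w ∈ W a) :
    (C (toOW a w) : BW a) ∈ WC a := ⟨w, hw, rfl⟩

theorem redU_eq_zero_of_mem {d : ℤ} {z : BW a} (hz : z ∈ WC a * BWdeg a d) : redU a z = 0 := by
  induction hz using Submodule.mul_induction_on' with
  | mem_mul_mem w hw b _ =>
    obtain ⟨w, hw, rfl⟩ := hw
    have h : redU a (C (toOW a w)) = 0 := by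
      rw [redU_C, (resU_toOW_eq_zero_iff a w).mpr (Ideal.subset_span hw), C_0]
    rw [map_mul]
    exact (congrArg (· * redU a b) h).trans (zero_mul _)
  | add x _ y _ h1 h2 => rw [map_add, h1, h2, add_zero]

theorem mem_WC_mul_of_redU_eq_zero {d : ℤ} {z : BW a} (hz : z ∈ BWdeg a d) (h0 : redU a z = 0) :
    z ∈ WC a * BWdeg a (d - 1) := by
  rw [z.as_sum]
  refine Submodule.sum_mem _ fun m _ => ?_
  obtain ⟨r0, hr0, r1, hr1, e⟩ := exists_homog_of_resU_eq_zero a (hz m) (by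
    rw [← coeff_redU, h0, coeff_zero])
  rw [e, map_add, ← C_mul_monomial, ← C_mul_monomial]
  have hd : d + (m.degree : ℤ) - 1 = d - 1 + m.degree := by ring
  rw [hd] at hr0 hr1
  exact add_mem (Submodule.mul_mem_mul (C_toOW_mem_WC a (ell_mem_W_zero a)) (BWdeg_monomial a m hr0))
    (Submodule.mul_mem_mul (C_toOW_mem_WC a (ell_mem_W_one a)) (BWdeg_monomial a m hr1))

theorem WC_mul_BWdeg_le {d : ℤ} {z : BW a} (hz : z ∈ WC a * BWdeg a d) : z ∈ BWdeg a (d + 1) := by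
  have hW : ∀ w ∈ W a, toOW a w ∈ homog a 1 := by
    intro w hw
    obtain ⟨x, y, rfl⟩ := Submodule.mem_span_pair.mp hw
    rw [map_add, map_smul, map_smul]
    exact add_mem (Submodule.smul_mem _ _ (toOW_mem_homog a (ell_isHomogeneous a 0)))
      (Submodule.smul_mem _ _ (toOW_mem_homog a (ell_isHomogeneous a 1)))
  induction hz using Submodule.mul_induction_on' with
  | mem_mul_mem w hw b hb =>
    obtain ⟨w, hw, rfl⟩ := hw
    rw [add_comm d]
    exact BWdeg_mul a (clPiece_C (hW w hw)) hb
  | add x _ y _ h1 h2 => exact add_mem h1 h2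

/-- In a fixed degree, divisibility by `W` with homogeneous cofactors is the same as vanishing
modulo `W`, coefficient by coefficient (`exists_homog_of_resU_eq_zero`). Ideal membership below is
always tested this way. -/
theorem mem_WC_mul_iff {d : ℤ} {z : BW a} :
    z ∈ WC a * BWdeg a d ↔ z ∈ BWdeg a (d + 1) ∧ redU a z = 0 :=
  ⟨fun h => ⟨WC_mul_BWdeg_le a h, redU_eq_zero_of_mem a h⟩, fun h => by
    simpa using mem_WC_mul_of_redU_eq_zero a h.1 h.2⟩

/-! ### The normalizer of `W` -/

theorem bracket_ell (p : BW a) (k : ℕ) :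
    bracket (derU a) p (C (toOW a (ell a k))) = dirD (OW a) (fun i => a i ^ k) p := by
  rw [bracket_C, dirD_eq_sum_C_mul]
  exact Finset.sum_congr rfl fun i _ => by rw [derU_ell, mul_comm]

theorem bracket_smul_add {x y : ℂ} (p : BW a) (u v : MvPolynomial (Fin (g + 3)) ℂ) :
    bracket (derU a) p (C (toOW a (x • u + y • v)))
      = x • bracket (derU a) p (C (toOW a u)) + y • bracket (derU a) p (C (toOW a v)) := by
  have hC : ∀ (x : ℂ) (r : OW a), (C (x • r) : BW a) = x • C r := by
    intro x r
    rw [Algebra.smul_def, map_mul, Algebra.smul_def]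
    rfl
  rw [bracket_C, bracket_C, bracket_C, Finset.smul_sum, Finset.smul_sum, ← Finset.sum_add_distrib]
  refine Finset.sum_congr rfl fun i _ => ?_
  rw [map_add, map_smul, map_smul, map_add, Derivation.map_smul, Derivation.map_smul, C_add, hC, hC,
    mul_add, mul_smul_comm, mul_smul_comm]

/-- The bracket with a linear form is a constant coefficient derivative in the momenta. Normalizing
`W` thus means that the reduced symbol is invariant under translations along `(1)` and `(aᵢ)`. -/
theorem mem_Ncl0_iff (p : BW a) : p ∈ Ncl0 a ↔ p ∈ BWdeg a 0 ∧
    dirD (FW a) (fun i => a i ^ 0) (redU a p) = 0 ∧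
      dirD (FW a) (fun i => a i ^ 1) (redU a p) = 0 := by
  constructor
  · rintro ⟨h, hW⟩
    refine ⟨h, ?_, ?_⟩
    · rw [← redU_dirD, ← bracket_ell]
      exact redU_eq_zero_of_mem a (hW _ (ell_mem_W_zero a))
    · rw [← redU_dirD, ← bracket_ell]
      exact redU_eq_zero_of_mem a (hW _ (ell_mem_W_one a))
  · rintro ⟨h, h0, h1⟩
    refine ⟨h, fun w hw => ?_⟩
    obtain ⟨x, y, rfl⟩ := Submodule.mem_span_pair.mp hw
    rw [bracket_smul_add, bracket_ell, bracket_ell]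
    refine add_mem (Submodule.smul_mem _ _ ?_) (Submodule.smul_mem _ _ ?_)
    · exact (mem_WC_mul_iff a).mpr ⟨dirD_mem_BWdeg a _ h, by rw [redU_dirD, h0]⟩
    · exact (mem_WC_mul_iff a).mpr ⟨dirD_mem_BWdeg a _ h, by rw [redU_dirD, h1]⟩

theorem mem_Ncl0_of_redU_eq_zero {p : BW a} (hp : p ∈ BWdeg a 0) (h : redU a p = 0) :
    p ∈ Ncl0 a := by
  rw [mem_Ncl0_iff, h]
  exact ⟨hp, map_zero _, map_zero _⟩

theorem homogeneousComponent_mem_Ncl0 (k : ℕ) {p : BW a} (hp : p ∈ Ncl0 a) :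
    homogeneousComponent k p ∈ Ncl0 a := by
  rw [mem_Ncl0_iff] at hp ⊢
  refine ⟨homogeneousComponent_mem_BWdeg a k hp.1, ?_, ?_⟩ <;> rw [redU_homogeneousComponent] <;>
    cases k with
  | zero => exact dirD_homogeneousComponent_zero _ _
  | succ k => rw [dirD_homogeneousComponent_succ]; first | rw [hp.2.1, map_zero] | rw [hp.2.2, map_zero]

/-- For `z = w b` the Leibniz rule gives `w {b, q} + {w, q} b`; the second term vanishes modulo `W`
because `q` normalizes `W`. -/
theorem redU_bracket_eq_zero {d : ℤ} {z q : BW a} (hz : z ∈ BWdeg a d) (h0 : redU a z = 0)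
    (hq : q ∈ Ncl0 a) : redU a (bracket (derU a) z q) = 0 := by
  have hz' := mem_WC_mul_of_redU_eq_zero a hz h0
  clear hz h0
  induction hz' using Submodule.mul_induction_on' with
  | mem_mul_mem w hw b _ =>
    obtain ⟨w, hw, rfl⟩ := hw
    change redU a (bracket (derU a) (C (toOW a w) * b) q) = 0
    have h1 : redU a (C (toOW a w)) = 0 := by
      rw [redU_C, (resU_toOW_eq_zero_iff a w).mpr (Ideal.subset_span hw), C_0]
    rw [bracket_mul_left, map_add, map_mul, map_mul, h1, zero_mul, zero_add, bracket_antisymm,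
      map_neg, redU_eq_zero_of_mem a (hq.2 w hw), neg_zero, zero_mul]
  | add x _ y _ h1 h2 => rw [bracket_add_left, map_add, h1, h2, add_zero]

theorem bracket_mem_Ncl0 {p q : BW a} (hp : p ∈ Ncl0 a) (hq : q ∈ Ncl0 a) :
    bracket (derU a) p q ∈ Ncl0 a := by
  have key : ∀ c : Fin (g + 3) → ℂ, dirD (FW a) c (redU a p) = 0 →
      dirD (FW a) c (redU a q) = 0 → dirD (FW a) c (redU a (bracket (derU a) p q)) = 0 := by
    intro c h h'
    have hp' := redU_bracket_eq_zero a (dirD_mem_BWdeg a c hp.1) (by rw [redU_dirD, h]) hq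
    have hq' := redU_bracket_eq_zero a (dirD_mem_BWdeg a c hq.1) (by rw [redU_dirD, h']) hp
    rw [← redU_dirD, dirD_bracket, map_add, hp', bracket_antisymm, map_neg, hq', neg_zero, add_zero]
  have hp' := (mem_Ncl0_iff a p).mp hp
  have hq' := (mem_Ncl0_iff a q).mp hq
  exact (mem_Ncl0_iff a _).mpr ⟨by simpa using bracket_mem_BWdeg a hp.1 hq.1,
    key _ hp'.2.1 hq'.2.1, key _ hp'.2.2 hq'.2.2⟩

/-! ### The canonical element -/

theorem PhiC_eq : PhiC a = linForm fun i => toOW a (X i) := rfl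

theorem X_mem_homog (i : Fin (g + 3)) : toOW a (X i) ∈ homog a 1 := by
  simpa using toOW_mem_homog a (isHomogeneous_X ℂ i)

theorem PhiC_mem_BWdeg : PhiC a ∈ BWdeg a 0 :=
  linForm_mem_BWdeg a fun i => by simpa using X_mem_homog a i

theorem dirD_redU_PhiC (k : ℕ) :
    dirD (FW a) (fun i => a i ^ k) (redU a (PhiC a)) = C (resU a (toOW a (ell a k))) := by
  rw [PhiC_eq, redU_linForm, dirD_linForm]
  refine congrArg C ?_
  rw [ell, map_sum, map_sum]
  refine Finset.sum_congr rfl fun i _ => ?_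
  rw [← smul_eq_C_mul, map_smul, map_smul, Algebra.smul_def]

theorem PhiC_mem_Ncl0 : PhiC a ∈ Ncl0 a := by
  refine (mem_Ncl0_iff a _).mpr ⟨PhiC_mem_BWdeg a, ?_, ?_⟩
  · rw [dirD_redU_PhiC, resU_ell_zero, C_0]
  · rw [dirD_redU_PhiC, resU_ell_one, C_0]

theorem redU_PhiC_ne_zero : redU a (PhiC a) ≠ 0 := by
  intro h
  have h2 := dirD_redU_PhiC a 2
  rw [h, map_zero] at h2
  exact resU_lU_ne_zero a (C_eq_zero.mp h2.symm)

/-- `Φ` generates the grading: `{Φ, q} = d q` in degree `d`, by Euler's identity on functions and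
`{Φ, fᵢ*} = -fᵢ*`. -/
theorem bracket_PhiC {q : BW a} (hq : q ∈ BWdeg a 0) : bracket (derU a) (PhiC a) q = 0 := by
  suffices H : ∀ {d : ℤ} {q : BW a}, q ∈ BWdeg a d → bracket (derU a) (PhiC a) q = d • q by
    simpa using H hq
  intro d q hq
  have hX : ∀ i, bracket (derU a) (PhiC a) (X i) = -X i := by
    intro i
    rw [PhiC_eq, bracket_antisymm, bracket_X_left, coeffD_linForm]
    congr 1
    rw [linForm, Finset.sum_eq_single i]
    · rw [derU_X, if_pos rfl, C_1, one_mul]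
    · intro j _ hj
      rw [derU_X, if_neg (Ne.symm hj), C_0, zero_mul]
    · simp
  refine BWdeg_induction a (P := fun d q => bracket (derU a) (PhiC a) q = d • q) ?_ ?_ ?_ hq
  · intro d r hr
    rw [bracket_C]
    simp only [PhiC_eq, pderiv_linForm, ← map_mul, ← map_sum]
    rw [euler_homog a hr, map_zsmul]
  · intro d p q hp hq
    rw [bracket_add_right, hp, hq, smul_add]
  · intro d p i _ ih
    rw [bracket_mul_right, ih, hX, sub_smul, one_smul]
    simp only [zsmul_eq_mul]
    ring

/-! ### The comparison map -/

theorem coeffU_mem (m : Fin g) (i : Fin (g + 3)) : coeffU a m i ∈ homog a 1 := by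
  rw [coeffU, mul_comm, ← Algebra.smul_def]
  exact Submodule.smul_mem _ _ (by simpa [lU] using toOW_mem_homog a (ell_isHomogeneous a 2))

/-- Translating the momenta along `(aᵢᵏ)` changes this form by `derQU a m` of `ℓₖ`, which is zero
for `k = 0, 1`. -/
theorem linForm_coeffU_mem (m : Fin g) : linForm (coeffU a m) ∈ Ncl0 a := by
  have h : ∀ k, dirD (FW a) (fun i => a i ^ k) (redU a (linForm (coeffU a m)))
      = C (resU a (derQU a m (toOW a (ell a k)))) := by
    intro k
    rw [redU_linForm, dirD_linForm]
    refine congrArg C ?_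
    rw [derQU_apply, map_sum]
    refine Finset.sum_congr rfl fun i _ => ?_
    rw [derU_ell, map_mul, AlgHom.commutes, mul_comm]
  refine (mem_Ncl0_iff a _).mpr ⟨linForm_mem_BWdeg a fun i => by simpa using coeffU_mem a m i, ?_, ?_⟩
  · rw [h, (derQU_ell a m).1, map_zero, C_0]
  · rw [h, (derQU_ell a m).2.1, map_zero, C_0]

theorem symbolMapU_mem (p : MvPolynomial (Fin g) (RatX g)) :
    symbolMap (secU a) (coeffU a) p ∈ Ncl0 a := by
  induction p using MvPolynomial.induction_on with
  | C r => rw [symbolMap_C]; exact C_mem_Ncl0 a (secU_mem a r)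
  | add p q hp hq => rw [map_add]; exact add_mem hp hq
  | mul_X p i hp => rw [map_mul, symbolMap_X]; exact mul_mem hp (linForm_coeffU_mem a i)

/-- The classical comparison map on the `𝒰` side. -/
def classicalU : MvPolynomial (Fin g) (RatX g) →ₐ[ℂ] Ncl0 a :=
  (symbolMap (secU a) (coeffU a)).codRestrict (Ncl0 a) (symbolMapU_mem a)

theorem coe_classicalU (p : MvPolynomial (Fin g) (RatX g)) :
    (classicalU a p : BW a) = symbolMap (secU a) (coeffU a) p := rfl

/-- The restriction of classical symbols to functions on the reduced phase space, in the
coordinates `qₘ`. -/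
def thetaU : BW a →ₐ[ℂ] MvPolynomial (Fin g) (FW a) :=
  symbolMap (resU a) fun i m => resU a (derU a i (coefO a m))

theorem thetaU_eq_zero_of_redU {p : BW a} (hp : redU a p = 0) : thetaU a p = 0 := by
  have : thetaU a p = aeval (fun i => linForm fun m : Fin g => resU a (derU a i (coefO a m)))
      (redU a p) := rfl
  rw [this, hp, map_zero]

theorem thetaU_PhiC : thetaU a (PhiC a) = 0 := by
  rw [thetaU, PhiC_eq, symbolMap_linForm]
  have : ∀ m : Fin g, ∑ i, resU a (toOW a (X i)) * resU a (derU a i (coefO a m)) = 0 := by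
    intro m
    simp only [← map_mul, ← map_sum]
    rw [euler_homog a (coefO_mem a m), zero_smul, map_zero]
  simp only [this]
  simp [linForm]

theorem thetaU_linForm_coeffU (m : Fin g) : thetaU a (linForm (coeffU a m)) = X m := by
  rw [thetaU, symbolMap_linForm]
  have : ∀ l : Fin g, ∑ i, resU a (coeffU a m i) * resU a (derU a i (coefO a l))
      = if l = m then 1 else 0 := by
    intro l
    simp only [← map_mul, ← map_sum]
    rw [← derQU_apply, derQU_coefO]
    by_cases h : l = m
    · simp [h]
    · rw [if_neg (fun h' => h (Fin.ext h')), if_neg h, map_zero]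
  simp only [this, linForm]
  rw [Finset.sum_eq_single m]
  · simp
  · intro l _ hl; simp [hl]
  · simp

/-- Restriction to the reduced phase space inverts `classicalU` up to the inclusion `ℂ(q) ⊂ ℂ(V/W)`;
injectivity and compatibility with degrees are read off from this. -/
theorem thetaU_classicalU (p : MvPolynomial (Fin g) (RatX g)) :
    thetaU a (classicalU a p) = mapAlgHom ((resU a).comp (secU a)) p := by
  rw [coe_classicalU]
  induction p using MvPolynomial.induction_on with
  | C r => rw [symbolMap_C, thetaU, symbolMap_C]; simp
  | add p q hp hq => rw [map_add, map_add, hp, hq, map_add]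
  | mul_X p i hp =>
    rw [map_mul, map_mul, hp, symbolMap_X, thetaU_linForm_coeffU, map_mul]
    simp

end UClassical

end

noncomputable section

open MvPolynomial

section UReduction

variable {g : ℕ} (a : Fin (g + 3) ↪ ℂ)

/-! ### Projection onto the reduced phase space -/

/-- The momentum dual to the coordinate `coefForm j`. -/
def formU (j : ℕ) : BW a := linForm fun i => algebraMap ℂ (OW a) (a i ^ j / nodeProd (⇑a) i)

theorem linForm_coeffU (m : Fin g) : linForm (coeffU a m) = C (lU a) * formU a m := by
  rw [formU, C_mul_linForm]
  rfl

/-- The `formU a j` are the momenta dual to the coordinates `coefForm a j`; Lagrange interpolation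
inverts this change of basis. -/
theorem X_eq_sum_formU (i : Fin (g + 3)) : (X i : BW a)
    = ∑ j ∈ Finset.range (g + 3), C (algebraMap ℂ (OW a) ((eraseProd (⇑a) i).coeff j)) * formU a j := by
  have h : ∀ k, ∑ j ∈ Finset.range (g + 3), (eraseProd (⇑a) i).coeff j * (a k ^ j / nodeProd (⇑a) k)
      = if k = i then 1 else 0 := by
    intro k
    simp only [← mul_div_assoc]
    rw [← Finset.sum_div, ← Polynomial.eval_eq_sum_range' (by rw [natDegree_eraseProd]; omega)]
    split_ifs with h
    · rw [h, eval_eraseProd_self, div_self (nodeProd_a_ne_zero a i)]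
    · rw [eval_eraseProd_of_ne _ h, zero_div]
  simp only [formU, C_mul_linForm]
  rw [linForm_sum]
  simp only [← map_mul, ← map_sum, h, linForm]
  rw [Finset.sum_eq_single i]
  · simp
  · intro k _ hk; simp [hk]
  · simp

theorem PhiC_eq_sum_formU :
    PhiC a = ∑ j ∈ Finset.range (g + 3), C (toOW a (coefForm a j)) * formU a j := by
  simp only [formU, C_mul_linForm]
  rw [linForm_sum, PhiC_eq]
  congr 1
  funext i
  have hn : algebraMap ℂ (OW a) (nodeProd (⇑a) i)⁻¹ * algebraMap ℂ (OW a) (nodeProd (⇑a) i) = 1 := by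
    rw [← map_mul, inv_mul_cancel₀ (nodeProd_a_ne_zero a i), map_one]
  have hC : ∀ c : ℂ, toOW a (C c) = algebraMap ℂ (OW a) c := fun c => (toOW a).commutes c
  have h := congrArg (toOW a) (sum_coefForm_mul_pow a i)
  rw [map_sum, map_mul, hC] at h
  have h2 : ∀ j, toOW a (coefForm a j) * algebraMap ℂ (OW a) (a i ^ j / nodeProd (⇑a) i)
      = algebraMap ℂ (OW a) (nodeProd (⇑a) i)⁻¹ * toOW a (C (a i ^ j) * coefForm a j) := by
    intro j
    rw [div_eq_mul_inv, map_mul, map_mul, hC]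
    ring
  simp only [h2]
  rw [← Finset.mul_sum, h, ← mul_assoc, hn, one_mul]

/-- The inverse of `∑ᵢ aᵢ² fᵢ`. -/
def lUinv : OW a := ↑(isUnit_lU a).unit⁻¹

theorem lUinv_mul : lUinv a * lU a = 1 := (isUnit_lU a).val_inv_mul

theorem lUinv_mem : lUinv a ∈ homog a (-1) :=
  homog_of_mul_eq a (isHomogeneous_one _ _) (ell_isHomogeneous a 2) (ell_two_notMem a) (by simp)
    ((lUinv_mul a).trans (map_one _).symm)

theorem lUinv_mul_coefForm (j : ℕ) : lUinv a * toOW a (coefForm a j) = coefO a j := by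
  rw [← lU_mul_coefO, ← mul_assoc, lUinv_mul, one_mul]

theorem lU_mul_derU_coefO (i : Fin (g + 3)) (j : ℕ) :
    derU a i (coefO a j) * lU a = algebraMap ℂ (OW a) ((eraseProd (⇑a) i).coeff j)
      - coefO a j * algebraMap ℂ (OW a) (a i ^ 2) := by
  have h := congrArg (derU a i) (lU_mul_coefO a j)
  rw [Derivation.leibniz, smul_eq_mul, smul_eq_mul, coefForm, derU_linear, lU, derU_ell] at h
  rw [lU, ← h]
  ring

/-- The projection of `fᵢ*` onto the span of the vector fields `∂/∂qₘ`. -/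
def kappaU (i : Fin (g + 3)) : BW a := ∑ m : Fin g, C (derU a i (coefO a m)) * linForm (coeffU a m)

/-- The projection of `fᵢ*` onto the span of the vector fields `∂/∂qₘ` and `Φ`. -/
def tauU (i : Fin (g + 3)) : BW a :=
  kappaU a i + C (lUinv a * algebraMap ℂ (OW a) (a i ^ 2)) * PhiC a

theorem kappaU_mem (i : Fin (g + 3)) : kappaU a i ∈ BWdeg a (-1) := by
  refine Submodule.sum_mem _ fun m _ => ?_
  exact BWdeg_mul a (d := -1) (e := 0) (clPiece_C (derU_homog a i 0 _ (coefO_mem a m)))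
    (linForm_coeffU_mem a m).1

theorem lUinv_mul_mem (c : ℂ) : lUinv a * algebraMap ℂ (OW a) c ∈ homog a (-1) := by
  rw [mul_comm, ← Algebra.smul_def]
  exact Submodule.smul_mem _ _ (lUinv_mem a)

theorem tauU_mem (i : Fin (g + 3)) : tauU a i ∈ BWdeg a (-1) :=
  add_mem (kappaU_mem a i) (BWdeg_mul a (d := -1) (e := 0) (clPiece_C (lUinv_mul_mem a _))
    (PhiC_mem_BWdeg a))

/-- Differentiating `coefO = coefForm / ℓ₂` produces a correction `-aᵢ² coefO`. Since `ℓ₂⁻¹ Φ = ∑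
coefO a j * formU a j`, the `Φ` term of `tauU` cancels it for `j < g`, and only the three top
momenta keep one. -/
theorem tauU_eq (i : Fin (g + 3)) : tauU a i
    = (∑ j ∈ Finset.range g, C (algebraMap ℂ (OW a) ((eraseProd (⇑a) i).coeff j)) * formU a j)
      + C (algebraMap ℂ (OW a) (a i ^ 2)) * (C (coefO a g) * formU a g
        + C (coefO a (g + 1)) * formU a (g + 1) + C (coefO a (g + 2)) * formU a (g + 2)) := by
  have h1 : kappaU a i = ∑ j ∈ Finset.range g,
      (C (algebraMap ℂ (OW a) ((eraseProd (⇑a) i).coeff j)) * formU a j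
        - C (algebraMap ℂ (OW a) (a i ^ 2)) * (C (coefO a j) * formU a j)) := by
    rw [kappaU, ← Fin.sum_univ_eq_sum_range (fun j =>
      C (algebraMap ℂ (OW a) ((eraseProd (⇑a) i).coeff j)) * formU a j
        - C (algebraMap ℂ (OW a) (a i ^ 2)) * (C (coefO a j) * formU a j))]
    refine Finset.sum_congr rfl fun m _ => ?_
    rw [linForm_coeffU, ← mul_assoc, ← map_mul, lU_mul_derU_coefO, map_sub, map_mul]
    ring
  have h2 : C (lUinv a) * PhiC a = ∑ j ∈ Finset.range (g + 3), C (coefO a j) * formU a j := by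
    rw [PhiC_eq_sum_formU, Finset.mul_sum]
    refine Finset.sum_congr rfl fun j _ => ?_
    rw [← mul_assoc, ← map_mul, lUinv_mul_coefForm]
  rw [tauU, h1, mul_comm (lUinv a), map_mul, mul_assoc, h2, Finset.sum_range_succ,
    Finset.sum_range_succ, Finset.sum_range_succ, Finset.sum_sub_distrib, ← Finset.mul_sum]
  ring

theorem resU_coefO : resU a (coefO a g) = 1 ∧ resU a (coefO a (g + 1)) = 0 ∧
    resU a (coefO a (g + 2)) = 0 := by
  refine ⟨?_, ?_, ?_⟩
  · rw [← lUinv_mul_coefForm, map_mul, resU_coefForm_middle, ← map_mul, lUinv_mul, map_one]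
  · rw [← lUinv_mul_coefForm, map_mul, resU_coefForm_top_sub_one, mul_zero]
  · rw [← lUinv_mul_coefForm, map_mul, resU_coefForm_top, mul_zero]

/-- Modulo `W` the three top `coefO` are `1, 0, 0`, while the top coefficients of `eraseProd` are
`1`, `π₂ + aᵢ` and `π₁ + π₂ aᵢ + aᵢ²`. The `aᵢ²` terms cancel, so `fᵢ*` and `tauU a i` differ by a
combination of `1` and `aᵢ` independent of `i` otherwise. -/
theorem exists_redU_tauU : ∃ η₀ η₁, ∀ i, redU a (tauU a i)
    = X i - C (algebraMap ℂ (FW a) (a i ^ 1)) * η₁ - C (algebraMap ℂ (FW a) (a i ^ 0)) * η₀ := by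
  set π₁ := (∏ j, (Polynomial.X - Polynomial.C (a j))).coeff (g + 1)
  set π₂ := (∏ j, (Polynomial.X - Polynomial.C (a j))).coeff (g + 2)
  refine ⟨redU a (C (algebraMap ℂ (OW a) π₁) * formU a g
    + C (algebraMap ℂ (OW a) π₂) * formU a (g + 1) + formU a (g + 2)),
    redU a (C (algebraMap ℂ (OW a) π₂) * formU a g + formU a (g + 1)), fun i => ?_⟩
  have hX := congrArg (redU a) (X_eq_sum_formU a i)
  have h2 : (eraseProd (⇑a) i).coeff (g + 1) = π₂ + a i := by
    rw [eraseProd_coeff_succ a i (g + 1), eraseProd_coeff_top, mul_one]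
  have h1 : (eraseProd (⇑a) i).coeff g = π₁ + a i * (π₂ + a i) := by
    rw [eraseProd_coeff_succ a i g, h2]
  rw [redU_X, Finset.sum_range_succ, Finset.sum_range_succ, Finset.sum_range_succ, h1, h2,
    eraseProd_coeff_top] at hX
  rw [hX, tauU_eq]
  obtain ⟨e0, e1, e2⟩ := resU_coefO a
  simp only [map_add, map_mul, redU_C, e0, e1, e2, AlgHom.commutes, map_pow, map_zero, map_one,
    pow_zero, pow_one]
  ring

theorem aeval_mem_BWdeg {y : Fin (g + 3) → BW a} (hy : ∀ i, y i ∈ BWdeg a (-1)) {d : ℤ}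
    {p : BW a} (hp : p ∈ BWdeg a d) : aeval y p ∈ BWdeg a d := by
  refine BWdeg_induction a (P := fun d p => aeval y p ∈ BWdeg a d) ?_ ?_ ?_ hp
  · intro d r hr
    rw [algHom_C]
    exact clPiece_C hr
  · intro d p q hp hq
    rw [map_add]
    exact add_mem hp hq
  · intro d p i _ ih
    rw [map_mul, aeval_X]
    exact BWdeg_mul a ih (hy i)

theorem exists_aeval_tauU_sub {d : ℤ} {p : BW a} (hp : p ∈ BWdeg a d) :
    ∃ c ∈ BWdeg a d, aeval (tauU a) p - aeval (kappaU a) p = c * PhiC a := by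
  refine BWdeg_induction a (P := fun d p => ∃ c ∈ BWdeg a d,
    aeval (tauU a) p - aeval (kappaU a) p = c * PhiC a) ?_ ?_ ?_ hp
  · intro d r hr
    exact ⟨0, zero_mem _, by rw [algHom_C, algHom_C, sub_self, zero_mul]⟩
  · rintro d p q ⟨c, hc, h⟩ ⟨c', hc', h'⟩
    refine ⟨c + c', add_mem hc hc', ?_⟩
    rw [map_add, map_add, add_mul, ← h, ← h']
    ring
  · rintro d p i hp ⟨c, hc, h⟩
    refine ⟨c * kappaU a i + aeval (tauU a) p * C (lUinv a * algebraMap ℂ (OW a) (a i ^ 2)),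
      add_mem (BWdeg_mul a hc (kappaU_mem a i))
        (BWdeg_mul a (aeval_mem_BWdeg a (tauU_mem a) hp) (clPiece_C (lUinv_mul_mem a _))), ?_⟩
    rw [map_mul, map_mul, aeval_X, aeval_X, tauU]
    linear_combination kappaU a i * h

theorem redU_aeval (y : Fin (g + 3) → BW a) (p : BW a) :
    redU a (aeval y p) = aeval (fun i => redU a (y i)) (redU a p) := by
  induction p using MvPolynomial.induction_on with
  | C r => rw [algHom_C, redU_C, algHom_C]; exact redU_C a r
  | add p q hp hq => rw [map_add, map_add, map_add, map_add, hp, hq]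
  | mul_X p i hp => rw [map_mul, map_mul, map_mul, map_mul, hp, aeval_X, redU_X, aeval_X]

instance charZeroFW : CharZero (FW a) :=
  charZero_of_injective_algebraMap (algebraMap ℂ (FW a)).injective

/-- Modulo `W`, replacing `fᵢ*` by `tauU a i` is a translation along `(1)` and `(aᵢ)`, under which
symbols of the normalizer are invariant. -/
theorem redU_aeval_tauU {p : BW a} (hp : p ∈ Ncl0 a) : redU a (aeval (tauU a) p) = redU a p := by
  obtain ⟨η₀, η₁, h⟩ := exists_redU_tauU a
  obtain ⟨-, h0, h1⟩ := (mem_Ncl0_iff a p).mp hp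
  rw [dirD_eq_sum_C_mul] at h0 h1
  rw [redU_aeval]
  simp only [h]
  rw [aeval_sub_eq_aeval _ h0, aeval_sub_eq_aeval _ h1, aeval_X_left_apply]

theorem redU_aeval_kappaU (p : BW a) :
    redU a (aeval (kappaU a) p) = aeval (fun m => redU a (linForm (coeffU a m))) (thetaU a p) := by
  induction p using MvPolynomial.induction_on with
  | C r => rw [algHom_C, thetaU, symbolMap_C, algHom_C]; exact redU_C a r
  | add p q hp hq => rw [map_add, map_add, map_add, map_add, hp, hq]
  | mul_X p i hp =>
    rw [map_mul, map_mul, map_mul, map_mul, hp, aeval_X, kappaU, thetaU, symbolMap_X, linForm,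
      map_sum, map_sum]
    refine congrArg _ (Finset.sum_congr rfl fun m _ => ?_)
    rw [map_mul, map_mul, redU_C, algHom_C, aeval_X]
    rfl

/-- The two directional derivatives kill the reduction of `Φ`, which is nonzero in a domain, so they
must kill the reduction of `c`. -/
theorem mem_Ncl0_of_mul_PhiC {c : BW a} (hc : c ∈ BWdeg a 0) (h : c * PhiC a ∈ Ncl0 a) :
    c ∈ Ncl0 a := by
  obtain ⟨-, h0, h1⟩ := (mem_Ncl0_iff a _).mp h
  rw [map_mul, Derivation.leibniz, dirD_redU_PhiC, smul_eq_mul, smul_eq_mul] at h0 h1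
  rw [resU_ell_zero, C_0, mul_zero, zero_add] at h0
  rw [resU_ell_one, C_0, mul_zero, zero_add] at h1
  exact (mem_Ncl0_iff a c).mpr ⟨hc, (mul_eq_zero.mp h0).resolve_left (redU_PhiC_ne_zero a),
    (mul_eq_zero.mp h1).resolve_left (redU_PhiC_ne_zero a)⟩

/-- The elements of the normalizer that vanish on the reduced phase space. -/
theorem exists_of_thetaU_eq_zero {q : BW a} (hq : q ∈ Ncl0 a) (h0 : thetaU a q = 0) :
    ∃ c ∈ Ncl0 a, q - c * PhiC a ∈ WC a * BWdeg a (-1) := by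
  -- Modulo `W`, `q` equals `q(τ)`; this differs from `q(κ)` by a multiple of `Φ`; and `q(κ)`
  -- reduces to a substitution into `thetaU a q = 0`.
  obtain ⟨c, hc, h⟩ := exists_aeval_tauU_sub a hq.1
  have hmem : q - c * PhiC a ∈ BWdeg a 0 :=
    sub_mem hq.1 (by simpa using BWdeg_mul a hc (PhiC_mem_BWdeg a))
  have hred : redU a (q - c * PhiC a) = 0 := by
    rw [← h, map_sub, map_sub, redU_aeval_tauU a hq, redU_aeval_kappaU, h0, map_zero]
    simp
  refine ⟨c, mem_Ncl0_of_mul_PhiC a hc ?_, (mem_WC_mul_iff a).mpr ⟨hmem, hred⟩⟩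
  have := sub_mem hq (mem_Ncl0_of_redU_eq_zero a hmem hred)
  simpa using this

theorem PhiC_isHomogeneous : (PhiC a).IsHomogeneous 1 := linForm_isHomogeneous _

/-- The bound on the degree of `c` keeps the correction by `Φ` within order `k` in the quantum
induction. It is obtained by passing to components of degree `k`; for `k = 0` the factor `Φ` forces
`c = 0`. -/
theorem exists_of_thetaU_eq_zero_of_isHomogeneous {q : BW a} (hq : q ∈ Ncl0 a)
    (h0 : thetaU a q = 0) {k : ℕ} (hk : q.IsHomogeneous k) :
    ∃ c ∈ Ncl0 a, c ∈ degLE (OW a) (Fin (g + 3)) ((k : ℤ) - 1) ∧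
      q - c * PhiC a ∈ WC a * BWdeg a (-1) := by
  obtain ⟨c, hc, h⟩ := exists_of_thetaU_eq_zero a hq h0
  have hqk : homogeneousComponent k q = q := (homogeneousComponent_of_mem hk).trans (if_pos rfl)
  rw [mem_WC_mul_iff] at h
  have h' : homogeneousComponent k (q - c * PhiC a) ∈ WC a * BWdeg a (-1) :=
    (mem_WC_mul_iff a).mpr ⟨homogeneousComponent_mem_BWdeg a k h.1, by
      rw [redU_homogeneousComponent, h.2, map_zero]⟩
  rw [map_sub, hqk, mul_comm c] at h'
  cases k with
  | zero =>
    refine ⟨0, zero_mem _, zero_mem _, ?_⟩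
    have e : homogeneousComponent 0 (PhiC a * c) = 0 := by
      rw [homogeneousComponent_zero, ← constantCoeff_eq, map_mul, constantCoeff_eq,
        (PhiC_isHomogeneous a).coeff_eq_zero (d := 0) (by simp), zero_mul, C_0]
    rw [e] at h'
    rwa [zero_mul]
  | succ k =>
    rw [homogeneousComponent_linear_mul (PhiC_isHomogeneous a), mul_comm (PhiC a)] at h'
    refine ⟨homogeneousComponent k c, homogeneousComponent_mem_Ncl0 a k hc, ?_, h'⟩
    have := IsHomogeneous.mem_degLE (homogeneousComponent_isHomogeneous k c)
    simpa using this

/-! ### The classical isomorphism on the `𝒰` side -/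

/-- The derivatives of the degree `0` functions `coefO` have degree `-1`, like the momenta they
replace, so `thetaU` preserves degrees. In degree `0` its coefficients are therefore in `ℂ(q)`. -/
theorem coeff_thetaU_mem {d : ℤ} {p : BW a} (hp : p ∈ BWdeg a d) (m : Fin g →₀ ℕ) :
    (thetaU a p).coeff m ∈ (homog a d).map (resU a).toLinearMap := by
  classical
  refine BWdeg_induction a (P := fun d p => ∀ m,
    (thetaU a p).coeff m ∈ (homog a d).map (resU a).toLinearMap) ?_ ?_ ?_ hp m
  · intro d r hr m
    rw [thetaU, symbolMap_C, coeff_C]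
    split_ifs
    · exact ⟨r, hr, rfl⟩
    · exact zero_mem _
  · intro d p q hp hq m
    rw [map_add, coeff_add]
    exact add_mem (hp m) (hq m)
  · intro d p i _ ih m
    rw [map_mul]
    nth_rewrite 2 [thetaU]
    rw [symbolMap_X, linForm, Finset.mul_sum, coeff_sum]
    refine Submodule.sum_mem _ fun l _ => ?_
    rw [← mul_assoc, coeff_mul_X']
    split_ifs
    · rw [mul_comm, coeff_C_mul, mul_comm]
      obtain ⟨r, hr, e⟩ := ih (m - Finsupp.single l 1)
      refine ⟨r * derU a i (coefO a l), homog_mul a d (-1) _ _ hr ?_, ?_⟩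
      · exact derU_homog a i 0 _ (coefO_mem a l)
      · rw [← e]
        exact map_mul (resU a) _ _
    · exact zero_mem _

theorem exists_map_eq_thetaU {p : BW a} (hp : p ∈ BWdeg a 0) :
    ∃ e, mapAlgHom ((resU a).comp (secU a)) e = thetaU a p := by
  have h : ∀ m, ∃ e, resU a (secU a e) = (thetaU a p).coeff m := by
    intro m
    obtain ⟨r, hr, e⟩ := coeff_thetaU_mem a hp m
    obtain ⟨e', he'⟩ := exists_resU_secU_eq a hr
    exact ⟨e', he'.trans e⟩
  choose e he using h
  refine ⟨∑ m ∈ (thetaU a p).support, monomial m (e m), ?_⟩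
  conv_rhs => rw [(thetaU a p).as_sum]
  rw [map_sum]
  refine Finset.sum_congr rfl fun m _ => ?_
  rw [← he]
  exact map_monomial _ _ _

theorem mapAlgHom_resU_secU_injective :
    Function.Injective (mapAlgHom (σ := Fin g) ((resU a).comp (secU a))) :=
  map_injective _ (resU_secU_injective a)

theorem mem_Jcl_iff (p : Ncl0 a) : p ∈ Jcl a ↔ thetaU a p = 0 := by
  constructor
  · intro hp
    refine Submodule.span_induction (p := fun (p : Ncl0 a) _ => thetaU a p = 0) ?_ ?_ ?_ ?_ hp
    · rintro x (hx | hx)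
      · exact thetaU_eq_zero_of_redU a (redU_eq_zero_of_mem a hx)
      · rw [hx, thetaU_PhiC]
    · exact map_zero (thetaU a)
    · intro x y _ _ hx hy
      rw [Subalgebra.coe_add, map_add, hx, hy, add_zero]
    · intro x y _ hy
      rw [smul_eq_mul, Subalgebra.coe_mul, map_mul, hy, mul_zero]
  · intro h
    obtain ⟨c, hc, hz⟩ := exists_of_thetaU_eq_zero a p.2 h
    have hz' := (mem_WC_mul_iff a).mp hz
    have e : p = ⟨_, mem_Ncl0_of_redU_eq_zero a hz'.1 hz'.2⟩ + ⟨c, hc⟩ * ⟨PhiC a, PhiC_mem_Ncl0 a⟩ :=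
      Subtype.ext (by simp)
    rw [e]
    exact add_mem (Ideal.subset_span (Or.inl hz))
      (Ideal.mul_mem_left _ _ (Ideal.subset_span (Or.inr rfl)))

theorem mkSU_eq_iff (p q : Ncl0 a) : mkSU a p = mkSU a q ↔ thetaU a p = thetaU a q := by
  rw [mkSU, Ideal.Quotient.mkₐ_eq_mk, Ideal.Quotient.eq, mem_Jcl_iff, Subalgebra.coe_sub, map_sub,
    sub_eq_zero]

theorem classicalU_bijective : Function.Bijective ((mkSU a).comp (classicalU a)) := by
  constructor
  · intro p q h
    have h2 := (mkSU_eq_iff a (classicalU a p) (classicalU a q)).mp h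
    rw [thetaU_classicalU, thetaU_classicalU] at h2
    exact mapAlgHom_resU_secU_injective a h2
  · intro z
    obtain ⟨p, rfl⟩ := Ideal.Quotient.mk_surjective z
    obtain ⟨e, he⟩ := exists_map_eq_thetaU a p.2.1
    refine ⟨e, (mkSU_eq_iff a (classicalU a e) p).mpr ?_⟩
    rw [thetaU_classicalU, he]

theorem isHomogeneous_of_map {F K ι : Type} [CommRing F] [CommRing K] (f : F →+* K)
    (hf : Function.Injective f) {p : MvPolynomial ι F} {k : ℕ} (h : (map f p).IsHomogeneous k) :
    p.IsHomogeneous k := by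
  intro m hm
  apply h
  rw [coeff_map]
  exact fun h0 => hm (hf (h0.trans (map_zero f).symm))

theorem classicalU_graded (k : ℕ) (p : MvPolynomial (Fin g) (RatX g)) : p.IsHomogeneous k ↔
    ∃ q : Ncl0 a, (q : BW a).IsHomogeneous k ∧ mkSU a q = mkSU a (classicalU a p) := by
  constructor
  · intro hp
    exact ⟨classicalU a p, symbolMap_isHomogeneous hp, rfl⟩
  · rintro ⟨q, hq, h⟩
    rw [mkSU_eq_iff, thetaU_classicalU] at h
    exact isHomogeneous_of_map _ (resU_secU_injective a) (h ▸ symbolMap_isHomogeneous hq)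

/-- The multiples of `W` are preserved because `q` normalizes `W`, brackets with `Φ` vanish in
degree `0`, and Leibniz does the rest. So the bracket descends to `SU a`. -/
theorem bracket_mem_Jcl {p : Ncl0 a} (hp : p ∈ Jcl a) (q : Ncl0 a) :
    (⟨bracket (derU a) p q, bracket_mem_Ncl0 a p.2 q.2⟩ : Ncl0 a) ∈ Jcl a := by
  refine Submodule.span_induction (p := fun (p : Ncl0 a) _ =>
    (⟨bracket (derU a) p q, bracket_mem_Ncl0 a p.2 q.2⟩ : Ncl0 a) ∈ Jcl a) ?_ ?_ ?_ ?_ hp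
  · rintro x (hx | hx)
    · have hx' := (mem_WC_mul_iff a).mp hx
      exact Ideal.subset_span (Or.inl ((mem_WC_mul_iff a).mpr
        ⟨by simpa using bracket_mem_BWdeg a hx'.1 q.2.1,
          redU_bracket_eq_zero a hx'.1 hx'.2 q.2⟩))
    · rw [mem_Jcl_iff]
      change thetaU a (bracket (derU a) (x : BW a) q) = 0
      rw [hx, bracket_PhiC a q.2.1, map_zero]
  · rw [mem_Jcl_iff]
    change thetaU a (bracket (derU a) 0 q) = 0
    simp [bracket]
  · intro x y _ _ hx hy
    convert add_mem hx hy using 1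
    exact Subtype.ext (bracket_add_left (derU a) (x : BW a) y q)
  · intro x y hy h
    have e : (⟨bracket (derU a) (x • y : Ncl0 a) q, bracket_mem_Ncl0 a (x • y).2 q.2⟩ : Ncl0 a)
        = x * ⟨bracket (derU a) y q, bracket_mem_Ncl0 a y.2 q.2⟩
          + ⟨bracket (derU a) x q, bracket_mem_Ncl0 a x.2 q.2⟩ * y :=
      Subtype.ext (bracket_mul_left (derU a) (x : BW a) y q)
    rw [e]
    exact add_mem (Ideal.mul_mem_left _ _ h) (Ideal.mul_mem_left _ _ hy)

theorem mkSU_bracket {p p' q q' : Ncl0 a} (h : mkSU a p = mkSU a q) (h' : mkSU a p' = mkSU a q') :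
    mkSU a ⟨bracket (derU a) p p', bracket_mem_Ncl0 a p.2 p'.2⟩
      = mkSU a ⟨bracket (derU a) q q', bracket_mem_Ncl0 a q.2 q'.2⟩ := by
  have left : ∀ {p q : Ncl0 a} (r : Ncl0 a), mkSU a p = mkSU a q →
      mkSU a ⟨bracket (derU a) p r, bracket_mem_Ncl0 a p.2 r.2⟩
        = mkSU a ⟨bracket (derU a) q r, bracket_mem_Ncl0 a q.2 r.2⟩ := by
    intro p q r h
    have h1 := bracket_mem_Jcl a (Ideal.Quotient.eq.mp h) r
    refine Ideal.Quotient.eq.mpr ?_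
    convert h1 using 1
    refine Subtype.ext ?_
    have e : (p : BW a) = ((p - q : Ncl0 a) : BW a) + q := by simp
    change bracket (derU a) p r - bracket (derU a) q r = bracket (derU a) ((p - q : Ncl0 a) : BW a) r
    conv_lhs => rw [e]
    rw [bracket_add_left, add_sub_cancel_right]
  have anti : ∀ p q : Ncl0 a, mkSU a ⟨bracket (derU a) p q, bracket_mem_Ncl0 a p.2 q.2⟩
      = -mkSU a ⟨bracket (derU a) q p, bracket_mem_Ncl0 a q.2 p.2⟩ := by
    intro p q
    rw [← map_neg]
    exact congrArg _ (Subtype.ext (bracket_antisymm (derU a) (q : BW a) p))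
  rw [left p' h, anti, left q h', ← anti]

end UReduction

end

noncomputable section

open MvPolynomial

section UQuantum

variable {g : ℕ} (a : Fin (g + 3) ↪ ℂ)

/-! ### Normal ordering and the normalizer of `W` -/

theorem nord_mem_AWdeg_iff {d : ℤ} {p : BW a} : nord (derU a) p ∈ AWdeg a d ↔ p ∈ BWdeg a d := by
  constructor
  · rintro ⟨q, hq, e⟩
    rw [← nord_injective (derU a) (derU_comm a) e]
    exact hq
  · exact fun h => ⟨p, h, rfl⟩

/-- Normal ordering keeps functions on the left, where `W` multiplies, so no correction arises. -/
theorem nord_mem_WQ_mul_iff {d : ℤ} {p : BW a} :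
    nord (derU a) p ∈ WQ a * AWdeg a d ↔ p ∈ WC a * BWdeg a d := by
  constructor
  · intro h
    have key : ∀ x ∈ WQ a * AWdeg a d, ∃ p ∈ WC a * BWdeg a d, nord (derU a) p = x := by
      intro x hx
      induction hx using Submodule.mul_induction_on' with
      | mem_mul_mem w hw b hb =>
        obtain ⟨w, hw, rfl⟩ := hw
        obtain ⟨b, hb, rfl⟩ := hb
        exact ⟨_, Submodule.mul_mem_mul (C_toOW_mem_WC a hw) hb, (coef_mul_nord _ _ _).symm⟩
      | add x _ y _ h1 h2 =>
        obtain ⟨p, hp, rfl⟩ := h1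
        obtain ⟨q, hq, rfl⟩ := h2
        exact ⟨p + q, add_mem hp hq, map_add _ _ _⟩
    obtain ⟨q, hq, e⟩ := key _ h
    rw [← nord_injective (derU a) (derU_comm a) e]
    exact hq
  · intro h
    induction h using Submodule.mul_induction_on' with
    | mem_mul_mem w hw b hb =>
      obtain ⟨w, hw, rfl⟩ := hw
      have e := coef_mul_nord (derU a) (toOW a w) b
      have h2 : coef (derU a) (toOW a w) * nord (derU a) b ∈ WQ a * AWdeg a d :=
        Submodule.mul_mem_mul ⟨w, hw, rfl⟩ ⟨b, hb, rfl⟩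
      rw [e] at h2
      exact h2
    | add x _ y _ h1 h2 => rw [map_add]; exact add_mem h1 h2

/-- Elements of `W` have constant derivatives, so the commutator is exactly the normally ordered
Poisson bracket. Hence the quantum and classical normalizers correspond under `nord`. -/
theorem nord_mul_coef_W {w : MvPolynomial (Fin (g + 3)) ℂ} (hw : w ∈ W a) (p : BW a) :
    nord (derU a) p * coef (derU a) (toOW a w) = coef (derU a) (toOW a w) * nord (derU a) p
      + nord (derU a) (bracket (derU a) p (C (toOW a w))) := by
  obtain ⟨x, y, rfl⟩ := Submodule.mem_span_pair.mp hw
  have h : ∀ i, derU a i (toOW a (x • ell a 0 + y • ell a 1))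
      = algebraMap ℂ (OW a) (x * a i ^ 0 + y * a i ^ 1) := by
    intro i
    rw [map_add, map_smul, map_smul, map_add, Derivation.map_smul, Derivation.map_smul, derU_ell,
      derU_ell, map_add, map_mul, map_mul, Algebra.smul_def, Algebra.smul_def]
  rw [nord_mul_coef_of_const (derU a) h, bracket_C]
  congr 2
  refine Finset.sum_congr rfl fun i _ => ?_
  rw [h, Algebra.smul_def, mul_comm]
  rfl

theorem nord_mem_N0_iff {p : BW a} : nord (derU a) p ∈ N0 a ↔ p ∈ Ncl0 a := by
  have key : ∀ w ∈ W a, p ∈ BWdeg a 0 →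
      (nord (derU a) p * coef (derU a) (toOW a w) ∈ WQ a * AWdeg a 0 ↔
        bracket (derU a) p (C (toOW a w)) ∈ WC a * BWdeg a 0) := by
    intro w hw hp
    rw [nord_mul_coef_W a hw, ← nord_mem_WQ_mul_iff]
    exact Submodule.add_mem_iff_right _
      (Submodule.mul_mem_mul ⟨w, hw, rfl⟩ ((nord_mem_AWdeg_iff a).mpr hp))
  constructor
  · rintro ⟨h, hW⟩
    have hp := (nord_mem_AWdeg_iff a).mp h
    exact ⟨hp, fun w hw => (key w hw hp).mp (hW w hw)⟩
  · rintro ⟨hp, hW⟩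
    exact ⟨(nord_mem_AWdeg_iff a).mpr hp, fun w hw => (key w hw hp).mpr (hW w hw)⟩

theorem Phi_eq : Phi a = nord (derU a) (PhiC a) := by
  rw [PhiC_eq, nord_linForm]
  rfl

theorem Phi_mem_N0 : Phi a ∈ N0 a := by
  rw [Phi_eq, nord_mem_N0_iff]
  exact PhiC_mem_Ncl0 a

theorem WQ_mul_AWdeg_le_N0 {x : AW a} (hx : x ∈ WQ a * AWdeg a (-1)) : x ∈ N0 a := by
  obtain ⟨p, rfl⟩ := nord_surjective (derU a) x
  rw [nord_mem_WQ_mul_iff, mem_WC_mul_iff] at hx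
  rw [nord_mem_N0_iff]
  exact mem_Ncl0_of_redU_eq_zero a hx.1 hx.2

theorem mkAU_eq_zero {x : N0 a} (h : (x : AW a) ∈ WQ a * AWdeg a (-1) ∨ (x : AW a) = Phi a) :
    mkAU a x = 0 := by
  have h2 := RingQuot.mkAlgHom_rel ℂ (s := AURel a) (x := x) (y := 0) ⟨h, rfl⟩
  rw [map_zero] at h2
  exact h2

/-! ### The quantum comparison map -/

theorem crossedMapU_mem (x : CrossedProduct (derE g)) :
    crossedMap (derivationChangeU a) x ∈ N0 a := by
  induction x using crossedProduct_induction with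
  | hc r => rw [crossedMap_coef]; exact coef_mem_N0 a (secU_mem a r)
  | hg i =>
    rw [crossedMap_gen, ← nord_linForm, nord_mem_N0_iff]
    exact linForm_coeffU_mem a i
  | hm x y hx hy => rw [map_mul]; exact mul_mem hx hy
  | ha x y hx hy => rw [map_add]; exact add_mem hx hy

/-- The quantum comparison map on the `𝒰` side. -/
def quantumU : CrossedProduct (derE g) →ₐ[ℂ] N0 a :=
  (crossedMap (derivationChangeU a)).codRestrict (N0 a) (crossedMapU_mem a)

theorem coe_quantumU (x : CrossedProduct (derE g)) :
    (quantumU a x : AW a) = crossedMap (derivationChangeU a) x := rfl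

/-! ### The action on functions on the reduced space -/

theorem opHom_mem_homog {d e : ℤ} {x : AW a} (hx : x ∈ AWdeg a e) {r : OW a} (hr : r ∈ homog a d) :
    opHom (derU a) (derU_comm a) x r ∈ homog a (e + d) := by
  obtain ⟨p, hp, rfl⟩ := hx
  refine BWdeg_induction a (P := fun e p => ∀ d r, r ∈ homog a d →
    opHom (derU a) (derU_comm a) (nord (derU a) p) r ∈ homog a (e + d)) ?_ ?_ ?_ hp d r hr
  · intro e s hs d r hr
    rw [nord_C, opHom_coef]
    exact homog_mul a _ _ _ _ hs hr
  · intro e p q hp hq d r hr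
    rw [map_add, map_add]
    exact add_mem (hp d r hr) (hq d r hr)
  · intro e p i _ ih d r hr
    rw [nord_mul_X, map_mul, Module.End.mul_apply, opHom_gen]
    convert ih _ _ (derU_homog a i d r hr) using 1
    ring_nf

theorem resU_opHom_WQ {d : ℤ} {x : AW a} (hx : x ∈ WQ a * AWdeg a d) (r : OW a) :
    resU a (opHom (derU a) (derU_comm a) x r) = 0 := by
  induction hx using Submodule.mul_induction_on' with
  | mem_mul_mem w hw b hb =>
    obtain ⟨w, hw, rfl⟩ := hw
    change resU a (opHom (derU a) (derU_comm a) (coef (derU a) (toOW a w) * b) r) = 0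
    rw [map_mul, Module.End.mul_apply, opHom_coef, map_mul,
      (resU_toOW_eq_zero_iff a w).mpr (Ideal.subset_span hw), zero_mul]
  | add x _ y _ h1 h2 => rw [map_add, LinearMap.add_apply, map_add, h1, h2, add_zero]

/-- `x W ⊂ W A⁰` moves the factor from `W` to the left of `x`; thus `N⁰` acts on homogeneous
functions modulo `W`. -/
theorem resU_opHom_N0 {x : AW a} (hx : x ∈ N0 a) {d : ℤ} {r : OW a} (hr : r ∈ homog a d)
    (h0 : resU a r = 0) : resU a (opHom (derU a) (derU_comm a) x r) = 0 := by
  obtain ⟨r0, -, r1, -, rfl⟩ := exists_homog_of_resU_eq_zero a hr h0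
  have key : ∀ w ∈ W a, ∀ s, resU a (opHom (derU a) (derU_comm a) x (toOW a w * s)) = 0 := by
    intro w hw s
    have := resU_opHom_WQ a (hx.2 w hw) s
    rwa [map_mul, Module.End.mul_apply, opHom_coef] at this
  rw [map_add, map_add, key _ (ell_mem_W_zero a), key _ (ell_mem_W_one a), add_zero]

theorem exists_actU (x : N0 a) (e : RatX g) :
    ∃ e', resU a (secU a e') = resU a (opHom (derU a) (derU_comm a) x (secU a e)) :=
  exists_resU_secU_eq a (by simpa using opHom_mem_homog a x.2.1 (secU_mem a e))

/-- The action of `N⁰` on the functions of degree `0` modulo `W`. -/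
def actFun (x : N0 a) (e : RatX g) : RatX g := (exists_actU a x e).choose

theorem actFun_spec (x : N0 a) (e : RatX g) :
    resU a (secU a (actFun a x e)) = resU a (opHom (derU a) (derU_comm a) x (secU a e)) :=
  (exists_actU a x e).choose_spec

theorem actFun_eq {x : N0 a} {e e' : RatX g}
    (h : resU a (opHom (derU a) (derU_comm a) x (secU a e)) = resU a (secU a e')) :
    actFun a x e = e' :=
  resU_secU_injective a ((actFun_spec a x e).trans h)

/-- The chosen representative of `y · e` is correct only modulo `W`; the error is homogeneous of
degree `0` and `x` keeps it zero modulo `W`. -/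
theorem actFun_mul (x y : N0 a) (e : RatX g) :
    actFun a (x * y) e = actFun a x (actFun a y e) := by
  apply actFun_eq
  rw [actFun_spec, Subalgebra.coe_mul, map_mul, Module.End.mul_apply, ← sub_eq_zero, ← map_sub,
    ← map_sub]
  refine resU_opHom_N0 a x.2 (d := 0) (sub_mem ?_ (secU_mem a _)) ?_
  · simpa using opHom_mem_homog a y.2.1 (secU_mem a e)
  · rw [map_sub, actFun_spec, sub_self]

/-- The representation of `N⁰` on the functions of degree `0` modulo `W`. -/
def actU : N0 a →ₐ[ℂ] Module.End ℂ (RatX g) where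
  toFun x :=
    { toFun := actFun a x
      map_add' := fun e e' => actFun_eq a (by
        rw [map_add, map_add, map_add, map_add, map_add, actFun_spec, actFun_spec])
      map_smul' := fun c e => actFun_eq a (by
        simp only [map_smul, actFun_spec, RingHom.id_apply]) }
  map_one' := LinearMap.ext fun e => actFun_eq a (by
    rw [Subalgebra.coe_one, map_one]; rfl)
  map_mul' x y := LinearMap.ext fun e => actFun_mul a x y e
  map_zero' := LinearMap.ext fun e => actFun_eq a (by
    rw [Subalgebra.coe_zero, map_zero]; simp)
  map_add' x y := LinearMap.ext fun e => actFun_eq a (by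
    rw [Subalgebra.coe_add, map_add, LinearMap.add_apply, map_add, ← actFun_spec, ← actFun_spec,
      ← map_add, ← map_add]
    rfl)
  commutes' c := LinearMap.ext fun e => actFun_eq a (by
    rw [Subalgebra.coe_algebraMap, AlgHom.commutes, Module.algebraMap_end_apply,
      Module.algebraMap_end_apply, map_smul, map_smul, map_smul])

theorem actU_eq_zero {x : N0 a} (h : (x : AW a) ∈ WQ a * AWdeg a (-1) ∨ (x : AW a) = Phi a) :
    actU a x = 0 := by
  refine LinearMap.ext fun e => actFun_eq a ?_
  rw [LinearMap.zero_apply, map_zero, map_zero]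
  rcases h with h | h
  · exact resU_opHom_WQ a h _
  · have e' := opHom_vectorField (derU a) (derU_comm a) (fun i => toOW a (X i)) (secU a e)
    rw [euler_homog a (secU_mem a e), zero_smul] at e'
    rw [h]
    exact (congrArg (resU a) e').trans (map_zero _)

theorem actU_eq_of_mkAU_eq {x y : N0 a} (h : mkAU a x = mkAU a y) : actU a x = actU a y := by
  let F : AU a →ₐ[ℂ] Module.End ℂ (RatX g) := RingQuot.liftAlgHom ℂ ⟨actU a, by
    rintro x y ⟨hx, rfl⟩
    rw [actU_eq_zero a hx, map_zero]⟩
  have hF : ∀ x, F (mkAU a x) = actU a x := fun x => RingQuot.liftAlgHom_mkAlgHom_apply _ _ _ _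
  rw [← hF, h, hF]

theorem actU_quantumU (x : CrossedProduct (derE g)) :
    actU a (quantumU a x) = opHom (derE g) (derE_comm) x := by
  refine LinearMap.ext fun e => actFun_eq a ?_
  rw [coe_quantumU, opHom_crossedMap (derivationChangeU a) (derE_comm) (derU_comm a)]

/-- The action of `N⁰` on `ℂ(q)` factors through `A_𝒰`, as `W A⁻¹` acts by zero modulo `W` and `Φ`
by the Euler operator in degree `0`. On the image of `ℂ(q)[∂/∂q]` it is the faithful standard
action. -/
theorem quantumU_injective : Function.Injective ((mkAU a).comp (quantumU a)) := by
  intro x y h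
  have h2 := actU_eq_of_mkAU_eq a (x := quantumU a x) (y := quantumU a y) h
  rw [actU_quantumU, actU_quantumU] at h2
  exact opHom_derE_injective h2

/-! ### Surjectivity -/

theorem crossedMap_nord_sub_mem_filt {e : MvPolynomial (Fin g) (RatX g)} {k : ℕ}
    (he : e.IsHomogeneous k) :
    crossedMap (derivationChangeU a) (nord (derE g) e) - nord (derU a) (classicalU a e : BW a)
      ∈ filt (derU a) ((k : ℤ) - 1) :=
  (crossedMap_nord_hasSymbol (derivationChangeU a) he).2

/-- The leading symbol agrees on the reduced space with some `s` over `ℂ(q)`; the discrepancy is `z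
+ c Φ` with `z` in the classical ideal `W B⁻¹`. Both parts lift to elements of `N⁰` that die in
`A_𝒰`, and subtracting everything lowers the order. -/
theorem exists_quantumU_eq (n : ℕ) (x : N0 a) (hx : (x : AW a) ∈ filt (derU a) ((n : ℤ) - 1)) :
    ∃ e ∈ filt (derE g) ((n : ℤ) - 1), mkAU a (quantumU a e) = mkAU a x := by
  induction n generalizing x with
  | zero =>
    obtain ⟨p, hp, e⟩ := hx
    have h0 : x = 0 := by
      rw [eq_zero_of_mem_degLE (by simp) hp, map_zero] at e
      exact Subtype.ext e.symm
    exact ⟨0, zero_mem _, by rw [h0, map_zero]⟩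
  | succ n ih =>
    obtain ⟨p, hp, hpx⟩ := hx
    rw [Nat.cast_succ, add_sub_cancel_right] at hp ⊢
    have hpN : p ∈ Ncl0 a := by
      rw [← nord_mem_N0_iff, hpx]
      exact x.2
    have hpk := homogeneousComponent_mem_Ncl0 a n hpN
    obtain ⟨s, hs⟩ := exists_map_eq_thetaU a hpk.1
    have hsk : s.IsHomogeneous n := isHomogeneous_of_map _ (resU_secU_injective a)
      (hs ▸ symbolMap_isHomogeneous (homogeneousComponent_isHomogeneous n p) :
        (map ((resU a).comp (secU a) : RatX g →+* FW a) s).IsHomogeneous n)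
    obtain ⟨c, hc, hcn, hz⟩ := exists_of_thetaU_eq_zero_of_isHomogeneous a
      (sub_mem hpk (classicalU a s).2) (k := n)
      (by rw [map_sub, thetaU_classicalU, hs, sub_self])
      ((homogeneousComponent_isHomogeneous n p).sub (symbolMap_isHomogeneous hsk))
    set z := homogeneousComponent n p - (classicalU a s : BW a) - c * PhiC a with hzdef
    have hzQ := (nord_mem_WQ_mul_iff a).mpr hz
    set Z : N0 a := ⟨nord (derU a) z, WQ_mul_AWdeg_le_N0 a hzQ⟩
    set Q : N0 a := ⟨nord (derU a) c, (nord_mem_N0_iff a).mpr hc⟩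
    set P : N0 a := ⟨Phi a, Phi_mem_N0 a⟩
    -- Three errors remain, all of order `n - 1`: the lower terms of `p`, the failure of
    -- `crossedMap` to respect normal ordering, and the reordering in the product of `c` (degree at
    -- most `n - 1`) with `Φ` (degree `1`).
    have hrest : ((x - quantumU a (nord (derE g) s) - Z - Q * P : N0 a) : AW a)
        ∈ filt (derU a) ((n : ℤ) - 1) := by
      have e1 : ((x - quantumU a (nord (derE g) s) - Z - Q * P : N0 a) : AW a)
          = nord (derU a) (p - homogeneousComponent n p)
            - (crossedMap (derivationChangeU a) (nord (derE g) s)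
              - nord (derU a) (classicalU a s : BW a))
            - (nord (derU a) c * nord (derU a) (PhiC a) - nord (derU a) (c * PhiC a)) := by
        change (x : AW a) - crossedMap (derivationChangeU a) (nord (derE g) s) - nord (derU a) z
          - nord (derU a) c * Phi a = _
        rw [← hpx, Phi_eq, hzdef]
        simp only [map_sub]
        abel
      rw [e1]
      refine sub_mem (sub_mem (nord_mem_filt _ (sub_homogeneousComponent_mem_degLE hp))
        (crossedMap_nord_sub_mem_filt a hsk)) ?_
      have := nord_mul_nord_sub (derU a) hcn (IsHomogeneous.mem_degLE (PhiC_isHomogeneous a))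
      simpa using this
    obtain ⟨e, he, h⟩ := ih _ hrest
    refine ⟨nord (derE g) s + e, add_mem (nord_mem_filt _ (IsHomogeneous.mem_degLE hsk))
      (filt_mono _ (by omega) he), ?_⟩
    have hx : x = quantumU a (nord (derE g) s)
        + (x - quantumU a (nord (derE g) s) - Z - Q * P) + Z + Q * P := by abel
    conv_rhs => rw [hx]
    rw [map_add, map_add, h, map_add (mkAU a), map_add (mkAU a), map_add (mkAU a), map_mul (mkAU a),
      mkAU_eq_zero a (x := Z) (Or.inl hzQ), mkAU_eq_zero a (x := P) (Or.inr rfl), mul_zero, add_zero,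
      add_zero]

theorem quantumU_filt (k : ℤ) :
    ((mkAU a).comp (quantumU a)) '' (filt (derE g) k) = filtAU a k := by
  ext z
  constructor
  · rintro ⟨e, he, rfl⟩
    exact ⟨quantumU a e, crossedMap_mem_filt _ he, rfl⟩
  · rintro ⟨y, hy, rfl⟩
    rcases lt_or_ge k 0 with hk | hk
    · obtain ⟨p, hp, e⟩ := hy
      have h0 : y = 0 := by
        rw [eq_zero_of_mem_degLE hk hp, map_zero] at e
        exact Subtype.ext e.symm
      exact ⟨0, zero_mem _, by rw [h0, map_zero, map_zero]⟩
    · have hn : ((k.toNat + 1 : ℕ) : ℤ) - 1 = k := by push_cast; omega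
      obtain ⟨e, he, h⟩ := exists_quantumU_eq a (k.toNat + 1) y (by rwa [hn])
      rw [hn] at he
      exact ⟨e, he, h⟩

theorem quantumU_bijective : Function.Bijective ((mkAU a).comp (quantumU a)) := by
  refine ⟨quantumU_injective a, fun z => ?_⟩
  obtain ⟨y, rfl⟩ := RingQuot.mkAlgHom_surjective ℂ (AURel a) z
  obtain ⟨p, hp⟩ := nord_surjective (derU a) (y : AW a)
  obtain ⟨k, hk⟩ := exists_mem_degLE p
  have : mkAU a y ∈ filtAU a k := ⟨y, ⟨p, hk, hp⟩, rfl⟩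
  rw [← quantumU_filt] at this
  obtain ⟨e, -, h⟩ := this
  exact ⟨e, h⟩

end UQuantum

end

noncomputable section

open MvPolynomial

section Main

variable {g : ℕ} (a : Fin (g + 3) ↪ ℂ)

/-! ### The residue elements -/

/-- For `g > 0` the derivative with respect to `q₀` is `1`; for `g = 0` the polynomial is `1`. -/
theorem genericMonic_eval_ne_zero (b : ℂ) :
    (genericMonic g).eval (algebraMap ℂ (RatX g) b) ≠ 0 := by
  rw [genericMonic, eval_monicOf]
  cases g with
  | zero => simp
  | succ g =>
    intro h
    have h2 := congrArg (derE (g + 1) 0) h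
    rw [← map_pow, map_add, Derivation.map_algebraMap, map_sum, map_zero, zero_add,
      Finset.sum_eq_single 0] at h2
    · rw [Fin.val_zero, pow_zero, mul_one, derE_xvar, if_pos rfl] at h2
      exact one_ne_zero h2
    · intro j _ hj
      rw [← map_pow, Derivation.leibniz, Derivation.map_algebraMap, derE_xvar,
        if_neg (Ne.symm hj), smul_zero, smul_zero, add_zero]
    · simp

/-- The reduction of the generic monic polynomial. -/
def monicF : Polynomial (FW a) := (genericMonic g).map ((resU a).comp (secU a) : RatX g →+* FW a)

theorem monicF_monic : (monicF a).Monic := genericMonic_monic.map _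

theorem eval_map_secU (p : Polynomial (RatX g)) (b : ℂ) :
    (p.map ((resU a).comp (secU a) : RatX g →+* FW a)).eval (algebraMap ℂ (FW a) b)
      = resU a (secU a (p.eval (algebraMap ℂ (RatX g) b))) := by
  have hb : algebraMap ℂ (FW a) b
      = ((resU a).comp (secU a) : RatX g →+* FW a) (algebraMap ℂ (RatX g) b) :=
    (((resU a).comp (secU a)).commutes b).symm
  rw [hb, Polynomial.eval_map, Polynomial.eval₂_hom]
  rfl

theorem resU_secU_div (x y : RatX g) :
    resU a (secU a (x / y)) = resU a (secU a x) / resU a (secU a y) :=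
  map_div₀ ((resU a).comp (secU a)) x y

theorem resU_secU_algebraMap (c : ℂ) :
    resU a (secU a (algebraMap ℂ (RatX g) c)) = algebraMap ℂ (FW a) c :=
  ((resU a).comp (secU a)).commutes c

/-- `Q` has degree `g < g + 3`, so it equals its Lagrange interpolation at the `aᵢ`, and `fᵢ ≡ ℓ₂
Q(aᵢ)/Π'(aᵢ)`. The scalar `ℓ₂` drops out of logarithmic derivatives. -/
theorem Pf_eq : Pf a = Polynomial.C (resU a (lU a)) * monicF a := by
  have hinj : Function.Injective fun j => algebraMap ℂ (FW a) (a j) :=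
    (algebraMap ℂ (FW a)).injective.comp a.injective
  have h := sum_eraseProd_eq hinj (p := monicF a) (by
    rw [monicF, Polynomial.degree_map, degree_genericMonic]
    exact_mod_cast (by omega : g < g + 3))
  conv_rhs => rw [← h]
  rw [Finset.mul_sum, Pf]
  refine Finset.sum_congr rfl fun i _ => ?_
  rw [← mul_assoc, ← map_mul]
  congr 2
  rw [← resU_apply, resU_X, monicF, eval_map_secU, chiU, aeval_X, resU_secU_div,
    resU_secU_algebraMap, algebraMap_nodeProd]

/-- The coefficients of `Ŵ[φ]` as functions of the `qⱼ`. -/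
def rhoE (φ : Polynomial ℂ) (i : Fin (g + 3)) : RatX g :=
  ((φ.map (algebraMap ℂ (RatX g)) * Polynomial.derivative (genericMonic g)) %ₘ
      genericMonic g).eval (algebraMap ℂ (RatX g) (a i))
    / (genericMonic g).eval (algebraMap ℂ (RatX g) (a i))

theorem wCoef_eq (φ : Polynomial ℂ) (i : Fin (g + 3)) :
    wCoef a φ i = resU a (secU a (rhoE a φ i)) := by
  have hb : (monicF a).eval (algebraMap ℂ (FW a) (a i)) ≠ 0 := by
    rw [monicF, eval_map_secU]
    intro h
    exact genericMonic_eval_ne_zero (a i)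
      (resU_secU_injective a (h.trans (by simp)))
  have hφ : φ.map (algebraMap ℂ (FW a)) = (φ.map (algebraMap ℂ (RatX g))).map
      ((resU a).comp (secU a) : RatX g →+* FW a) := by
    rw [Polynomial.map_map]
    congr 1
    exact (AlgHom.comp_algebraMap ((resU a).comp (secU a))).symm
  rw [wCoef, Pf_eq, resInfty_logDeriv (monicF_monic a) _ hb (resU_lU_ne_zero a), rhoE,
    resU_secU_div, ← eval_map_secU, ← eval_map_secU, Polynomial.map_modByMonic _ genericMonic_monic,
    Polynomial.map_mul, ← Polynomial.derivative_map, hφ]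
  rfl

theorem isLift_secU (φ : Polynomial ℂ) : IsLift a φ fun i => secU a (rhoE a φ i) := fun i =>
  ⟨secU_mem a _, (wCoef_eq a φ i).symm⟩

/-- The coefficients of the image of the vector field `fieldE` on the `𝒰` side. -/
def fieldU (φ : Polynomial ℂ) (i : Fin (g + 3)) : OW a :=
  ∑ m, secU a (fieldE (φ.map (algebraMap ℂ (RatX g))) m) * coeffU a m i

theorem fieldU_mem (φ : Polynomial ℂ) (i : Fin (g + 3)) : fieldU a φ i ∈ homog a 1 :=
  Submodule.sum_mem _ fun m _ => by
    simpa using homog_mul a 0 1 _ _ (secU_mem a _) (coeffU_mem a m i)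

/-- The value `Q(aᵢ)` in `fᵢ ≡ ℓ₂ Q(aᵢ)/Π'(aᵢ)` cancels the denominator of `rhoE`. What is left is
the remainder `N = φ Q' mod Q` at `aᵢ`; expanding `N(aᵢ)` in powers of `aᵢ` gives the coordinate
fields `coeffU`. -/
theorem resU_fieldU {φ : Polynomial ℂ} {r : Fin (g + 3) → OW a} (hr : IsLift a φ r)
    (i : Fin (g + 3)) : resU a (-2 * r i * toOW a (X i)) = resU a (fieldU a φ i) := by
  set Q := genericMonic g
  set N := (φ.map (algebraMap ℂ (RatX g)) * Polynomial.derivative Q) %ₘ Q with hN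
  set b := algebraMap ℂ (RatX g) (a i) with hb
  have hNd : N.degree < g :=
    (Polynomial.degree_modByMonic_lt _ genericMonic_monic).trans_eq degree_genericMonic
  have hn : algebraMap ℂ (RatX g) (nodeProd (⇑a) i) ≠ 0 := by
    simpa using nodeProd_a_ne_zero a i
  have h1 : fieldU a φ i
      = lU a * secU a (-2 * N.eval b / algebraMap ℂ (RatX g) (nodeProd (⇑a) i)) := by
    rw [fieldU, ← sum_coeff_mul_pow hNd, Finset.mul_sum, Finset.sum_div, map_sum, Finset.mul_sum]
    refine Finset.sum_congr rfl fun m _ => ?_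
    rw [coeffU, ← AlgHom.commutes (secU a), mul_left_comm, ← map_mul, fieldE, ← hN, map_div₀,
      map_pow]
    congr 2
    ring
  have h2 : rhoE a φ i * chiU a (X i) = N.eval b / algebraMap ℂ (RatX g) (nodeProd (⇑a) i) := by
    rw [rhoE, chiU, aeval_X, div_mul_div_cancel₀ (genericMonic_eval_ne_zero (a i))]
  have hr' : resU a (r i) = resU a (secU a (rhoE a φ i)) := (hr i).2.trans (wCoef_eq a φ i)
  rw [h1, map_mul, map_mul, resU_X, hr', map_mul, mul_div_assoc, ← h2, map_mul, map_mul, map_mul,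
    map_mul]
  simp only [map_neg, map_ofNat]
  ring

/-- Lifts matter only modulo `W`, so every representative differs from the image of `fieldE` by an
element that dies in the quotient; this gives both membership in the normalizer and independence of
the lift. -/
theorem linForm_sub_mem {φ : Polynomial ℂ} {r : Fin (g + 3) → OW a} (hr : IsLift a φ r) :
    linForm (fun i => -2 * r i * toOW a (X i)) - linForm (fieldU a φ) ∈ WC a * BWdeg a (-1) := by
  rw [linForm_sub, mem_WC_mul_iff]
  constructor
  · refine linForm_mem_BWdeg a fun i => sub_mem ?_ (fieldU_mem a φ i)
    have e : (-2 : OW a) = algebraMap ℂ (OW a) (-2) := by rw [map_neg, map_ofNat]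
    rw [mul_assoc, e, ← Algebra.smul_def]
    exact Submodule.smul_mem _ _ (homog_mul a 0 1 _ _ (hr i).1 (X_mem_homog a i))
  · rw [redU_linForm]
    have : ∀ i, resU a (-2 * r i * toOW a (X i) - fieldU a φ i) = 0 := fun i => by
      rw [map_sub, resU_fieldU a hr, sub_self]
    simp only [this]
    simp [linForm]

theorem classicalU_linForm (φ : Polynomial ℂ) :
    (classicalU a (linForm (fieldE (φ.map (algebraMap ℂ (RatX g))))) : BW a)
      = linForm (fieldU a φ) := symbolMap_linForm _

theorem sum_C_mul_vcl (r : Fin (g + 3) → OW a) :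
    ∑ i, C (r i) * vcl a i = linForm fun i => -2 * r i * toOW a (X i) := by
  refine Finset.sum_congr rfl fun i _ => ?_
  rw [vcl, map_mul, map_mul]
  have : (C (-2) : BW a) = -2 := by rw [map_neg, map_ofNat]
  rw [this]
  ring

theorem sum_coef_mul_hhat (r : Fin (g + 3) → OW a) :
    ∑ i, coef (derU a) (r i) * hhat a i
      = nord (derU a) (linForm fun i => -2 * r i * toOW a (X i)) := by
  rw [nord_linForm]
  refine Finset.sum_congr rfl fun i _ => ?_
  have : coef (derU a) (-2) = -2 := by rw [map_neg, map_ofNat]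
  rw [hhat, ← this, ← mul_assoc, ← mul_assoc, ← map_mul, ← map_mul, mul_comm (r i)]

theorem IsWcl.mem {φ : Polynomial ℂ} {w : BW a} (hw : IsWcl a φ w) : w ∈ Ncl0 a := by
  obtain ⟨r, hr, rfl⟩ := hw
  rw [sum_C_mul_vcl]
  have h := (mem_WC_mul_iff a).mp (linForm_sub_mem a hr)
  have := add_mem (mem_Ncl0_of_redU_eq_zero a h.1 h.2)
    (classicalU a (linForm (fieldE (φ.map (algebraMap ℂ (RatX g)))))).2
  rwa [classicalU_linForm, sub_add_cancel] at this

theorem IsWcl.mkSU_eq {φ : Polynomial ℂ} {w : BW a} (hw : IsWcl a φ w) :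
    mkSU a ⟨w, hw.mem⟩ = mkSU a (classicalU a (linForm (fieldE (φ.map (algebraMap ℂ (RatX g)))))) := by
  have h : redU a (w - linForm (fieldU a φ)) = 0 := by
    obtain ⟨r, hr, rfl⟩ := hw
    rw [sum_C_mul_vcl]
    exact redU_eq_zero_of_mem a (linForm_sub_mem a hr)
  rw [mkSU_eq_iff, classicalU_linForm, ← sub_eq_zero, ← map_sub]
  exact thetaU_eq_zero_of_redU a h

theorem quantumU_vectorField (φ : Polynomial ℂ) :
    (quantumU a (vectorField (derE g) (fieldE (φ.map (algebraMap ℂ (RatX g))))) : AW a)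
      = nord (derU a) (linForm (fieldU a φ)) := by
  rw [nord_linForm]
  exact crossedMap_vectorField _ _

theorem IsWhat.mem {φ : Polynomial ℂ} {w : AW a} (hw : IsWhat a φ w) : w ∈ N0 a := by
  obtain ⟨r, hr, rfl⟩ := hw
  rw [sum_coef_mul_hhat, nord_mem_N0_iff, ← sum_C_mul_vcl]
  exact IsWcl.mem a ⟨r, hr, rfl⟩

theorem IsWhat.mkAU_eq {φ : Polynomial ℂ} {w : N0 a} (hw : IsWhat a φ w) :
    mkAU a w = mkAU a (quantumU a
      (vectorField (derE g) (fieldE (φ.map (algebraMap ℂ (RatX g)))))) := by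
  obtain ⟨r, hr, h⟩ := hw
  have hz := (nord_mem_WQ_mul_iff a).mpr (linForm_sub_mem a hr)
  have e : w = quantumU a (vectorField (derE g) (fieldE (φ.map (algebraMap ℂ (RatX g)))))
      + ⟨_, WQ_mul_AWdeg_le_N0 a hz⟩ := by
    apply Subtype.ext
    rw [h, sum_coef_mul_hhat, Subalgebra.coe_add, quantumU_vectorField, ← map_add,
      add_sub_cancel]
  rw [e, map_add, mkAU_eq_zero a (x := ⟨_, WQ_mul_AWdeg_le_N0 a hz⟩) (Or.inl hz), add_zero]

theorem exists_isWhat (φ : Polynomial ℂ) : ∃ w, IsWhat a φ w := ⟨_, _, isLift_secU a φ, rfl⟩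

theorem exists_isWcl (φ : Polynomial ℂ) : ∃ w, IsWcl a φ w := ⟨_, _, isLift_secU a φ, rfl⟩

/-! ### Elementary symmetric functions -/

/-- Vieta for `g + 2` roots: the coefficient of index `g - k` is the elementary symmetric function
of degree `k + 2`, whence the shift by `2` in the formulas for `Λ̂`. -/
theorem eraseProd_coeff_eq_esymmErase (i : Fin (g + 3)) {k : ℕ} (hk : k ≤ g) :
    (eraseProd (⇑a) i).coeff (g - k) = (-1) ^ k * esymmErase a (k + 2) i := by
  have hc : Multiset.card ((Finset.univ.erase i).val.map a) = g + 2 := by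
    rw [Multiset.card_map, Finset.card_val, Finset.card_erase_of_mem (Finset.mem_univ i)]
    simp
  have h := Multiset.prod_X_sub_C_coeff ((Finset.univ.erase i).val.map a) (k := g - k) (by omega)
  rw [hc, show g + 2 - (g - k) = k + 2 by omega, Finset.esymm_map_val, Multiset.map_map, pow_add] at h
  refine h.trans ?_
  rw [esymmErase]
  ring

theorem secU_esymm {k : ℕ} (h1 : 1 ≤ k) (hk : k ≤ g) :
    secU a ((-1) ^ k * xvar ⟨g - k, by omega⟩) = ∑ i, esymmErase a (k + 2) i • fbarO a i := by
  rw [map_mul, secU_xvar, map_pow, map_neg, map_one, coefO, Finset.mul_sum]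
  refine Finset.sum_congr rfl fun i _ => ?_
  rw [eraseProd_coeff_eq_esymmErase a i hk, Algebra.smul_def, Algebra.smul_def, map_mul, map_pow,
    map_neg, map_one, ← mul_assoc, ← mul_assoc, ← mul_pow]
  simp

theorem mkAU_quantumU_esymm {k : ℕ} (h1 : 1 ≤ k) (hk : k ≤ g) :
    mkAU a (quantumU a (coef (derE g) ((-1) ^ k * xvar ⟨g - k, by omega⟩)))
      = ∑ i, esymmErase a (k + 2) i • mkAU a (fbar a i) := by
  have e : quantumU a (coef (derE g) ((-1) ^ k * xvar ⟨g - k, by omega⟩))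
      = ∑ i, esymmErase a (k + 2) i • fbar a i := by
    apply Subtype.ext
    rw [coe_quantumU, crossedMap_coef, secU_esymm a h1 hk, map_sum, AddSubmonoidClass.coe_finsetSum]
    exact Finset.sum_congr rfl fun i _ => map_smul _ _ _
  rw [e, map_sum]
  exact Finset.sum_congr rfl fun i _ => map_smul _ _ _

theorem mkSU_classicalU_esymm {k : ℕ} (h1 : 1 ≤ k) (hk : k ≤ g) :
    mkSU a (classicalU a (C ((-1) ^ k * xvar ⟨g - k, by omega⟩)))
      = ∑ i, esymmErase a (k + 2) i • mkSU a (ubar a i) := by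
  have e : classicalU a (C ((-1) ^ k * xvar ⟨g - k, by omega⟩))
      = ∑ i, esymmErase a (k + 2) i • ubar a i := by
    apply Subtype.ext
    rw [coe_classicalU, symbolMap_C, secU_esymm a h1 hk, map_sum, AddSubmonoidClass.coe_finsetSum]
    refine Finset.sum_congr rfl fun i _ => ?_
    rw [Algebra.smul_def, map_mul, Subalgebra.coe_smul, Algebra.smul_def]
    rfl
  rw [e, map_sum]
  exact Finset.sum_congr rfl fun i _ => map_smul _ _ _

/-! ### The isomorphisms -/

theorem apply_xvar_of_esymm {B : Type} [Semiring B] [Algebra ℂ B] {F G : RatX g →ₐ[ℂ] B}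
    (h : ∀ (k : ℕ) (_ : 1 ≤ k) (_ : k ≤ g), F ((-1) ^ k * xvar ⟨g - k, by omega⟩)
      = G ((-1) ^ k * xvar ⟨g - k, by omega⟩)) (j : Fin g) : F (xvar j) = G (xvar j) := by
  have hj := j.2
  have h2 := h (g - j) (by omega) (by omega)
  have e : (⟨g - (g - j), by omega⟩ : Fin g) = j := Fin.ext (by simp; omega)
  rw [e] at h2
  have h3 : xvar j = ((-1 : ℂ) ^ (g - (j : ℕ))) • ((-1) ^ (g - (j : ℕ)) * xvar j) := by
    rw [Algebra.smul_def, map_pow, map_neg, map_one, ← mul_assoc, ← mul_pow]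
    simp
  rw [h3, map_smul, map_smul, h2]

/-- The prescribed values are the images of generators of `ℂ(q)[∂/∂q]` under the two comparison
maps, so the conditions say exactly that `L` closes the triangle. -/
theorem isQuantumGNR_iff (L : AX a ≃ₐ[ℂ] AU a) :
    IsQuantumGNR a L ↔ ∀ x, L (quantumX a x) = mkAU a (quantumU a x) := by
  constructor
  · rintro ⟨h1, h2⟩ x
    have H : (L : AX a →ₐ[ℂ] AU a).comp (quantumX a) = (mkAU a).comp (quantumU a) := by
      apply quantum_hom_ext
      · refine apply_xvar_of_esymm (F := ((L : AX a →ₐ[ℂ] AU a).comp (quantumX a)).comp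
          (coef (derE g))) (G := ((mkAU a).comp (quantumU a)).comp (coef (derE g))) ?_
        intro k hk1 hk
        change L (quantumX a (coef (derE g) _)) = mkAU a (quantumU a (coef (derE g) _))
        rw [quantumX_coef_esymm a hk1 hk, mkAU_quantumU_esymm a hk1 hk, h1 k hk1 hk]
      · intro φ
        obtain ⟨w, hw⟩ := exists_isWhat a φ
        have e : mkAU a ⟨w, hw.mem⟩ = _ := IsWhat.mkAU_eq a (w := ⟨w, hw.mem⟩) hw
        change L (quantumX a _) = mkAU a (quantumU a _)
        rw [quantumX_vectorField, ← e]
        exact h2 φ ⟨w, hw.mem⟩ hw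
    exact congrArg (fun f => f x) H
  · intro h
    refine ⟨fun k hk1 hk => ?_, fun φ w hw => ?_⟩
    · rw [← quantumX_coef_esymm a hk1 hk, h, mkAU_quantumU_esymm a hk1 hk]
    · rw [← quantumX_vectorField, h, hw.mkAU_eq]

theorem existsUnique_quantum : ∃! L : AX a ≃ₐ[ℂ] AU a, IsQuantumGNR a L := by
  refine ⟨(AlgEquiv.ofBijective _ (quantumX_bijective a)).symm.trans
    (AlgEquiv.ofBijective _ (quantumU_bijective a)), ?_, ?_⟩
  · refine (isQuantumGNR_iff a _).mpr fun x => ?_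
    have h : (AlgEquiv.ofBijective _ (quantumX_bijective a)).symm (quantumX a x) = x :=
      (AlgEquiv.ofBijective _ (quantumX_bijective a)).symm_apply_apply x
    rw [AlgEquiv.trans_apply, h]
    rfl
  · intro L hL
    refine AlgEquiv.ext fun y => ?_
    obtain ⟨x, rfl⟩ := (quantumX_bijective a).2 y
    have h : (AlgEquiv.ofBijective _ (quantumX_bijective a)).symm (quantumX a x) = x :=
      (AlgEquiv.ofBijective _ (quantumX_bijective a)).symm_apply_apply x
    rw [(isQuantumGNR_iff a L).mp hL x, AlgEquiv.trans_apply, h]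
    rfl

theorem isHomogeneous_classicalX_iff (k : ℕ) (p : MvPolynomial (Fin g) (RatX g)) :
    (classicalX a p : MvPolynomial (Fin g) (RatX g)).IsHomogeneous k ↔ p.IsHomogeneous k :=
  ⟨fun h => isHomogeneous_of_symbolMap (f := rootEmb g) (c := coeffX a) (symbolMapX_injective a) h,
    fun h => symbolMap_isHomogeneous (f := rootEmb g) (c := coeffX a) h⟩

/-- The formulas alone force the triangle to commute; gradedness and the Poisson property are then
inherited from `ℂ(q)[ξ]` through both comparison maps. -/
theorem isClassicalGNR_iff (L : SX g ≃ₐ[ℂ] SU a) :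
    IsClassicalGNR a L ↔ ∀ p, L (classicalX a p) = mkSU a (classicalU a p) := by
  constructor
  · intro hL p
    have H : (L : SX g →ₐ[ℂ] SU a).comp (classicalX a) = (mkSU a).comp (classicalU a) := by
      apply classical_hom_ext
      · refine apply_xvar_of_esymm (F := ((L : SX g →ₐ[ℂ] SU a).comp (classicalX a)).comp
          (IsScalarTower.toAlgHom ℂ (RatX g) (MvPolynomial (Fin g) (RatX g))))
          (G := ((mkSU a).comp (classicalU a)).comp
            (IsScalarTower.toAlgHom ℂ (RatX g) (MvPolynomial (Fin g) (RatX g)))) ?_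
        intro k hk1 hk
        change L (classicalX a (C _)) = mkSU a (classicalU a (C _))
        rw [classicalX_C_esymm a hk1 hk, mkSU_classicalU_esymm a hk1 hk, hL.esymm k hk1 hk]
      · intro φ
        obtain ⟨w, hw⟩ := exists_isWcl a φ
        obtain ⟨h, e⟩ := hL.residue φ w hw
        change L (classicalX a _) = mkSU a (classicalU a _)
        rw [classicalX_linForm, e, ← hw.mkSU_eq]
    exact congrArg (fun f => f p) H
  · intro h
    refine ⟨fun k hk1 hk => ?_, fun φ w hw => ⟨hw.mem, ?_⟩, fun k y => ?_, fun y y' q q' e e' => ?_⟩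
    · rw [← classicalX_C_esymm a hk1 hk, h, mkSU_classicalU_esymm a hk1 hk]
    · rw [← classicalX_linForm, h, hw.mkSU_eq]
    · obtain ⟨p, rfl⟩ := (classicalX_bijective a).2 y
      rw [isHomogeneous_classicalX_iff, classicalU_graded a, h]
    · obtain ⟨p, rfl⟩ := (classicalX_bijective a).2 y
      obtain ⟨p', rfl⟩ := (classicalX_bijective a).2 y'
      rw [h] at e e'
      have hb : (classicalX a (bracket (derE g) p p') : MvPolynomial (Fin g) (RatX g))
          = bracket (derX a) (classicalX a p : MvPolynomial (Fin g) (RatX g)) (classicalX a p') :=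
        symbolMap_bracket (derivationChangeX a) p p'
      have hbU : classicalU a (bracket (derE g) p p') = ⟨bracket (derU a) (classicalU a p : BW a)
          (classicalU a p'), bracket_mem_Ncl0 a (classicalU a p).2 (classicalU a p').2⟩ :=
        Subtype.ext (symbolMap_bracket (derivationChangeU a) p p')
      refine ⟨hb ▸ (classicalX a (bracket (derE g) p p')).2, bracket_mem_Ncl0 a q.2 q'.2, ?_⟩
      rw [← mkSU_bracket a e e', ← hbU, ← h]
      exact congrArg L (Subtype.ext hb.symm)

theorem existsUnique_classical : ∃! L : SX g ≃ₐ[ℂ] SU a, IsClassicalGNR a L := by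
  refine ⟨(AlgEquiv.ofBijective _ (classicalX_bijective a)).symm.trans
    (AlgEquiv.ofBijective _ (classicalU_bijective a)), ?_, ?_⟩
  · refine (isClassicalGNR_iff a _).mpr fun x => ?_
    have h : (AlgEquiv.ofBijective _ (classicalX_bijective a)).symm (classicalX a x) = x :=
      (AlgEquiv.ofBijective _ (classicalX_bijective a)).symm_apply_apply x
    rw [AlgEquiv.trans_apply, h]
    rfl
  · intro L hL
    refine AlgEquiv.ext fun y => ?_
    obtain ⟨x, rfl⟩ := (classicalX_bijective a).2 y
    have h : (AlgEquiv.ofBijective _ (classicalX_bijective a)).symm (classicalX a x) = x :=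
      (AlgEquiv.ofBijective _ (classicalX_bijective a)).symm_apply_apply x
    rw [(isClassicalGNR_iff a L).mp hL x, AlgEquiv.trans_apply, h]
    rfl

theorem isQuantizationOf_of {M : AX a ≃ₐ[ℂ] AU a} {L : SX g ≃ₐ[ℂ] SU a} (hM : IsQuantumGNR a M)
    (hL : IsClassicalGNR a L) : IsQuantizationOf a M L := by
  rw [isQuantumGNR_iff] at hM
  rw [isClassicalGNR_iff] at hL
  refine ⟨fun k => ?_, fun k x p hx => ?_⟩
  · rw [← quantumX_filt, ← quantumU_filt, Set.image_image]
    exact Set.image_congr fun e _ => hM e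
  · obtain ⟨e, rfl⟩ := (quantumX_bijective a).2 x
    obtain ⟨s, rfl⟩ := (classicalX_bijective a).2 p
    have hs : s.IsHomogeneous k := (isHomogeneous_classicalX_iff a k s).mp hx.1
    refine ⟨quantumU a e, classicalU a s, (hM e).symm, (hL s).symm, symbolMap_isHomogeneous hs, ?_⟩
    -- The symbol condition is pulled back to the model: strictness of the filtration
    -- (`quantumX_filt`) and injectivity give `e - nord s` order `k - 1`, and the `𝒰` comparison map
    -- pushes this forward.
    have h1 : quantumX a (e - nord (derE g) s) ∈ filtAX a ((k : ℤ) - 1) := by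
      have h2 := sub_mem hx.2 (crossedMap_nord_hasSymbol (derivationChangeX a) hs).2
      have e2 : ((quantumX a (e - nord (derE g) s) : AX a) : AXfull a)
          = (quantumX a e : AXfull a) - nord (derX a) (classicalX a s : MvPolynomial (Fin g) (RatX g))
            - (crossedMap (derivationChangeX a) (nord (derE g) s)
              - nord (derX a) (symbolMap (rootEmb g) (coeffX a) s)) := by
        rw [coe_quantumX, coe_quantumX, coe_classicalX, map_sub]
        abel
      change ((quantumX a (e - nord (derE g) s) : AX a) : AXfull a) ∈ filt (derX a) _
      rw [e2]
      exact h2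
    rw [← quantumX_filt] at h1
    obtain ⟨e', he', h'⟩ := h1
    rw [(quantumX_bijective a).1 h'] at he'
    have h3 := add_mem (crossedMap_mem_filt (derivationChangeU a) he')
      (crossedMap_nord_hasSymbol (derivationChangeU a) hs).2
    rw [map_sub, sub_add_sub_cancel] at h3
    exact h3

end Main

end

end GNR

open GNR

theorem mainTheorem6 (g : ℕ) (a : Fin (g + 3) ↪ ℂ) :
    (∀ φ : Polynomial ℂ, (∃ w, IsWhat a φ w) ∧ ∀ w, IsWhat a φ w → w ∈ N0 a) ∧
    (∃! L : AX a ≃ₐ[ℂ] AU a, IsQuantumGNR a L) ∧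
    (∃! L : SX g ≃ₐ[ℂ] SU a, IsClassicalGNR a L) ∧
    (∀ (M : AX a ≃ₐ[ℂ] AU a) (L : SX g ≃ₐ[ℂ] SU a),
      IsQuantumGNR a M → IsClassicalGNR a L → IsQuantizationOf a M L) :=
  ⟨fun φ => ⟨exists_isWhat a φ, fun _ hw => hw.mem⟩, existsUnique_quantum a,
    existsUnique_classical a, fun _ _ => isQuantizationOf_of a⟩
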